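/- **Terms.** Fix a set of constants and a set of instantiatable variables. *De Bruijn terms* are constants $c$, instantiatable variables $x$, variable references $\#i$ ($i\ge 1$), applications $(t_1\ t_2)$ and abstractions $(\lambda\,t)$. Put $S(\#i;s_1,s_2,\dots)=s_i$ and $S((\lambda\,t);s_1,s_2,\dots)=(\lambda\,S(t;\#1,s_1',s_2',\dots))$ with $s_i'=S(s_i;\#2,\#3,\dots)$, and let $S$ commute with application and fix $c$ and $x$. The $\beta$-contraction rule, applied to any subterm, is $((\lambda\,t_1)\ t_2)\to S(t_1;t_2,\#1,\#2,\dots)$; $\beta$-reduction is its reflexive-transitive closure. A *head normal form* is a term $(\lambda\cdots(\lambda\,(\cdots(h\ t_1)\cdots t_m))\cdots)$, with $n\ge 0$ abstractions and $m\ge0$, whose head $h$ is a constant, an instantiatable variable or a variable reference. A head normal form of $d$ is one to which $d$ $\beta$-reduces. *Suspension terms* have in addition the suspensions $[\![t,ol,nl,e]\!]$ with $ol,nl\in\mathbb N$ and $e$ a finite list of items $@l$ or $(s,l)$, where $s$ is a suspension term and $l\in\mathbb N$. A suspension term is *well-formed* if for each suspension $[\![t,ol,nl,e]\!]$ in it $e$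 has length $ol$, $l<nl$ for each item $@l$ of $e$, and $l\le nl$ for each item $(s,l)$ of $e$. The *reading rules* are $[\![c,ol,nl,e]\!]\to c$; $[\![x,ol,nl,e]\!]\to x$; $[\![\#i,ol,nl,e]\!]\to\#(i-ol+nl)$ if $i>ol$; $[\![\#i,ol,nl,e]\!]\to\#(nl-l)$ if $i\le ol$, $e[i]=@l$; $[\![\#i,ol,nl,e]\!]\to[\![t,0,nl-l,nil]\!]$ if $i\le ol$, $e[i]=(t,l)$; $[\![(t_1\ t_2),ol,nl,e]\!]\to([\![t_1,ol,nl,e]\!]\ [\![t_2,ol,nl,e]\!])$; $[\![(\lambda\,t),ol,nl,e]\!]\to(\lambda\,[\![t,ol+1,nl+1,@nl::e]\!])$; $[\![[\![t,ol,nl,e]\!],0,nl',nil]\!]\to[\![t,ol,nl+nl',e]\!]$; $[\![t,0,0,nil]\!]\to t$; and, for $i\le ol$ and $e[i]=(t,l)$: $[\![\#i,ol,nl,e]\!]\to t$ if $nl=l$; $[\![\#i,ol,nl,e]\!]\to[\![s,ol',nl'+nl-l,e']\!]$ if $nl\ne l$ and $t=[\![s,ol',nl',e']\!]$; $[\![\#i,ol,nl,e]\!]\to[\![t,0,nl-l,nil]\!]$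 if $nl\neq l$ and $t$ is not a suspension. The *rewrite rules* are these together with $(\beta_s)$ $((\lambda\,t_1)\ t_2)\to[\![t_1,1,0,(t_2,0)::nil]\!]$ and $(\beta_s')$ $((\lambda\,[\![t_1,ol+1,nl+1,@nl::e]\!])\ t_2)\to[\![t_1,ol+1,nl,(t_2,nl)::e]\!]$. Rules apply to any subterm, also inside environments. A *generalized head normal form* of a suspension term $t$ is a suspension term that has the shape of a head normal form, with arbitrary suspension terms as arguments $t_1,\dots,t_m$, and that can be obtained from $t$ by a finite (perhaps empty) series of applications of the rewrite rules. **Program.** Terms are represented on a heap by references of the SML type `term = rawterm ref`, where ``` datatype rawterm = const of string | fv of string | bv of int | ptr of (rawterm ref) | lam of (rawterm ref) | app of (rawterm ref) * (rawterm ref) | susp of (rawterm ref) * int * int * (eitem list) and eitem = dum of int | bndg of (rawterm ref) * int ``` Here `const`, `fv`, `bv(i)`, `lam`, `app`, `susp` stand for $c$, $x$, $\#i$, abstraction, application and suspension, `dum(l)` and `bndg(t,l)` for the items $@l$ and $(t,l)$, and `ptr` is an indirection, transparent to the represented term. Subterms may be shared. A reference is *acyclic* if no cycle of the directed graph formed by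 the heap can be reached from it. The procedure `head_norm3` is defined by ``` fun deref(term as ref(ptr(t))) = deref(t) | deref(term) = term fun assign(t1,ref(ptr(t))) = assign(t1,t) | assign(t1,t2) = t1 := ptr(t2) fun nth(x::l,1) = x | nth(x::l,n) = nth(l,n-1) fun build_lam(term,body,0,0) = (term,0,0,nil) | build_lam(term,body,ol,nl) = (ref(lam(body)),0,0,nil) fun update_app(term,(t,0,0,nil),0,0) = (assign(term,t); (t,0,0,nil)) | update_app(term,s,ol,nl) = s fun build_app(term,f,arg,0,0,nil) = (assign(term,ref(app(f,arg))); (term,0,0,nil)) | build_app(term,f,arg,ol,nl,env) = (ref(app(f,ref(susp(arg,ol,nl,env)))),0,0,nil) fun mk_explicit(term,(t,0,0,nil),_,_) = (assign(term,t); (t,0,0,nil)) | mk_explicit(term,(t,ol,nl,env),0,0) = (assign(term,ref(susp(t,ol,nl,env))); (t,ol,nl,env)) | mk_explicit(term,(ref(lam(t)),ol,nl,env),ol',nl') = (assign(term,ref(lam(ref(susp(t,ol+1,nl+1,dum(nl)::env))))); (term,0,0,nil)) fun arg(t,0,0,nil) = t | arg(t,ol,nl,env) = ref(susp(t,ol,nl,env))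 fun hn_co(term as ref(bv(i)),0,0,[],_) = (term,0,0,[]) | hn_co(term as ref(bv(i)),ol,nl,env,w) = if (i > ol) then (ref(bv(i-ol+nl)),0,0,nil) else (fn dum(l) => (ref(bv(nl-l)),0,0,nil) | bndg(t,l) => if (nl = l) then hn_co(t,0,0,nil,w) else (fn ref(susp(t2,o,n,e)) => hn_co(t2,o,n+nl-l,e,w) | t => hn_co(t,0,nl-l,[],w))(deref(t)))(nth(env,i)) | hn_co(term as ref(lam(t)),ol,nl,env,true) = (term,ol,nl,env) | hn_co(term as ref(lam(t)),ol,nl,env,w) = let val (t',o,n,e) = if (ol=0) andalso (nl=0) then hn_co(t,0,0,[],w) else hn_co(t,ol+1,nl+1,dum(nl)::env,w) in build_lam(term,t',ol,nl) end | hn_co(term as ref(app(t1,t2)),ol,nl,env,w) = let val (f,fo,fl,fe) = hn_co(t1,ol,nl,env,true) in (fn ref(lam(t)) => let val s = hn_co(t,fo+1,fl,bndg(arg(t2,ol,nl,env),fl)::fe,w) in update_app(term,s,ol,nl) end | t => build_app(term,t,t2,ol,nl,env))(deref(f)) end | hn_co(term as ref(susp(t,ol,nl,env)),ol',nl',env',whnf)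 = let val s = mk_explicit(term,hn_co(t,ol,nl,env,whnf),ol',nl') in if (ol'=0) andalso (nl'=0) then s else hn_co(term,ol',nl',env',whnf) end | hn_co(ref(ptr(t)),ol,nl,env,whnf) = hn_co(deref(t),ol,nl,env,whnf) | hn_co(term,_,_,_,_) = (term,0,0,nil) fun head_norm3(t) = hn_co(t,0,0,nil,false) ``` **Theorem.** Let $t'$ be an acyclic reference to the representation of a well-formed suspension term $t$, and suppose that the reading rules transform $t$ into a de Bruijn term $d$ that has a head normal form. Then the call `head_norm3(t')` terminates (without a failure). When it does, every reference that was acyclic before the call is acyclic, and $t'$ is a reference to the representation of a well-formed suspension term $r$ that is a generalized head normal form of the original term $t$. Moreover the reading rules transform $r$ into a de Bruijn term that is a head normal form of $d$. -/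

import Mathlib

namespace Suspension

/-! ## De Bruijn terms

`C` is the set of constants and `V` the set of instantiatable variables.
Indices are counted from `0`: `idx k` is the variable reference written `#(k+1)`. -/

inductive DTerm (C V : Type*) where
  | const (c : C)
  | ivar (x : V)
  | idx (k : ℕ)
  | app (t₁ t₂ : DTerm C V)
  | lam (t : DTerm C V)

/-- The sequence `x, s 0, s 1, …`. -/
def scons {α : Type*} (x : α) (s : ℕ → α) : ℕ → α
  | 0 => x
  | n + 1 => s n

namespace DTerm

variable {C V : Type*}

/-- Renaming of the free variables: `S(t; #(f 0 + 1), #(f 1 + 1), …)`. -/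
def rename : DTerm C V → (ℕ → ℕ) → DTerm C V
  | const c, _ => const c
  | ivar x, _ => ivar x
  | idx k, f => idx (f k)
  | app t₁ t₂, f => app (t₁.rename f) (t₂.rename f)
  | lam t, f => lam (t.rename (scons 0 fun i => f i + 1))

/-- Simultaneous substitution `S(t; s 0, s 1, …)`.  See `subst_lam` for the clause for
abstractions in its usual form. -/
def subst : DTerm C V → (ℕ → DTerm C V) → DTerm C V
  | const c, _ => const c
  | ivar x, _ => ivar x
  | idx k, s => s k
  | app t₁ t₂, s => app (t₁.subst s) (t₂.subst s)
  | lam t, s => lam (t.subst (scons (idx 0) fun i => (s i).rename Nat.succ))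

theorem rename_eq_subst (t : DTerm C V) (f : ℕ → ℕ) :
    t.rename f = t.subst fun i => idx (f i) := by
  induction t generalizing f with
  | const c => rfl
  | ivar x => rfl
  | idx k => rfl
  | app t₁ t₂ ih₁ ih₂ => simp only [rename, subst, ih₁, ih₂]
  | lam t ih =>
    simp only [rename, subst, ih]
    congr 2
    funext i
    cases i <;> rfl

/-- `S(λ t; s₁, s₂, …) = λ S(t; #1, s₁', s₂', …)` with `sᵢ' = S(sᵢ; #2, #3, …)`. -/
theorem subst_lam (t : DTerm C V) (s : ℕ → DTerm C V) :
    (lam t).subst s =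
      lam (t.subst (scons (idx 0) fun i => (s i).subst fun j => idx (j + 1))) := by
  simp only [subst, rename_eq_subst]

/-- One β-contraction, at any position: `(λ t₁) t₂ ▷ S(t₁; t₂, #1, #2, …)`. -/
inductive Beta : DTerm C V → DTerm C V → Prop
  | contract (t₁ t₂ : DTerm C V) : Beta (app (lam t₁) t₂) (t₁.subst (scons t₂ idx))
  | appL {t t' : DTerm C V} (s : DTerm C V) : Beta t t' → Beta (app t s) (app t' s)
  | appR {t t' : DTerm C V} (s : DTerm C V) : Beta t t' → Beta (app s t) (app s t')
  | lam {t t' : DTerm C V} : Beta t t' → Beta (lam t) (lam t')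

/-- β-reduction: a finite, possibly empty, series of contractions. -/
def BetaStar : DTerm C V → DTerm C V → Prop := Relation.ReflTransGen Beta

/-- Terms `(… (h t₁) … tₘ)` with `m ≥ 0`, where the head `h` is a constant, an
instantiatable variable or a variable reference. -/
inductive IsHeadApp : DTerm C V → Prop
  | const (c : C) : IsHeadApp (const c)
  | ivar (x : V) : IsHeadApp (ivar x)
  | idx (k : ℕ) : IsHeadApp (idx k)
  | app {t : DTerm C V} (s : DTerm C V) : IsHeadApp t → IsHeadApp (app t s)

/-- Head normal forms `λ … λ (… (h t₁) … tₘ)`. -/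
inductive IsHNF : DTerm C V → Prop
  | body {t : DTerm C V} : IsHeadApp t → IsHNF t
  | lam {t : DTerm C V} : IsHNF t → IsHNF (lam t)

/-- `s` is a head normal form of `t`. -/
def IsHNFOf (s t : DTerm C V) : Prop := IsHNF s ∧ BetaStar t s

def HasHNF (t : DTerm C V) : Prop := ∃ s, IsHNFOf s t

end DTerm

/-! ## Suspension terms -/

/-- Environment items: `dum l` is `@l` and `bndg t l` is `(t, l)`.  The type `α` is that of
suspension terms in the calculus, and that of references in the program. -/
inductive EItem (α : Type*) where
  | dum (l : ℕ)
  | bndg (t : α) (l : ℕ)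

/-- Suspension terms; `susp t ol nl e` is `⟦t, ol, nl, e⟧`, and `idx k` is `#(k+1)`. -/
inductive STerm (C V : Type*) where
  | const (c : C)
  | ivar (x : V)
  | idx (k : ℕ)
  | app (t₁ t₂ : STerm C V)
  | lam (t : STerm C V)
  | susp (t : STerm C V) (ol nl : ℕ) (e : List (EItem (STerm C V)))

/-- A de Bruijn term as a suspension term. -/
def DTerm.toSTerm {C V : Type*} : DTerm C V → STerm C V
  | .const c => .const c
  | .ivar x => .ivar x
  | .idx k => .idx k
  | .app t₁ t₂ => .app t₁.toSTerm t₂.toSTerm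
  | .lam t => .lam t.toSTerm

namespace STerm

variable {C V : Type*}

/-- In every suspension `⟦t, ol, nl, e⟧`, the list `e` has length `ol`, every item `@l` of `e`
has `l < nl`, and every item `(s, l)` of `e` has `l ≤ nl`. -/
inductive WellFormed : STerm C V → Prop
  | const (c : C) : WellFormed (const c)
  | ivar (x : V) : WellFormed (ivar x)
  | idx (k : ℕ) : WellFormed (idx k)
  | app {t₁ t₂ : STerm C V} : WellFormed t₁ → WellFormed t₂ → WellFormed (app t₁ t₂)
  | lam {t : STerm C V} : WellFormed t → WellFormed (lam t)
  | susp {t : STerm C V} {ol nl : ℕ} {e : List (EItem (STerm C V))} :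
      WellFormed t → e.length = ol →
      (∀ l, EItem.dum l ∈ e → l < nl) →
      (∀ s l, EItem.bndg s l ∈ e → l ≤ nl) →
      (∀ s l, EItem.bndg s l ∈ e → WellFormed s) →
      WellFormed (susp t ol nl e)

def IsSusp : STerm C V → Prop
  | susp _ _ _ _ => True
  | _ => False

/-- The reading rules (r1)–(r9), with the enhanced versions (r10)–(r12) of (r5).  Since `idx k`
is `#(k+1)`, the side condition `i > ol` reads `ol ≤ k`, and `e[i]` is `e[k]?`. -/
inductive ReadRule : STerm C V → STerm C V → Prop
  | r1 (c : C) (ol nl : ℕ) (e : List (EItem (STerm C V))) :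
      ReadRule (susp (const c) ol nl e) (const c)
  | r2 (x : V) (ol nl : ℕ) (e : List (EItem (STerm C V))) :
      ReadRule (susp (ivar x) ol nl e) (ivar x)
  | r3 (k ol nl : ℕ) (e : List (EItem (STerm C V))) : ol ≤ k →
      ReadRule (susp (idx k) ol nl e) (idx (k - ol + nl))
  | r4 (k ol nl : ℕ) (e : List (EItem (STerm C V))) (l j : ℕ) : k < ol →
      e[k]? = some (.dum l) → j + 1 + l = nl →
      ReadRule (susp (idx k) ol nl e) (idx j)
  | r5 (k ol nl : ℕ) (e : List (EItem (STerm C V))) (t : STerm C V) (l j : ℕ) : k < ol →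
      e[k]? = some (.bndg t l) → j + l = nl →
      ReadRule (susp (idx k) ol nl e) (susp t 0 j [])
  | r6 (t₁ t₂ : STerm C V) (ol nl : ℕ) (e : List (EItem (STerm C V))) :
      ReadRule (susp (app t₁ t₂) ol nl e) (app (susp t₁ ol nl e) (susp t₂ ol nl e))
  | r7 (t : STerm C V) (ol nl : ℕ) (e : List (EItem (STerm C V))) :
      ReadRule (susp (lam t) ol nl e) (lam (susp t (ol + 1) (nl + 1) (.dum nl :: e)))
  | r8 (t : STerm C V) (ol nl nl' : ℕ) (e : List (EItem (STerm C V))) :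
      ReadRule (susp (susp t ol nl e) 0 nl' []) (susp t ol (nl + nl') e)
  | r9 (t : STerm C V) : ReadRule (susp t 0 0 []) t
  | r10 (k ol nl : ℕ) (e : List (EItem (STerm C V))) (t : STerm C V) : k < ol →
      e[k]? = some (.bndg t nl) →
      ReadRule (susp (idx k) ol nl e) t
  | r11 (k ol nl : ℕ) (e : List (EItem (STerm C V))) (t : STerm C V) (ol' nl' : ℕ)
      (e' : List (EItem (STerm C V))) (l j : ℕ) : k < ol →
      e[k]? = some (.bndg (susp t ol' nl' e') l) → nl ≠ l → j + l = nl →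
      ReadRule (susp (idx k) ol nl e) (susp t ol' (nl' + j) e')
  | r12 (k ol nl : ℕ) (e : List (EItem (STerm C V))) (t : STerm C V) (l j : ℕ) : k < ol →
      e[k]? = some (.bndg t l) → ¬ t.IsSusp → nl ≠ l → j + l = nl →
      ReadRule (susp (idx k) ol nl e) (susp t 0 j [])

/-- The rules (β_s) and (β'_s). -/
inductive BetaRule : STerm C V → STerm C V → Prop
  | beta (t₁ t₂ : STerm C V) :
      BetaRule (app (lam t₁) t₂) (susp t₁ 1 0 [.bndg t₂ 0])
  | beta' (t₁ t₂ : STerm C V) (ol nl : ℕ) (e : List (EItem (STerm C V))) :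
      BetaRule (app (lam (susp t₁ (ol + 1) (nl + 1) (.dum nl :: e))) t₂)
        (susp t₁ (ol + 1) nl (.bndg t₂ nl :: e))

/-- Application of `R` to one subterm, which may lie inside an environment. -/
inductive Compat (R : STerm C V → STerm C V → Prop) : STerm C V → STerm C V → Prop
  | root {t t' : STerm C V} : R t t' → Compat R t t'
  | appL {t t' : STerm C V} (s : STerm C V) : Compat R t t' → Compat R (app t s) (app t' s)
  | appR {t t' : STerm C V} (s : STerm C V) : Compat R t t' → Compat R (app s t) (app s t')
  | lam {t t' : STerm C V} : Compat R t t' → Compat R (lam t) (lam t')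
  | susp {t t' : STerm C V} (ol nl : ℕ) (e : List (EItem (STerm C V))) :
      Compat R t t' → Compat R (susp t ol nl e) (susp t' ol nl e)
  | env {s s' : STerm C V} (t : STerm C V) (ol nl l : ℕ)
      (e₁ e₂ : List (EItem (STerm C V))) : Compat R s s' →
      Compat R (susp t ol nl (e₁ ++ .bndg s l :: e₂)) (susp t ol nl (e₁ ++ .bndg s' l :: e₂))

/-- A finite, possibly empty, series of applications of the reading rules. -/
def ReadStar : STerm C V → STerm C V → Prop := Relation.ReflTransGen (Compat ReadRule)

/-- A finite, possibly empty, series of applications of all the rules. -/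
def RewriteStar : STerm C V → STerm C V → Prop :=
  Relation.ReflTransGen (Compat fun t t' => ReadRule t t' ∨ BetaRule t t')

/-- Terms `(… (h t₁) … tₘ)` with arbitrary suspension terms as arguments. -/
inductive IsHeadApp : STerm C V → Prop
  | const (c : C) : IsHeadApp (const c)
  | ivar (x : V) : IsHeadApp (ivar x)
  | idx (k : ℕ) : IsHeadApp (idx k)
  | app {t : STerm C V} (s : STerm C V) : IsHeadApp t → IsHeadApp (app t s)

/-- Generalized head normal forms: `λ … λ (… (h t₁) … tₘ)` with arbitrary suspension terms
as arguments. -/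
inductive IsGenHNF : STerm C V → Prop
  | body {t : STerm C V} : IsHeadApp t → IsGenHNF t
  | lam {t : STerm C V} : IsGenHNF t → IsGenHNF (lam t)

/-- `r` is a generalized head normal form of `t`. -/
def IsGenHNFOf (r t : STerm C V) : Prop := IsGenHNF r ∧ RewriteStar t r

end STerm

/-! ## The heap -/

/-- SML expressions of type `term = rawterm ref`. -/
abbrev Loc := ℕ

/-- SML expressions of type `rawterm`. -/
inductive Cell (C V : Type*) where
  | const (c : C)
  | fv (x : V)
  | bv (i : ℕ)
  | ptr (t : Loc)
  | lam (t : Loc)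
  | app (t₁ t₂ : Loc)
  | susp (t : Loc) (ol nl : ℕ) (env : List (EItem Loc))

/-- The contents of the locations `0, 1, …` allocated so far. -/
abbrev Heap (C V : Type*) := List (Cell C V)

/-- A term together with an environment; it stands for `⟦t, ol, nl, env⟧`. -/
abbrev Quad := Loc × ℕ × ℕ × List (EItem Loc)

section Graph

variable {C V : Type*}

/-- The references that occur in a cell. -/
inductive Cell.Refers : Cell C V → Loc → Prop
  | ptr (t : Loc) : Refers (.ptr t) t
  | lam (t : Loc) : Refers (.lam t) t
  | appL (t₁ t₂ : Loc) : Refers (.app t₁ t₂) t₁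
  | appR (t₁ t₂ : Loc) : Refers (.app t₁ t₂) t₂
  | susp (t : Loc) (ol nl : ℕ) (env : List (EItem Loc)) : Refers (.susp t ol nl env) t
  | env (t : Loc) (ol nl : ℕ) (env : List (EItem Loc)) (s : Loc) (l : ℕ) :
      EItem.bndg s l ∈ env → Refers (.susp t ol nl env) s

/-- The edges of the directed graph formed by the heap. -/
def Edge (h : Heap C V) (u v : Loc) : Prop := ∃ c, h[u]? = some c ∧ c.Refers v

/-- No cycle can be reached from `t`. -/
def Acyclic (h : Heap C V) (t : Loc) : Prop :=
  ∀ u, Relation.ReflTransGen (Edge h) t u → ¬ Relation.TransGen (Edge h) u u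

mutual

/-- `Represents h t s`: in the heap `h`, the reference `t` refers to a representation of the
suspension term `s`.  Indirections `ptr` are transparent; `bv i` is `#i`, with `i > 0`. -/
inductive Represents (h : Heap C V) : Loc → STerm C V → Prop
  | const {t : Loc} {c : C} : h[t]? = some (.const c) → Represents h t (.const c)
  | fv {t : Loc} {x : V} : h[t]? = some (.fv x) → Represents h t (.ivar x)
  | bv {t : Loc} {k : ℕ} : h[t]? = some (.bv (k + 1)) → Represents h t (.idx k)
  | ptr {t t' : Loc} {s : STerm C V} :
      h[t]? = some (.ptr t') → Represents h t' s → Represents h t s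
  | lam {t t' : Loc} {s : STerm C V} :
      h[t]? = some (.lam t') → Represents h t' s → Represents h t (.lam s)
  | app {t t₁ t₂ : Loc} {s₁ s₂ : STerm C V} :
      h[t]? = some (.app t₁ t₂) → Represents h t₁ s₁ → Represents h t₂ s₂ →
      Represents h t (.app s₁ s₂)
  | susp {t t' : Loc} {ol nl : ℕ} {env : List (EItem Loc)} {s : STerm C V}
      {e : List (EItem (STerm C V))} :
      h[t]? = some (.susp t' ol nl env) → Represents h t' s → RepresentsEnv h env e →
      Represents h t (.susp s ol nl e)

/-- Representation of an environment by a list. -/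
inductive RepresentsEnv (h : Heap C V) :
    List (EItem Loc) → List (EItem (STerm C V)) → Prop
  | nil : RepresentsEnv h [] []
  | dum {l : ℕ} {env : List (EItem Loc)} {e : List (EItem (STerm C V))} :
      RepresentsEnv h env e → RepresentsEnv h (.dum l :: env) (.dum l :: e)
  | bndg {t : Loc} {s : STerm C V} {l : ℕ} {env : List (EItem Loc)}
      {e : List (EItem (STerm C V))} :
      Represents h t s → RepresentsEnv h env e →
      RepresentsEnv h (.bndg t l :: env) (.bndg s l :: e)

end

end Graph

/-! ## The program

The heap is passed along explicitly.  The first argument of a recursive function bounds the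
depth of the recursion: the result is `none` if this depth does not suffice, and also if the
evaluation fails (no clause matches, or a difference of integers is negative).  A call
terminates with a given result if it has this result for every sufficiently large bound. -/

section Program

variable {C V : Type*}

/-- `ref c` -/
def alloc (h : Heap C V) (c : Cell C V) : Heap C V × Loc := (h ++ [c], h.length)

/-- The difference of two integers, required not to be negative. -/
def sub (a b : ℕ) : Option ℕ := if b ≤ a then some (a - b) else none

def deref : ℕ → Heap C V → Loc → Option Loc
  | 0, _, _ => none
  | fuel + 1, h, term =>
    match h[term]? with
    | none => none
    | some (.ptr t) => deref fuel h t
    | some _ => some term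

def assign : ℕ → Heap C V → Loc → Loc → Option (Heap C V)
  | 0, _, _, _ => none
  | fuel + 1, h, t₁, t₂ =>
    match h[t₂]? with
    | none => none
    | some (.ptr t) => assign fuel h t₁ t
    | some _ => some (h.set t₁ (.ptr t₂))

/-- The `i`th item of a list, counted from `1`. -/
def nth {α : Type*} : List α → ℕ → Option α
  | [], _ => none
  | x :: _, 1 => some x
  | _ :: l, n => nth l (n - 1)

def buildLam (h : Heap C V) (term body : Loc) : ℕ → ℕ → Heap C V × Quad
  | 0, 0 => (h, (term, 0, 0, []))
  | _, _ =>
    let (h, r) := alloc h (.lam body)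
    (h, (r, 0, 0, []))

def updateApp (fuel : ℕ) (h : Heap C V) (term : Loc) :
    Quad → ℕ → ℕ → Option (Heap C V × Quad)
  | (t, 0, 0, []), 0, 0 => do
    let h ← assign fuel h term t
    some (h, (t, 0, 0, []))
  | s, _, _ => some (h, s)

def buildApp (fuel : ℕ) (h : Heap C V) (term f arg : Loc) :
    ℕ → ℕ → List (EItem Loc) → Option (Heap C V × Quad)
  | 0, 0, [] => do
    let (h, r) := alloc h (.app f arg)
    let h ← assign fuel h term r
    some (h, (term, 0, 0, []))
  | ol, nl, env =>
    let (h, a) := alloc h (.susp arg ol nl env)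
    let (h, r) := alloc h (.app f a)
    some (h, (r, 0, 0, []))

def mkExplicit (fuel : ℕ) (h : Heap C V) (term : Loc) :
    Quad → ℕ → ℕ → Option (Heap C V × Quad)
  | (t, 0, 0, []), _, _ => do
    let h ← assign fuel h term t
    some (h, (t, 0, 0, []))
  | (t, ol, nl, env), 0, 0 => do
    let (h, r) := alloc h (.susp t ol nl env)
    let h ← assign fuel h term r
    some (h, (t, ol, nl, env))
  | (f, ol, nl, env), _, _ =>
    match h[f]? with
    | some (.lam t) => do
      let (h, a) := alloc h (.susp t (ol + 1) (nl + 1) (.dum nl :: env))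
      let (h, r) := alloc h (.lam a)
      let h ← assign fuel h term r
      some (h, (term, 0, 0, []))
    | _ => none

def arg (h : Heap C V) (t : Loc) : ℕ → ℕ → List (EItem Loc) → Heap C V × Loc
  | 0, 0, [] => (h, t)
  | ol, nl, env => alloc h (.susp t ol nl env)

def hnCo : ℕ → Heap C V → Loc → ℕ → ℕ → List (EItem Loc) → Bool → Option (Heap C V × Quad)
  | 0, _, _, _, _, _, _ => none
  | fuel + 1, h, term, ol, nl, env, whnf =>
    match h[term]? with
    | none => none
    | some (.bv i) =>
      match ol, nl, env with
      | 0, 0, [] => some (h, (term, 0, 0, []))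
      | ol, nl, env =>
        if i > ol then
          let (h, r) := alloc h (.bv (i - ol + nl))
          some (h, (r, 0, 0, []))
        else
          match nth env i with
          | none => none
          | some (.dum l) =>
            (sub nl l).bind fun j =>
              let (h, r) := alloc h (.bv j)
              some (h, (r, 0, 0, []))
          | some (.bndg t l) =>
            if nl = l then hnCo fuel h t 0 0 [] whnf
            else
              (sub nl l).bind fun j =>
              (deref fuel h t).bind fun t =>
              match h[t]? with
              | none => none
              | some (.susp t₂ o n e) => hnCo fuel h t₂ o (n + j) e whnf
              | some _ => hnCo fuel h t 0 j [] whnf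
    | some (.lam t) =>
      match whnf with
      | true => some (h, (term, ol, nl, env))
      | false => do
        let (h, (t', _, _, _)) ←
          if ol = 0 ∧ nl = 0 then hnCo fuel h t 0 0 [] false
          else hnCo fuel h t (ol + 1) (nl + 1) (.dum nl :: env) false
        some (buildLam h term t' ol nl)
    | some (.app t₁ t₂) => do
      let (h, (f, fo, fl, fe)) ← hnCo fuel h t₁ ol nl env true
      (deref fuel h f).bind fun f =>
      match h[f]? with
      | none => none
      | some (.lam t) => do
        let (h, a) := arg h t₂ ol nl env
        let (h, s) ← hnCo fuel h t (fo + 1) fl (.bndg a fl :: fe) whnf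
        updateApp fuel h term s ol nl
      | some _ => buildApp fuel h term f t₂ ol nl env
    | some (.susp t ol₁ nl₁ env₁) => do
      let (h, q) ← hnCo fuel h t ol₁ nl₁ env₁ whnf
      let (h, s) ← mkExplicit fuel h term q ol nl
      if ol = 0 ∧ nl = 0 then some (h, s)
      else hnCo fuel h term ol nl env whnf
    | some (.ptr t) =>
      (deref fuel h t).bind fun t =>
      hnCo fuel h t ol nl env whnf
    | some _ => some (h, (term, 0, 0, []))

def headNorm3 (fuel : ℕ) (h : Heap C V) (t : Loc) : Option (Heap C V × Quad) :=
  hnCo fuel h t 0 0 [] false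

/-- The call `head_norm3(t)` in the heap `h` terminates, and leaves the heap `h'`. -/
def HeadNorm3Yields (h : Heap C V) (t : Loc) (h' : Heap C V) : Prop :=
  ∃ (q : Quad) (n₀ : ℕ), ∀ fuel ≥ n₀, headNorm3 fuel h t = some (h', q)

end Program

end Suspension

/-!
A well-formed suspension term `t` stands for the de Bruijn term `STerm.den t`, in which every
suspension has been carried out as a simultaneous substitution.  The reading rules preserve `den`
and transform `t` into `den t`, and the rewrite rules that the program applies act on `den` as
β-reduction.  Hence, for correctness, it is enough that the program only ever replaces
represented terms by terms obtained from them by rewriting, and that its result has the shape of a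
generalized head normal form.

**Termination.**  By standardization (`DTerm.HasHNF.headNormalizes`), a term with a head normal
form reaches one by contractions on its head path, that is, on the path that enters bodies of
abstractions and operators of applications.  The number of these contractions does not grow under
any β-reduction, because head contractions commute with parallel reduction
(`DTerm.HeadNormalizes.betaStar`), and it falls with every contraction on the head path, because of
a diamond property (`DTerm.HeadNormalizes.betaHead`).  It cannot account for the work of the
reading rules, which leave `den` unchanged.  This work is measured by `STerm.cost`, a weight of the
head path of a suspension term that looks into the environment only at the item bound to the head
variable.  Arguments do not count, so a destructive update elsewhere does no harm: by
`STerm.Steps.descends`, rewriting at any position either contracts a redex on the head path of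
`den`, or does not raise the weight.  Every recursive call of the program lowers the pair of the two
measures lexicographically.  The critical call is the one that resumes with an updated suspension;
there the removal of the suspension has lowered the pair (`STerm.Steps.descends_one`).

**Sharing.**  A reference that represents a term reaches no cycle, so acyclicity of the references
that matter comes with the representation of terms.  The relation `Evolves h h'` says that the term
of each reference of `h` is rewritten into its term in `h'`.  An assignment to `x` must not create a
cycle and must not lose this relation.  Both follow from a frame property (`Frame`): an evaluation
changes nothing outside any given set that contains its input and is closed under references.  It is
applied to the set `avoid h x` of the references from which `x` cannot be reached, which contains
the immediate subterms of `x`.  In `Evolves.assign` the rewriting is followed from the heap before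
the evaluation, since the evaluation of `x` may have left parts of `x` in states from which its
result is not obtained by rewriting.  The specification `Outcome` of the program combines these
properties, and `goodBelow` establishes it by induction on the two measures.
-/

namespace Suspension

theorem reflTransGen_map {α β : Type*} {r : α → α → Prop} {p : β → β → Prop} (f : α → β)
    (hf : ∀ a b, r a b → p (f a) (f b)) {a b : α} (h : Relation.ReflTransGen r a b) :
    Relation.ReflTransGen p (f a) (f b) :=
  Relation.ReflTransGen.lift f hf a b h

/-! ### Substitution in de Bruijn terms -/

namespace DTerm

variable {C V : Type*}

theorem rename_subst (t : DTerm C V) (f : ℕ → ℕ) (σ : ℕ → DTerm C V) :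
    (t.rename f).subst σ = t.subst fun i => σ (f i) := by
  induction t generalizing f σ with
  | const c => rfl
  | ivar x => rfl
  | idx k => rfl
  | app t₁ t₂ ih₁ ih₂ => simp only [rename, subst, ih₁, ih₂]
  | lam t ih =>
    simp only [rename, subst, ih]
    congr 2
    funext i
    cases i <;> rfl

theorem rename_rename (t : DTerm C V) (f g : ℕ → ℕ) :
    (t.rename f).rename g = t.rename fun i => g (f i) := by
  rw [rename_eq_subst _ g, rename_subst, rename_eq_subst]

theorem subst_rename (t : DTerm C V) (σ : ℕ → DTerm C V) (f : ℕ → ℕ) :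
    (t.subst σ).rename f = t.subst fun i => (σ i).rename f := by
  induction t generalizing f σ with
  | const c => rfl
  | ivar x => rfl
  | idx k => rfl
  | app t₁ t₂ ih₁ ih₂ => simp only [rename, subst, ih₁, ih₂]
  | lam t ih =>
    simp only [rename, subst, ih]
    congr 2
    funext i
    cases i with
    | zero => rfl
    | succ i => simp only [scons, rename_rename]

theorem subst_subst (t : DTerm C V) (σ τ : ℕ → DTerm C V) :
    (t.subst σ).subst τ = t.subst fun i => (σ i).subst τ := by
  induction t generalizing σ τ with
  | const c => rfl
  | ivar x => rfl
  | idx k => rfl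
  | app t₁ t₂ ih₁ ih₂ => simp only [subst, ih₁, ih₂]
  | lam t ih =>
    simp only [subst, ih]
    congr 2
    funext i
    cases i with
    | zero => rfl
    | succ i => simp only [scons, rename_subst, subst_rename]

theorem subst_idx (t : DTerm C V) : t.subst idx = t := by
  induction t with
  | const c => rfl
  | ivar x => rfl
  | idx k => rfl
  | app t₁ t₂ ih₁ ih₂ => simp only [subst, ih₁, ih₂]
  | lam t ih =>
    simp only [subst]
    congr 1
    convert ih using 2
    funext i
    cases i <;> rfl

/-- The substitution `σ` carried under an abstraction. -/
def up (σ : ℕ → DTerm C V) : ℕ → DTerm C V := scons (idx 0) fun i => (σ i).rename Nat.succ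

theorem rename_contract (t₁ t₂ : DTerm C V) (f : ℕ → ℕ) :
    (t₁.subst (scons t₂ idx)).rename f =
      (t₁.rename (scons 0 fun i => f i + 1)).subst (scons (t₂.rename f) idx) := by
  rw [subst_rename, rename_subst]
  congr 1
  funext i
  cases i <;> rfl

theorem up_subst_scons (t₁ t₂ : DTerm C V) (σ : ℕ → DTerm C V) :
    (t₁.subst (up σ)).subst (scons t₂ idx) = t₁.subst (scons t₂ σ) := by
  rw [subst_subst]
  congr 1
  funext i
  cases i with
  | zero => rfl
  | succ i =>
    simp only [up, scons, rename_subst]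
    exact subst_idx _

theorem contract_subst (t₁ t₂ : DTerm C V) (σ : ℕ → DTerm C V) :
    (t₁.subst (scons t₂ idx)).subst σ =
      (t₁.subst (up σ)).subst (scons (t₂.subst σ) idx) := by
  rw [up_subst_scons, subst_subst]
  congr 1
  funext i
  cases i <;> rfl

/-! ### Congruence properties of β-reduction -/

theorem BetaStar.appL {t t' : DTerm C V} (s : DTerm C V) (h : BetaStar t t') :
    BetaStar (app t s) (app t' s) :=
  reflTransGen_map (fun x => app x s) (fun _ _ h => Beta.appL s h) h

theorem BetaStar.appR {t t' : DTerm C V} (s : DTerm C V) (h : BetaStar t t') :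
    BetaStar (app s t) (app s t') :=
  reflTransGen_map (fun x => app s x) (fun _ _ h => Beta.appR s h) h

theorem BetaStar.app {t t' s s' : DTerm C V} (h₁ : BetaStar t t') (h₂ : BetaStar s s') :
    BetaStar (app t s) (app t' s') :=
  (h₁.appL s).trans (h₂.appR t')

theorem BetaStar.lam {t t' : DTerm C V} (h : BetaStar t t') : BetaStar (lam t) (lam t') :=
  reflTransGen_map DTerm.lam (fun _ _ h => Beta.lam h) h

theorem Beta.subst {t t' : DTerm C V} (h : Beta t t') (σ : ℕ → DTerm C V) :
    Beta (t.subst σ) (t'.subst σ) := by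
  induction h generalizing σ with
  | contract t₁ t₂ => rw [contract_subst]; exact Beta.contract _ _
  | appL s _ ih => exact Beta.appL _ (ih σ)
  | appR s _ ih => exact Beta.appR _ (ih σ)
  | lam _ ih => exact Beta.lam (ih _)

theorem BetaStar.subst {t t' : DTerm C V} (h : BetaStar t t') (σ : ℕ → DTerm C V) :
    BetaStar (t.subst σ) (t'.subst σ) :=
  reflTransGen_map (DTerm.subst · σ) (fun _ _ h => h.subst σ) h

theorem BetaStar.rename {t t' : DTerm C V} (h : BetaStar t t') (f : ℕ → ℕ) :
    BetaStar (t.rename f) (t'.rename f) := by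
  simpa only [rename_eq_subst] using h.subst fun i => idx (f i)

theorem BetaStar.up {σ τ : ℕ → DTerm C V} (h : ∀ i, BetaStar (σ i) (τ i)) (i : ℕ) :
    BetaStar (up σ i) (up τ i) := by
  cases i with
  | zero => exact Relation.ReflTransGen.refl
  | succ i => exact (h i).rename _

theorem BetaStar.subst_right (t : DTerm C V) {σ τ : ℕ → DTerm C V}
    (h : ∀ i, BetaStar (σ i) (τ i)) : BetaStar (t.subst σ) (t.subst τ) := by
  induction t generalizing σ τ with
  | const c => exact Relation.ReflTransGen.refl
  | ivar x => exact Relation.ReflTransGen.refl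
  | idx k => exact h k
  | app t₁ t₂ ih₁ ih₂ => exact (ih₁ h).app (ih₂ h)
  | lam t ih => exact (ih (BetaStar.up h)).lam

/-! ### Contractions on the head path -/

/-- A contraction on the head path, that is, the path from the root that enters the body of each
abstraction and the operator of each application.  Since a contraction on this path neither
duplicates nor deletes another redex on it, the order of such contractions does not matter. -/
inductive HeadStep : DTerm C V → DTerm C V → Prop
  | contract (t₁ t₂ : DTerm C V) : HeadStep (app (lam t₁) t₂) (t₁.subst (scons t₂ idx))
  | appL {t t' : DTerm C V} (s : DTerm C V) : HeadStep t t' → HeadStep (app t s) (app t' s)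
  | lam {t t' : DTerm C V} : HeadStep t t' → HeadStep (lam t) (lam t')

theorem HeadStep.beta {t t' : DTerm C V} (h : HeadStep t t') : Beta t t' := by
  induction h with
  | contract t₁ t₂ => exact Beta.contract _ _
  | appL s _ ih => exact Beta.appL _ ih
  | lam _ ih => exact Beta.lam ih

theorem HeadStep.subst {t t' : DTerm C V} (h : HeadStep t t') (σ : ℕ → DTerm C V) :
    HeadStep (t.subst σ) (t'.subst σ) := by
  induction h generalizing σ with
  | contract t₁ t₂ => rw [contract_subst]; exact HeadStep.contract _ _
  | appL s _ ih => exact HeadStep.appL _ (ih σ)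
  | lam _ ih => exact HeadStep.lam (ih _)

theorem IsHeadApp.not_headStep {t t' : DTerm C V} (h : IsHeadApp t) : ¬ HeadStep t t' := by
  intro hs
  induction h generalizing t' with
  | const c => cases hs
  | ivar x => cases hs
  | idx k => cases hs
  | app s h ih =>
    cases hs with
    | contract => cases h
    | appL _ hs => exact ih hs

theorem IsHNF.not_headStep {t t' : DTerm C V} (h : IsHNF t) : ¬ HeadStep t t' := by
  intro hs
  induction h generalizing t' with
  | body h => exact h.not_headStep hs
  | lam _ ih =>
    cases hs with
    | lam hs => exact ih hs

theorem isHeadApp_or_lam_or_headStep (t : DTerm C V) :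
    IsHeadApp t ∨ (∃ b, t = lam b) ∨ ∃ t', HeadStep t t' := by
  induction t with
  | const c => exact .inl (.const c)
  | ivar x => exact .inl (.ivar x)
  | idx k => exact .inl (.idx k)
  | lam t _ => exact .inr (.inl ⟨t, rfl⟩)
  | app t₁ t₂ ih₁ _ =>
    rcases ih₁ with h | ⟨b, rfl⟩ | ⟨t', h⟩
    · exact .inl (.app _ h)
    · exact .inr (.inr ⟨_, .contract _ _⟩)
    · exact .inr (.inr ⟨_, .appL _ h⟩)

theorem isHNF_or_headStep (t : DTerm C V) : IsHNF t ∨ ∃ t', HeadStep t t' := by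
  induction t with
  | const c => exact .inl (.body (.const c))
  | ivar x => exact .inl (.body (.ivar x))
  | idx k => exact .inl (.body (.idx k))
  | lam t ih =>
    rcases ih with h | ⟨t', h⟩
    · exact .inl (.lam h)
    · exact .inr ⟨_, .lam h⟩
  | app t₁ t₂ _ _ =>
    rcases isHeadApp_or_lam_or_headStep (app t₁ t₂) with h | ⟨b, h⟩ | h
    · exact .inl (.body h)
    · cases h
    · exact .inr h

theorem HeadStep.diamond {t a b : DTerm C V} (ha : HeadStep t a) (hb : HeadStep t b) :
    a = b ∨ ∃ c, HeadStep a c ∧ HeadStep b c := by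
  induction ha generalizing b with
  | contract t₁ t₂ =>
    cases hb with
    | contract => exact .inl rfl
    | appL _ hb =>
      cases hb with
      | lam hb => exact .inr ⟨_, hb.subst _, .contract _ _⟩
  | appL s ha ih =>
    cases hb with
    | contract =>
      cases ha with
      | lam ha => exact .inr ⟨_, .contract _ _, ha.subst _⟩
    | appL _ hb =>
      rcases ih hb with rfl | ⟨c, h₁, h₂⟩
      · exact .inl rfl
      · exact .inr ⟨_, .appL _ h₁, .appL _ h₂⟩
  | lam ha ih =>
    cases hb with
    | lam hb =>
      rcases ih hb with rfl | ⟨c, h₁, h₂⟩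
      · exact .inl rfl
      · exact .inr ⟨_, .lam h₁, .lam h₂⟩

/-- At most `n` contractions on the head path lead from the term to a head normal form. -/
inductive HeadNormalizes : ℕ → DTerm C V → Prop
  | hnf {t : DTerm C V} (n : ℕ) : IsHNF t → HeadNormalizes n t
  | step {t t' : DTerm C V} {n : ℕ} : HeadStep t t' → HeadNormalizes n t' →
      HeadNormalizes (n + 1) t

/-- By the diamond property, every contraction on the head path brings the term nearer to a
head normal form. -/
theorem HeadNormalizes.of_headStep {n : ℕ} {t t' : DTerm C V} (h : HeadNormalizes n t)
    (hs : HeadStep t t') : ∃ m, n = m + 1 ∧ HeadNormalizes m t' := by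
  induction h generalizing t' with
  | hnf n h => exact absurd hs h.not_headStep
  | @step t a n ha h ih =>
    refine ⟨n, rfl, ?_⟩
    rcases ha.diamond hs with rfl | ⟨c, h₁, h₂⟩
    · exact h
    · obtain ⟨m, rfl, hm⟩ := ih h₁
      exact .step h₂ hm

/-- If `f` preserves contractions on the head path, then `t` is at least as near to a head
normal form as `f t`. -/
theorem HeadNormalizes.of_map {f : DTerm C V → DTerm C V}
    (hf : ∀ a b, HeadStep a b → HeadStep (f a) (f b)) {n : ℕ} {t : DTerm C V}
    (h : HeadNormalizes n (f t)) : HeadNormalizes n t := by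
  induction n generalizing t with
  | zero =>
    rcases isHNF_or_headStep t with ht | ⟨t', ht⟩
    · exact .hnf _ ht
    · obtain ⟨m, hm, -⟩ := h.of_headStep (hf _ _ ht)
      omega
  | succ n ih =>
    rcases isHNF_or_headStep t with ht | ⟨t', ht⟩
    · exact .hnf _ ht
    · obtain ⟨m, hm, h'⟩ := h.of_headStep (hf _ _ ht)
      obtain rfl : n = m := by omega
      exact .step ht (ih h')

/-! ### Parallel reduction does not lengthen head reduction -/

/-- Parallel β-reduction. -/
inductive Par : DTerm C V → DTerm C V → Prop
  | const (c : C) : Par (const c) (const c)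
  | ivar (x : V) : Par (ivar x) (ivar x)
  | idx (k : ℕ) : Par (idx k) (idx k)
  | app {t t' s s' : DTerm C V} : Par t t' → Par s s' → Par (app t s) (app t' s')
  | lam {t t' : DTerm C V} : Par t t' → Par (lam t) (lam t')
  | contract {t t' s s' : DTerm C V} : Par t t' → Par s s' →
      Par (app (lam t) s) (t'.subst (scons s' DTerm.idx))

theorem Par.refl (t : DTerm C V) : Par t t := by
  induction t with
  | const c => exact .const c
  | ivar x => exact .ivar x
  | idx k => exact .idx k
  | app _ _ h₁ h₂ => exact .app h₁ h₂
  | lam _ h => exact .lam h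

theorem Beta.par {t t' : DTerm C V} (h : Beta t t') : Par t t' := by
  induction h with
  | contract t₁ t₂ => exact .contract (.refl _) (.refl _)
  | appL s _ ih => exact .app ih (.refl _)
  | appR s _ ih => exact .app (.refl _) ih
  | lam _ ih => exact .lam ih

theorem Par.rename {t t' : DTerm C V} (h : Par t t') (f : ℕ → ℕ) :
    Par (t.rename f) (t'.rename f) := by
  induction h generalizing f with
  | const c => exact .const c
  | ivar x => exact .ivar x
  | idx k => exact .idx _
  | app _ _ h₁ h₂ => exact .app (h₁ f) (h₂ f)
  | lam _ h => exact .lam (h _)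
  | contract _ _ h₁ h₂ =>
    rw [rename_contract]
    exact .contract (h₁ _) (h₂ _)

theorem Par.subst {t t' : DTerm C V} (h : Par t t') {σ τ : ℕ → DTerm C V}
    (hσ : ∀ i, Par (σ i) (τ i)) : Par (t.subst σ) (t'.subst τ) := by
  have hup : ∀ {σ τ : ℕ → DTerm C V}, (∀ i, Par (σ i) (τ i)) → ∀ i, Par (up σ i) (up τ i) := by
    intro σ τ h i
    cases i with
    | zero => exact .idx 0
    | succ i => exact (h i).rename _
  induction h generalizing σ τ with
  | const c => exact .const c
  | ivar x => exact .ivar x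
  | idx k => exact hσ k
  | app _ _ h₁ h₂ => exact .app (h₁ hσ) (h₂ hσ)
  | lam _ h => exact .lam (h (hup hσ))
  | contract _ _ h₁ h₂ =>
    rw [contract_subst]
    exact .contract (h₁ (hup hσ)) (h₂ hσ)

theorem Par.scons {t t' : DTerm C V} (h : Par t t') (i : ℕ) :
    Par (scons t DTerm.idx i) (scons t' DTerm.idx i) := by
  cases i with
  | zero => exact h
  | succ i => exact .idx i

/-- A contraction on the head path is either part of the parallel reduction, or it has exactly one
residual, which lies on the head path. -/
theorem Par.headStep {t t' a : DTerm C V} (h : Par t t') (ha : HeadStep t a) :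
    Par a t' ∨ ∃ a', HeadStep t' a' ∧ Par a a' := by
  induction ha generalizing t' with
  | contract t₁ t₂ =>
    cases h with
    | app h₁ h₂ =>
      cases h₁ with
      | lam h₁ => exact .inr ⟨_, .contract _ _, h₁.subst h₂.scons⟩
    | contract h₁ h₂ => exact .inl (h₁.subst h₂.scons)
  | appL s ha ih =>
    cases h with
    | app h₁ h₂ =>
      rcases ih h₁ with h | ⟨a', h, h'⟩
      · exact .inl (.app h h₂)
      · exact .inr ⟨_, .appL _ h, .app h' h₂⟩
    | contract h₁ h₂ =>
      cases ha with
      | lam ha =>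
        rcases ih (.lam h₁) with h | ⟨a', h, h'⟩
        · cases h with
          | lam h => exact .inl (.contract h h₂)
        · cases h with
          | lam h =>
            cases h' with
            | lam h' => exact .inr ⟨_, h.subst _, .contract h' h₂⟩
  | lam ha ih =>
    cases h with
    | lam h =>
      rcases ih h with h | ⟨a', h, h'⟩
      · exact .inl (.lam h)
      · exact .inr ⟨_, .lam h, .lam h'⟩

theorem IsHeadApp.par {t t' : DTerm C V} (h : IsHeadApp t) (hp : Par t t') : IsHeadApp t' := by
  induction h generalizing t' with
  | const c => cases hp; exact .const c
  | ivar x => cases hp; exact .ivar x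
  | idx k => cases hp; exact .idx k
  | app s h ih =>
    cases hp with
    | app h₁ h₂ => exact .app _ (ih h₁)
    | contract => cases h

theorem IsHNF.par {t t' : DTerm C V} (h : IsHNF t) (hp : Par t t') : IsHNF t' := by
  induction h generalizing t' with
  | body h => exact .body (h.par hp)
  | lam _ ih =>
    cases hp with
    | lam hp => exact .lam (ih hp)

theorem HeadNormalizes.mono {n m : ℕ} {t : DTerm C V} (h : HeadNormalizes n t) (hnm : n ≤ m) :
    HeadNormalizes m t := by
  induction h generalizing m with
  | hnf n h => exact .hnf _ h
  | step hs _ ih =>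
    obtain ⟨m, rfl⟩ : ∃ k, m = k + 1 := ⟨m - 1, by omega⟩
    exact .step hs (ih (by omega))

theorem HeadNormalizes.par {n : ℕ} {t t' : DTerm C V} (h : HeadNormalizes n t) (hp : Par t t') :
    HeadNormalizes n t' := by
  induction h generalizing t' with
  | hnf n h => exact .hnf _ (h.par hp)
  | step hs h ih =>
    rcases hp.headStep hs with h' | ⟨a', hs', h'⟩
    · exact (ih h').mono (Nat.le_succ _)
    · exact .step hs' (ih h')

/-- No β-reduction makes the way to a head normal form longer. -/
theorem HeadNormalizes.betaStar {n : ℕ} {t t' : DTerm C V} (h : HeadNormalizes n t)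
    (hb : BetaStar t t') : HeadNormalizes n t' := by
  induction hb with
  | refl => exact h
  | tail _ hb ih => exact ih.par hb.par

/-! ### Standardization -/

/-- A contraction of the weak head redex. -/
inductive WeakHeadStep : DTerm C V → DTerm C V → Prop
  | contract (t₁ t₂ : DTerm C V) : WeakHeadStep (app (lam t₁) t₂) (t₁.subst (scons t₂ idx))
  | appL {t t' : DTerm C V} (s : DTerm C V) : WeakHeadStep t t' →
      WeakHeadStep (app t s) (app t' s)

/-- A series of contractions of weak head redexes. -/
def WeakHeadStar : DTerm C V → DTerm C V → Prop := Relation.ReflTransGen WeakHeadStep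

theorem WeakHeadStep.headStep {t t' : DTerm C V} (h : WeakHeadStep t t') : HeadStep t t' := by
  induction h with
  | contract t₁ t₂ => exact .contract _ _
  | appL s _ ih => exact .appL _ ih

theorem WeakHeadStep.subst {t t' : DTerm C V} (h : WeakHeadStep t t') (σ : ℕ → DTerm C V) :
    WeakHeadStep (t.subst σ) (t'.subst σ) := by
  induction h with
  | contract t₁ t₂ => rw [contract_subst]; exact .contract _ _
  | appL s _ ih => exact .appL _ ih

theorem WeakHeadStar.subst {t t' : DTerm C V} (h : WeakHeadStar t t') (σ : ℕ → DTerm C V) :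
    WeakHeadStar (t.subst σ) (t'.subst σ) :=
  reflTransGen_map (DTerm.subst · σ) (fun _ _ h => h.subst σ) h

theorem WeakHeadStar.appL {t t' : DTerm C V} (h : WeakHeadStar t t') (s : DTerm C V) :
    WeakHeadStar (app t s) (app t' s) :=
  reflTransGen_map (fun x => app x s) (fun _ _ h => WeakHeadStep.appL s h) h

/-- Standard reduction, in Kashima's inductive form: weak head reduction of the term itself,
followed by standard reduction of the immediate subterms of the result. -/
inductive Std : DTerm C V → DTerm C V → Prop
  | const {t : DTerm C V} {c : C} : WeakHeadStar t (const c) → Std t (const c)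
  | ivar {t : DTerm C V} {x : V} : WeakHeadStar t (ivar x) → Std t (ivar x)
  | idx {t : DTerm C V} {k : ℕ} : WeakHeadStar t (idx k) → Std t (idx k)
  | app {t a a' b b' : DTerm C V} : WeakHeadStar t (app a b) → Std a a' → Std b b' →
      Std t (app a' b')
  | lam {t a a' : DTerm C V} : WeakHeadStar t (lam a) → Std a a' → Std t (lam a')

theorem Std.refl (t : DTerm C V) : Std t t := by
  induction t with
  | const c => exact .const .refl
  | ivar x => exact .ivar .refl
  | idx k => exact .idx .refl
  | app _ _ h₁ h₂ => exact .app .refl h₁ h₂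
  | lam _ h => exact .lam .refl h

theorem Std.head {s t t' : DTerm C V} (h : WeakHeadStar s t) (ht : Std t t') : Std s t' := by
  cases ht with
  | const h' => exact .const (h.trans h')
  | ivar h' => exact .ivar (h.trans h')
  | idx h' => exact .idx (h.trans h')
  | app h' h₁ h₂ => exact .app (h.trans h') h₁ h₂
  | lam h' h₁ => exact .lam (h.trans h') h₁

theorem Std.rename {t t' : DTerm C V} (h : Std t t') (f : ℕ → ℕ) :
    Std (t.rename f) (t'.rename f) := by
  have hw : ∀ {t t' : DTerm C V} (f : ℕ → ℕ), WeakHeadStar t t' →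
      WeakHeadStar (t.rename f) (t'.rename f) := by
    intro t t' f h
    simpa only [rename_eq_subst] using h.subst fun i => DTerm.idx (f i)
  induction h generalizing f with
  | const h => exact .const (hw f h)
  | ivar h => exact .ivar (hw f h)
  | idx h => exact .idx (hw f h)
  | app h _ _ h₁ h₂ => exact .app (hw f h) (h₁ f) (h₂ f)
  | lam h _ h₁ => exact .lam (hw f h) (h₁ _)

theorem Std.subst {t t' : DTerm C V} (h : Std t t') {σ τ : ℕ → DTerm C V}
    (hσ : ∀ i, Std (σ i) (τ i)) : Std (t.subst σ) (t'.subst τ) := by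
  induction h generalizing σ τ with
  | const h => exact .const (h.subst σ)
  | ivar h => exact .ivar (h.subst σ)
  | idx h => exact .head (h.subst σ) (hσ _)
  | app h _ _ h₁ h₂ => exact .app (h.subst σ) (h₁ hσ) (h₂ hσ)
  | lam h _ h₁ =>
    refine .lam (h.subst σ) (h₁ fun i => ?_)
    cases i with
    | zero => exact .refl _
    | succ i => exact (hσ i).rename _

/-- Standard reductions absorb contractions, hence contain all of β-reduction. -/
theorem Std.beta {t a b : DTerm C V} (h : Std t a) (hb : Beta a b) : Std t b := by
  induction hb generalizing t with
  | contract a₁ a₂ =>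
    cases h with
    | app h h₁ h₂ =>
      cases h₁ with
      | lam h' h₁ =>
        refine .head (h.trans ((WeakHeadStar.appL h' _).tail (.contract _ _))) (h₁.subst ?_)
        intro i
        cases i with
        | zero => exact h₂
        | succ i => exact .refl _
  | appL s _ ih =>
    cases h with
    | app h h₁ h₂ => exact .app h (ih h₁) h₂
  | appR s _ ih =>
    cases h with
    | app h h₁ h₂ => exact .app h h₁ (ih h₂)
  | lam _ ih =>
    cases h with
    | lam h h₁ => exact .lam h (ih h₁)

theorem Std.of_betaStar {t t' : DTerm C V} (h : BetaStar t t') : Std t t' := by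
  induction h with
  | refl => exact .refl _
  | tail _ hb ih => exact ih.beta hb

theorem HeadNormalizes.of_weakHeadStar {t t' : DTerm C V} (h : WeakHeadStar t t') {n : ℕ}
    (hn : HeadNormalizes n t') : ∃ m, HeadNormalizes m t := by
  induction h using Relation.ReflTransGen.head_induction_on with
  | refl => exact ⟨n, hn⟩
  | head hs _ ih =>
    obtain ⟨m, hm⟩ := ih
    exact ⟨m + 1, .step hs.headStep hm⟩

theorem HeadNormalizes.lam {n : ℕ} {t : DTerm C V} (h : HeadNormalizes n t) :
    HeadNormalizes n (lam t) := by
  induction h with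
  | hnf n h => exact .hnf _ (.lam h)
  | step hs _ ih => exact .step (.lam hs) ih

theorem Std.exists_isHeadApp {t t' : DTerm C V} (h : Std t t') (ht : IsHeadApp t') :
    ∃ a, WeakHeadStar t a ∧ IsHeadApp a := by
  induction ht generalizing t with
  | const c => cases h with | const h => exact ⟨_, h, .const c⟩
  | ivar x => cases h with | ivar h => exact ⟨_, h, .ivar x⟩
  | idx k => cases h with | idx h => exact ⟨_, h, .idx k⟩
  | app s _ ih =>
    cases h with
    | app h h₁ h₂ =>
      obtain ⟨a, ha, ha'⟩ := ih h₁
      exact ⟨_, h.trans (ha.appL _), .app _ ha'⟩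

theorem Std.headNormalizes {t t' : DTerm C V} (h : Std t t') (ht : IsHNF t') :
    ∃ n, HeadNormalizes n t := by
  induction ht generalizing t with
  | body ht =>
    obtain ⟨a, ha, ha'⟩ := h.exists_isHeadApp ht
    exact HeadNormalizes.of_weakHeadStar ha (.hnf 0 (.body ha'))
  | lam _ ih =>
    cases h with
    | lam h h₁ =>
      obtain ⟨n, hn⟩ := ih h₁
      exact HeadNormalizes.of_weakHeadStar h hn.lam

/-- A term that has a head normal form reaches one along its head path. -/
theorem HasHNF.headNormalizes {t : DTerm C V} (h : HasHNF t) : ∃ n, HeadNormalizes n t := by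
  obtain ⟨s, hs, hb⟩ := h
  exact (Std.of_betaStar hb).headNormalizes hs

/-! ### Reductions that contract a redex on the head path -/

/-- β-reduction by a series of contractions of which at least one is on the head path. -/
def BetaHead (t t' : DTerm C V) : Prop :=
  ∃ a b, BetaStar t a ∧ HeadStep a b ∧ BetaStar b t'

theorem HeadStep.betaHead {t t' : DTerm C V} (h : HeadStep t t') : BetaHead t t' :=
  ⟨t, t', .refl, h, .refl⟩

theorem BetaHead.betaStar {t t' : DTerm C V} (h : BetaHead t t') : BetaStar t t' := by
  obtain ⟨a, b, h₁, h₂, h₃⟩ := h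
  exact (h₁.tail h₂.beta).trans h₃

theorem BetaHead.trans {t s r : DTerm C V} (h : BetaHead t s) (h' : BetaStar s r) :
    BetaHead t r := by
  obtain ⟨a, b, h₁, h₂, h₃⟩ := h
  exact ⟨a, b, h₁, h₂, h₃.trans h'⟩

theorem BetaStar.trans_betaHead {t s r : DTerm C V} (h : BetaStar t s) (h' : BetaHead s r) :
    BetaHead t r := by
  obtain ⟨a, b, h₁, h₂, h₃⟩ := h'
  exact ⟨a, b, h.trans h₁, h₂, h₃⟩

theorem BetaHead.appL {t t' : DTerm C V} (h : BetaHead t t') (s : DTerm C V) :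
    BetaHead (app t s) (app t' s) := by
  obtain ⟨a, b, h₁, h₂, h₃⟩ := h
  exact ⟨_, _, h₁.appL s, h₂.appL s, h₃.appL s⟩

theorem BetaHead.lam {t t' : DTerm C V} (h : BetaHead t t') : BetaHead (lam t) (lam t') := by
  obtain ⟨a, b, h₁, h₂, h₃⟩ := h
  exact ⟨_, _, h₁.lam, h₂.lam, h₃.lam⟩

theorem BetaHead.subst {t t' : DTerm C V} (h : BetaHead t t') (σ : ℕ → DTerm C V) :
    BetaHead (t.subst σ) (t'.subst σ) := by
  obtain ⟨a, b, h₁, h₂, h₃⟩ := h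
  exact ⟨_, _, h₁.subst σ, h₂.subst σ, h₃.subst σ⟩

theorem BetaHead.rename {t t' : DTerm C V} (h : BetaHead t t') (f : ℕ → ℕ) :
    BetaHead (t.rename f) (t'.rename f) := by
  simpa only [rename_eq_subst] using h.subst fun i => idx (f i)

theorem HeadNormalizes.betaHead {n : ℕ} {t t' : DTerm C V} (h : HeadNormalizes n t)
    (hb : BetaHead t t') : ∃ m, n = m + 1 ∧ HeadNormalizes m t' := by
  obtain ⟨a, b, h₁, h₂, h₃⟩ := hb
  obtain ⟨m, hm, h'⟩ := (h.betaStar h₁).of_headStep h₂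
  exact ⟨m, hm, h'.betaStar h₃⟩

/-- The variable at the end of the head path, if it is free in the term. -/
def headVar : DTerm C V → Option ℕ
  | const _ => none
  | ivar _ => none
  | idx k => some k
  | app t _ => headVar t
  | lam t => (headVar t).bind fun k => if k = 0 then none else some (k - 1)

theorem headVar_rename (t : DTerm C V) (f : ℕ → ℕ) :
    (t.rename f).headVar = t.headVar.map f := by
  induction t generalizing f with
  | const c => rfl
  | ivar x => rfl
  | idx k => rfl
  | app t₁ t₂ ih₁ _ => exact ih₁ f
  | lam t ih =>
    simp only [rename, headVar, ih]
    rcases t.headVar with _ | (_ | k) <;> simp [scons]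

theorem headVar_subst (t : DTerm C V) (σ : ℕ → DTerm C V) :
    (t.subst σ).headVar = t.headVar.bind fun k => (σ k).headVar := by
  induction t generalizing σ with
  | const c => rfl
  | ivar x => rfl
  | idx k => rfl
  | app t₁ t₂ ih₁ _ => exact ih₁ σ
  | lam t ih =>
    simp only [subst, headVar, ih]
    rcases t.headVar with _ | (_ | k)
    · simp
    · simp [scons, headVar]
    · simp only [Option.bind_some, scons, headVar_rename]
      rcases h : (σ k).headVar with _ | j <;> simp [h]

/-- A substitution of `τ` for `σ` contracts a redex on the head path if it does so in the image
of the head variable. -/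
theorem BetaHead.subst_right {t : DTerm C V} {k : ℕ} (ht : t.headVar = some k)
    {σ τ : ℕ → DTerm C V} (hk : BetaHead (σ k) (τ k)) (h : ∀ i, BetaStar (σ i) (τ i)) :
    BetaHead (t.subst σ) (t.subst τ) := by
  induction t generalizing k σ τ with
  | const c => cases ht
  | ivar x => cases ht
  | idx j => cases ht; exact hk
  | app t₁ t₂ ih₁ _ => exact ((ih₁ ht hk h).appL _).trans ((BetaStar.subst_right t₂ h).appR _)
  | lam t ih =>
    have ht' : t.headVar = some (k + 1) := by
      simp only [headVar] at ht
      rcases h' : t.headVar with _ | (_ | j) <;> simp [h'] at ht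
      rw [ht]
    exact (ih ht' (hk.rename _) (BetaStar.up h)).lam

end DTerm

/-! ### Meaning of suspension terms -/

section Meaning

variable {C V : Type*}

mutual

/-- The de Bruijn term that a suspension term stands for: `⟦t, ol, nl, e⟧` is the result of a
simultaneous substitution in `t`.  The number `ol` does not enter, because in a well-formed term
it is the length of `e`. -/
def STerm.den : STerm C V → DTerm C V
  | .const c => .const c
  | .ivar x => .ivar x
  | .idx k => .idx k
  | .app t₁ t₂ => .app t₁.den t₂.den
  | .lam t => .lam t.den
  | .susp t _ nl e => t.den.subst (denEnv e nl)

/-- The substitution that an environment with the new embedding level `nl` stands for. -/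
def denEnv : List (EItem (STerm C V)) → ℕ → ℕ → DTerm C V
  | [], nl => fun k => .idx (k + nl)
  | x :: e, nl => scons (denItem x nl) (denEnv e nl)

/-- The term that an environment item substitutes at the new embedding level `nl`. -/
def denItem : EItem (STerm C V) → ℕ → DTerm C V
  | .dum l, nl => .idx (nl - l - 1)
  | .bndg t l, nl => t.den.rename fun k => k + (nl - l)

end

mutual

/-- A weight of the head path of a suspension term, where the path runs from a variable that is
bound by the environment of a suspension into the term bound to it.  Arguments and the other items
of environments do not count.  Each reading rule lowers the weight if it is applied on the head
path; the factor `2` makes up for the copies of a suspension that are distributed over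
applications and abstractions. -/
def STerm.cost : STerm C V → ℕ
  | .const _ => 1
  | .ivar _ => 1
  | .idx _ => 1
  | .app t₁ _ => t₁.cost + 1
  | .lam t => t.cost + 1
  | .susp t _ _ e => 2 * t.cost + 2 * t.den.headVar.elim 0 (costAt e)

/-- The weight of the item at position `k` of an environment. -/
def costAt : List (EItem (STerm C V)) → ℕ → ℕ
  | [], _ => 0
  | x :: _, 0 => costItem x
  | _ :: e, k + 1 => costAt e k

/-- The weight of an environment item. -/
def costItem : EItem (STerm C V) → ℕ
  | .dum _ => 0
  | .bndg t _ => t.cost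

end

theorem STerm.cost_pos (t : STerm C V) : 0 < t.cost := by
  cases t with
  | susp t ol nl e =>
    simp only [cost]
    have := STerm.cost_pos t
    omega
  | _ => simp only [cost]; omega

theorem denEnv_of_le {e : List (EItem (STerm C V))} {k : ℕ} (h : e.length ≤ k) (nl : ℕ) :
    denEnv e nl k = .idx (k - e.length + nl) := by
  induction e generalizing k with
  | nil => simp [denEnv]
  | cons x e ih =>
    obtain ⟨k, rfl⟩ : ∃ j, k = j + 1 := ⟨k - 1, by simp at h; omega⟩
    simp only [denEnv, scons, List.length_cons, Nat.add_sub_add_right]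
    exact ih (by simpa using h)

theorem denEnv_of_getElem? {e : List (EItem (STerm C V))} {k : ℕ} {x : EItem (STerm C V)}
    (h : e[k]? = some x) (nl : ℕ) : denEnv e nl k = denItem x nl := by
  induction e generalizing k with
  | nil => simp at h
  | cons y e ih =>
    cases k with
    | zero => simp at h; subst h; rfl
    | succ k => exact ih (by simpa using h)

theorem costAt_of_getElem? {e : List (EItem (STerm C V))} {k : ℕ} {x : EItem (STerm C V)}
    (h : e[k]? = some x) : costAt e k = costItem x := by
  induction e generalizing k with
  | nil => simp at h
  | cons y e ih =>
    cases k with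
    | zero => simp at h; subst h; rfl
    | succ k => exact ih (by simpa using h)

theorem denEnv_append_length (e₁ e₂ : List (EItem (STerm C V))) (x : EItem (STerm C V)) (nl : ℕ) :
    denEnv (e₁ ++ x :: e₂) nl e₁.length = denItem x nl :=
  denEnv_of_getElem? (by simp) nl

theorem costAt_append_length (e₁ e₂ : List (EItem (STerm C V))) (x : EItem (STerm C V)) :
    costAt (e₁ ++ x :: e₂) e₁.length = costItem x :=
  costAt_of_getElem? (by simp)

theorem denEnv_append_of_ne (e₁ e₂ : List (EItem (STerm C V))) (x y : EItem (STerm C V)) (nl : ℕ)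
    {k : ℕ} (h : k ≠ e₁.length) : denEnv (e₁ ++ x :: e₂) nl k = denEnv (e₁ ++ y :: e₂) nl k := by
  induction e₁ generalizing k with
  | nil =>
    cases k with
    | zero => simp at h
    | succ k => rfl
  | cons z e ih =>
    cases k with
    | zero => rfl
    | succ k => exact ih (by simpa using h)

theorem costAt_append_of_ne (e₁ e₂ : List (EItem (STerm C V))) (x y : EItem (STerm C V))
    {k : ℕ} (h : k ≠ e₁.length) : costAt (e₁ ++ x :: e₂) k = costAt (e₁ ++ y :: e₂) k := by
  induction e₁ generalizing k with
  | nil =>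
    cases k with
    | zero => simp at h
    | succ k => rfl
  | cons z e ih =>
    cases k with
    | zero => rfl
    | succ k => exact ih (by simpa using h)

end Meaning

namespace STerm

variable {C V : Type*}

theorem wellFormed_susp {t : STerm C V} {ol nl : ℕ} {e : List (EItem (STerm C V))} :
    WellFormed (susp t ol nl e) ↔ WellFormed t ∧ e.length = ol ∧
      (∀ l, EItem.dum l ∈ e → l < nl) ∧
      (∀ s l, EItem.bndg s l ∈ e → l ≤ nl) ∧ ∀ s l, EItem.bndg s l ∈ e → WellFormed s := by
  constructor
  · rintro ⟨⟩
    refine ⟨?_, ?_, ?_, ?_, ?_⟩ <;> assumption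
  · rintro ⟨h₁, h₂, h₃, h₄, h₅⟩
    exact .susp h₁ h₂ h₃ h₄ h₅

theorem wellFormed_app {t₁ t₂ : STerm C V} :
    WellFormed (app t₁ t₂) ↔ WellFormed t₁ ∧ WellFormed t₂ :=
  ⟨fun | .app h₁ h₂ => ⟨h₁, h₂⟩, fun h => .app h.1 h.2⟩

theorem wellFormed_lam {t : STerm C V} : WellFormed (lam t) ↔ WellFormed t :=
  ⟨fun | .lam h => h, fun h => .lam h⟩

theorem wellFormed_susp_nil {t : STerm C V} {nl : ℕ} :
    WellFormed (susp t 0 nl []) ↔ WellFormed t := by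
  simp [wellFormed_susp]

theorem WellFormed.susp_app {t₁ t₂ : STerm C V} {ol nl : ℕ} {e : List (EItem (STerm C V))}
    (h : WellFormed (.susp (.app t₁ t₂) ol nl e)) :
    WellFormed (.susp t₁ ol nl e) ∧ WellFormed (.susp t₂ ol nl e) := by
  rw [wellFormed_susp, wellFormed_app] at h
  exact ⟨wellFormed_susp.2 ⟨h.1.1, h.2⟩, wellFormed_susp.2 ⟨h.1.2, h.2⟩⟩

theorem WellFormed.susp_lam {t : STerm C V} {ol nl : ℕ} {e : List (EItem (STerm C V))}
    (h : WellFormed (.susp (.lam t) ol nl e)) :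
    WellFormed (.susp t (ol + 1) (nl + 1) (.dum nl :: e)) := by
  rw [wellFormed_susp, wellFormed_lam] at h
  obtain ⟨h₁, h₂, h₃, h₄, h₅⟩ := h
  refine wellFormed_susp.2 ⟨h₁, by simp [h₂], ?_, ?_, ?_⟩
  · intro l hl
    rcases List.mem_cons.1 hl with h | h
    · cases h; omega
    · exact (h₃ l h).trans (Nat.lt_succ_self _)
  · intro s l hl
    rcases List.mem_cons.1 hl with h | h
    · cases h
    · exact (h₄ s l h).trans (Nat.le_succ _)
  · intro s l hl
    rcases List.mem_cons.1 hl with h | h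
    · cases h
    · exact h₅ s l h

theorem WellFormed.susp_bndg {t a : STerm C V} {ol nl : ℕ} {e : List (EItem (STerm C V))}
    (h : WellFormed (.susp (.lam t) ol nl e)) (ha : WellFormed a) :
    WellFormed (.susp t (ol + 1) nl (.bndg a nl :: e)) := by
  rw [wellFormed_susp, wellFormed_lam] at h
  obtain ⟨h₁, h₂, h₃, h₄, h₅⟩ := h
  refine wellFormed_susp.2 ⟨h₁, by simp [h₂], ?_, ?_, ?_⟩
  · intro l hl
    rcases List.mem_cons.1 hl with h | h
    · cases h
    · exact h₃ l h
  · intro s l hl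
    rcases List.mem_cons.1 hl with h | h
    · cases h; exact le_rfl
    · exact h₄ s l h
  · intro s l hl
    rcases List.mem_cons.1 hl with h | h
    · cases h; exact ha
    · exact h₅ s l h

theorem WellFormed.susp_add {t : STerm C V} {ol nl : ℕ} {e : List (EItem (STerm C V))}
    (h : WellFormed (.susp t ol nl e)) (j : ℕ) : WellFormed (.susp t ol (nl + j) e) := by
  rw [wellFormed_susp] at h ⊢
  exact ⟨h.1, h.2.1, fun l hl => (h.2.2.1 l hl).trans_le (Nat.le_add_right _ _),
    fun s l hl => (h.2.2.2.1 s l hl).trans (Nat.le_add_right _ _), h.2.2.2.2⟩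

theorem WellFormed.bndg {t s : STerm C V} {ol nl l : ℕ} {e : List (EItem (STerm C V))}
    (h : WellFormed (.susp t ol nl e)) (hs : EItem.bndg s l ∈ e) : WellFormed s :=
  (wellFormed_susp.1 h).2.2.2.2 s l hs

theorem WellFormed.of_getElem? {t s : STerm C V} {ol nl l k : ℕ} {e : List (EItem (STerm C V))}
    (h : WellFormed (.susp t ol nl e)) (hk : e[k]? = some (.bndg s l)) : WellFormed s :=
  h.bndg (List.mem_of_getElem? hk)

theorem ReadRule.wellFormed {t t' : STerm C V} (h : ReadRule t t') (ht : WellFormed t) :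
    WellFormed t' := by
  cases h with
  | r1 c => exact .const c
  | r2 x => exact .ivar x
  | r3 k ol nl => exact .idx _
  | r4 => exact .idx _
  | r5 k ol nl e t l j hk h => exact wellFormed_susp_nil.2 (ht.of_getElem? h)
  | r6 t₁ t₂ ol nl e => exact .app ht.susp_app.1 ht.susp_app.2
  | r7 t ol nl e => exact .lam ht.susp_lam
  | r8 t ol nl nl' e => exact (wellFormed_susp_nil.1 ht).susp_add nl'
  | r9 t => exact wellFormed_susp_nil.1 ht
  | r10 k ol nl e t hk h => exact ht.of_getElem? h
  | r11 k ol nl e t ol' nl' e' l j hk h => exact (ht.of_getElem? h).susp_add j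
  | r12 k ol nl e t l j hk h => exact wellFormed_susp_nil.2 (ht.of_getElem? h)

theorem Compat.wellFormed {R : STerm C V → STerm C V → Prop}
    (hR : ∀ t t', R t t' → WellFormed t → WellFormed t') {t t' : STerm C V} (h : Compat R t t')
    (ht : WellFormed t) : WellFormed t' := by
  induction h with
  | root h => exact hR _ _ h ht
  | appL s _ ih =>
    rw [wellFormed_app] at ht ⊢
    exact ⟨ih ht.1, ht.2⟩
  | appR s _ ih =>
    rw [wellFormed_app] at ht ⊢
    exact ⟨ht.1, ih ht.2⟩
  | lam _ ih =>
    rw [wellFormed_lam] at ht ⊢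
    exact ih ht
  | susp ol nl e _ ih =>
    rw [wellFormed_susp] at ht ⊢
    exact ⟨ih ht.1, ht.2⟩
  | env t ol nl l e₁ e₂ _ ih =>
    rw [wellFormed_susp] at ht ⊢
    obtain ⟨h₁, h₂, h₃, h₄, h₅⟩ := ht
    refine ⟨h₁, by simpa using h₂, fun m hm => h₃ m ?_, fun r m hm => ?_, fun r m hm => ?_⟩
    · simpa using hm
    · simp only [List.mem_append, List.mem_cons, EItem.bndg.injEq] at hm
      rcases hm with hm | ⟨-, rfl⟩ | hm
      · exact h₄ r m (by simp [hm])
      · exact h₄ _ m (List.mem_append_right _ List.mem_cons_self)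
      · exact h₄ r m (by simp [hm])
    · simp only [List.mem_append, List.mem_cons, EItem.bndg.injEq] at hm
      rcases hm with hm | ⟨rfl, rfl⟩ | hm
      · exact h₅ r m (by simp [hm])
      · exact ih (h₅ _ m (List.mem_append_right _ List.mem_cons_self))
      · exact h₅ r m (by simp [hm])

theorem den_susp_lam {t : STerm C V} {ol nl : ℕ} {e : List (EItem (STerm C V))}
    (h : WellFormed (.susp (.lam t) ol nl e)) :
    (susp (.lam t) ol nl e).den =
      .lam (susp t (ol + 1) (nl + 1) (.dum nl :: e)).den := by
  simp only [den, DTerm.subst, denEnv]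
  congr 2
  funext i
  cases i with
  | zero => simp [scons, denItem]
  | succ i =>
    simp only [scons]
    rcases hx : e[i]? with _ | (l | ⟨s, l⟩)
    · have hi : e.length ≤ i := by simpa using hx
      rw [denEnv_of_le hi, denEnv_of_le hi]
      rfl
    · have := (wellFormed_susp.1 h).2.2.1 l (List.mem_of_getElem? hx)
      rw [denEnv_of_getElem? hx, denEnv_of_getElem? hx]
      simp only [denItem, DTerm.rename, DTerm.idx.injEq]
      omega
    · have := (wellFormed_susp.1 h).2.2.2.1 s l (List.mem_of_getElem? hx)
      rw [denEnv_of_getElem? hx, denEnv_of_getElem? hx]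
      simp only [denItem, DTerm.rename_rename]
      congr 1
      funext k
      simp only [Nat.succ_eq_add_one]
      omega

theorem den_susp_nil (t : STerm C V) (nl : ℕ) :
    (susp t 0 nl []).den = t.den.rename fun k => k + nl := by
  simp only [den, denEnv, DTerm.rename_eq_subst]

theorem den_susp_zero (t : STerm C V) : (susp t 0 0 []).den = t.den := by
  simp only [den, denEnv, Nat.add_zero]
  exact DTerm.subst_idx _

theorem den_susp_add {t : STerm C V} {ol nl : ℕ} {e : List (EItem (STerm C V))}
    (h : WellFormed (.susp t ol nl e)) (j : ℕ) :
    (susp t ol (nl + j) e).den = (susp t ol nl e).den.rename fun k => k + j := by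
  simp only [den, DTerm.subst_rename]
  congr 1
  funext i
  rcases hx : e[i]? with _ | (l | ⟨s, l⟩)
  · have hi : e.length ≤ i := by simpa using hx
    rw [denEnv_of_le hi, denEnv_of_le hi]
    simp only [DTerm.rename, DTerm.idx.injEq]
    omega
  · have := (wellFormed_susp.1 h).2.2.1 l (List.mem_of_getElem? hx)
    rw [denEnv_of_getElem? hx, denEnv_of_getElem? hx]
    simp only [denItem, DTerm.rename, DTerm.idx.injEq]
    omega
  · have := (wellFormed_susp.1 h).2.2.2.1 s l (List.mem_of_getElem? hx)
    rw [denEnv_of_getElem? hx, denEnv_of_getElem? hx]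
    simp only [denItem, DTerm.rename_rename]
    congr 1
    funext k
    omega

theorem den_susp_idx {k ol nl : ℕ} {e : List (EItem (STerm C V))} :
    (susp (idx k) ol nl e).den = denEnv e nl k := rfl

/-- The reading rules do not change the meaning of a well-formed term. -/
theorem ReadRule.den_eq {t t' : STerm C V} (h : ReadRule t t') (ht : WellFormed t) :
    t'.den = t.den := by
  cases h with
  | r1 c => rfl
  | r2 x => rfl
  | r3 k ol nl e hk =>
    have hl := (wellFormed_susp.1 ht).2.1
    rw [den_susp_idx, denEnv_of_le (by omega), hl, den]
  | r4 k ol nl e l j hk h hj =>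
    rw [den_susp_idx, denEnv_of_getElem? h, den, denItem]
    congr 1
    omega
  | r5 k ol nl e t l j hk h hj =>
    rw [den_susp_idx, denEnv_of_getElem? h, den_susp_nil, denItem]
    congr 1
    funext i
    omega
  | r6 t₁ t₂ ol nl e => rfl
  | r7 t ol nl e => exact (den_susp_lam ht).symm
  | r8 t ol nl nl' e => rw [den_susp_nil, den_susp_add (wellFormed_susp_nil.1 ht)]
  | r9 t => exact (den_susp_zero _).symm
  | r10 k ol nl e t hk h =>
    rw [den_susp_idx, denEnv_of_getElem? h, denItem, DTerm.rename_eq_subst]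
    simp only [Nat.sub_self, Nat.add_zero]
    exact (DTerm.subst_idx _).symm
  | r11 k ol nl e t ol' nl' e' l j hk h hl hj =>
    rw [den_susp_idx, denEnv_of_getElem? h, den_susp_add (ht.of_getElem? h), denItem]
    congr 1
    funext i
    omega
  | r12 k ol nl e t l j hk h hs hl hj =>
    rw [den_susp_idx, denEnv_of_getElem? h, den_susp_nil, denItem]
    congr 1
    funext i
    omega

theorem cost_susp_nil (t : STerm C V) (nl : ℕ) : (susp t 0 nl []).cost = 2 * t.cost := by
  simp only [cost]
  rcases t.den.headVar with _ | k <;> simp [costAt]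

/-- The variable bound by the abstraction has weight `0` in both environments. -/
theorem cost_susp_lam (t : STerm C V) (ol nl ol' nl' : ℕ) (e : List (EItem (STerm C V))) :
    (susp (lam t) ol nl e).cost = (susp t ol' nl' (.dum nl :: e)).cost + 2 := by
  simp only [cost, den, DTerm.headVar]
  rcases t.den.headVar with _ | (_ | k) <;> simp [costAt, costItem] <;> omega

theorem ReadRule.cost_lt {t t' : STerm C V} (h : ReadRule t t') : t'.cost < t.cost := by
  cases h with
  | r1 c => simp only [cost]; omega
  | r2 x => simp only [cost]; omega
  | r3 k ol nl e hk => simp only [cost]; omega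
  | r4 k ol nl e l j hk h hj => simp only [cost]; omega
  | r5 k ol nl e t l j hk h hj =>
    rw [cost_susp_nil]
    simp only [cost, den, DTerm.headVar, Option.elim_some, costAt_of_getElem? h, costItem]
    omega
  | r6 t₁ t₂ ol nl e => simp only [cost, den, DTerm.headVar]; omega
  | r7 t ol nl e =>
    rw [cost_susp_lam t ol nl (ol + 1) (nl + 1) e, cost]
    omega
  | r8 t ol nl nl' e =>
    have := cost_pos t
    simp only [cost_susp_nil]
    simp only [cost]
    omega
  | r9 t =>
    have := cost_pos t'
    rw [cost_susp_nil]
    omega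
  | r10 k ol nl e t hk h =>
    simp only [cost, den, DTerm.headVar, Option.elim_some, costAt_of_getElem? h, costItem]
    omega
  | r11 k ol nl e t ol' nl' e' l j hk h hl hj =>
    simp only [cost, den, DTerm.headVar, Option.elim_some, costAt_of_getElem? h, costItem]
    omega
  | r12 k ol nl e t l j hk h hs hl hj =>
    rw [cost_susp_nil]
    simp only [cost, den, DTerm.headVar, Option.elim_some, costAt_of_getElem? h, costItem]
    omega

/-! ### Reading a suspension term -/

theorem den_toSTerm (d : DTerm C V) : d.toSTerm.den = d := by
  induction d with
  | const c => rfl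
  | ivar x => rfl
  | idx k => rfl
  | app _ _ h₁ h₂ => simp only [DTerm.toSTerm, den, h₁, h₂]
  | lam _ h => simp only [DTerm.toSTerm, den, h]

theorem Compat.den_eq {t t' : STerm C V} (h : Compat ReadRule t t') (ht : WellFormed t) :
    t'.den = t.den := by
  induction h with
  | root h => exact h.den_eq ht
  | appL s _ ih => simp only [den, ih (wellFormed_app.1 ht).1]
  | appR s _ ih => simp only [den, ih (wellFormed_app.1 ht).2]
  | lam _ ih => simp only [den, ih (wellFormed_lam.1 ht)]
  | susp ol nl e _ ih => simp only [den, ih (wellFormed_susp.1 ht).1]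
  | env t ol nl l e₁ e₂ _ ih =>
    have := ih ((wellFormed_susp.1 ht).2.2.2.2 _ l (by simp))
    simp only [den]
    congr 1
    funext k
    rcases eq_or_ne k e₁.length with rfl | hk
    · simp only [denEnv_append_length, denItem, this]
    · exact denEnv_append_of_ne _ _ _ _ _ hk

theorem ReadStar.den_eq {t t' : STerm C V} (h : ReadStar t t') (ht : WellFormed t) :
    t'.den = t.den := by
  induction h using Relation.ReflTransGen.head_induction_on with
  | refl => rfl
  | head h _ ih =>
    rw [ih (h.wellFormed (fun _ _ h => h.wellFormed) ht), h.den_eq ht]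

end STerm

/-- The relation `P` between the terms of two environment items with equal levels. -/
inductive ItemRel {α β : Type*} (P : α → β → Prop) : EItem α → EItem β → Prop
  | dum (l : ℕ) : ItemRel P (.dum l) (.dum l)
  | bndg {t : α} {s : β} (l : ℕ) : P t s → ItemRel P (.bndg t l) (.bndg s l)

namespace STerm

variable {C V : Type*} {R : STerm C V → STerm C V → Prop}

/-- A finite, possibly empty, series of applications of `R` to subterms. -/
abbrev Star (R : STerm C V → STerm C V → Prop) : STerm C V → STerm C V → Prop :=
  Relation.ReflTransGen (Compat R)

theorem Star.wellFormed (hR : ∀ t t', R t t' → WellFormed t → WellFormed t') {t t' : STerm C V}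
    (h : Star R t t') (ht : WellFormed t) : WellFormed t' := by
  induction h with
  | refl => exact ht
  | tail _ h ih => exact h.wellFormed hR ih

theorem Star.app {t t' s s' : STerm C V} (h₁ : Star R t t') (h₂ : Star R s s') :
    Star R (app t s) (app t' s') :=
  (reflTransGen_map (STerm.app · s) (fun _ _ h => Compat.appL s h) h₁).trans
    (reflTransGen_map (STerm.app t' ·) (fun _ _ h => Compat.appR t' h) h₂)

theorem Star.lam {t t' : STerm C V} (h : Star R t t') : Star R (lam t) (lam t') :=
  reflTransGen_map STerm.lam (fun _ _ h => Compat.lam h) h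

theorem Star.susp_left {t t' : STerm C V} (h : Star R t t') (ol nl : ℕ)
    (e : List (EItem (STerm C V))) : Star R (susp t ol nl e) (susp t' ol nl e) :=
  reflTransGen_map (STerm.susp · ol nl e) (fun _ _ h => Compat.susp ol nl e h) h

theorem Star.susp_right (t : STerm C V) (ol nl : ℕ) {e e' : List (EItem (STerm C V))}
    (h : List.Forall₂ (ItemRel (Star R)) e e') : Star R (susp t ol nl e) (susp t ol nl e') := by
  suffices ∀ p, Star R (susp t ol nl (p ++ e)) (susp t ol nl (p ++ e')) from this []
  induction h with
  | nil => exact fun _ => .refl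
  | @cons x x' e e' hx _ ih =>
    intro p
    refine Relation.ReflTransGen.trans (b := susp t ol nl (p ++ x' :: e)) ?_
      (by simpa using ih (p ++ [x']))
    cases hx with
    | dum l => exact .refl
    | @bndg s s' l hs =>
      exact reflTransGen_map (fun s => STerm.susp t ol nl (p ++ .bndg s l :: e))
        (fun _ _ h => Compat.env t ol nl l p e h) hs

theorem Star.susp {t t' : STerm C V} (h : Star R t t') (ol nl : ℕ)
    {e e' : List (EItem (STerm C V))} (he : List.Forall₂ (ItemRel (Star R)) e e') :
    Star R (STerm.susp t ol nl e) (STerm.susp t' ol nl e') :=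
  (h.susp_left ol nl e).trans (susp_right t' ol nl he)

/-- A suspension of a de Bruijn term can be read if the terms in its environment can be read after
a shift of their free variables. -/
theorem ReadStar.susp_toSTerm (d : DTerm C V) (ol nl : ℕ) (e : List (EItem (STerm C V)))
    (h : WellFormed (susp d.toSTerm ol nl e))
    (he : ∀ s l, EItem.bndg s l ∈ e → ∀ j,
      ReadStar (susp s 0 j []) (susp s 0 j []).den.toSTerm) :
    ReadStar (susp d.toSTerm ol nl e) (susp d.toSTerm ol nl e).den.toSTerm := by
  induction d generalizing ol nl e with
  | const c => exact .single (.root (.r1 _ _ _ _))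
  | ivar x => exact .single (.root (.r2 _ _ _ _))
  | idx k =>
    have hl := (wellFormed_susp.1 h).2.1
    rcases hx : e[k]? with _ | (l | ⟨s, l⟩)
    · have hk : e.length ≤ k := by simpa using hx
      rw [DTerm.toSTerm, den_susp_idx, denEnv_of_le hk]
      exact .single (.root (hl ▸ .r3 k e.length nl e hk))
    · have hm := (wellFormed_susp.1 h).2.2.1 l (List.mem_of_getElem? hx)
      have hk : k < e.length := (List.getElem?_eq_some_iff.1 hx).1
      rw [DTerm.toSTerm, den_susp_idx, denEnv_of_getElem? hx]
      exact .single (.root (.r4 k ol nl e l _ (by omega) hx (by omega)))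
    · have hm := (wellFormed_susp.1 h).2.2.2.1 s l (List.mem_of_getElem? hx)
      have hk : k < e.length := (List.getElem?_eq_some_iff.1 hx).1
      have hr : ReadRule (susp (idx k) ol nl e) (susp s 0 (nl - l) []) :=
        .r5 k ol nl e s l (nl - l) (by omega) hx (by omega)
      rw [DTerm.toSTerm, ← hr.den_eq h]
      exact .head (.root hr) (he s l (List.mem_of_getElem? hx) _)
  | app t₁ t₂ ih₁ ih₂ =>
    exact .head (.root (.r6 _ _ _ _ _))
      (Star.app (ih₁ ol nl e h.susp_app.1 he) (ih₂ ol nl e h.susp_app.2 he))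
  | lam t ih =>
    rw [DTerm.toSTerm, den_susp_lam h]
    exact .head (.root (.r7 _ _ _ _)) (Star.lam (ih _ _ _ h.susp_lam (by simpa using he)))

/-- The reading rules transform a well-formed term into the de Bruijn term it stands for. -/
theorem WellFormed.readStar_den {t : STerm C V} (h : WellFormed t) :
    ReadStar t t.den.toSTerm := by
  induction h with
  | const c => exact .refl
  | ivar x => exact .refl
  | idx k => exact .refl
  | app _ _ h₁ h₂ => exact Star.app h₁ h₂
  | lam _ h => exact Star.lam h
  | @susp t ol nl e ht hl hd hb hw iht ihe =>
    let f : EItem (STerm C V) → EItem (STerm C V)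
      | .dum l => .dum l
      | .bndg s l => .bndg s.den.toSTerm l
    have he : List.Forall₂ (ItemRel (Star ReadRule)) e (e.map f) := by
      rw [List.forall₂_map_right_iff, List.forall₂_same]
      intro x hx
      cases x with
      | dum l => exact .dum l
      | bndg s l => exact .bndg l (ihe s l hx)
    have hs : ReadStar (STerm.susp t ol nl e) (STerm.susp t.den.toSTerm ol nl (e.map f)) :=
      Star.susp iht ol nl he
    have hwf : WellFormed (STerm.susp t ol nl e) := .susp ht hl hd hb hw
    have hwf' : WellFormed (STerm.susp t.den.toSTerm ol nl (e.map f)) :=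
      Star.wellFormed (fun _ _ h => h.wellFormed) hs hwf
    rw [← hs.den_eq hwf]
    refine hs.trans (ReadStar.susp_toSTerm _ _ _ _ hwf' ?_)
    intro s l hs j
    obtain ⟨x, -, hx⟩ := List.mem_map.1 hs
    cases x with
    | dum l => cases hx
    | bndg s l =>
      cases hx
      -- The environment is now empty, so that no further terms have to be read.
      exact ReadStar.susp_toSTerm _ _ _ _ (wellFormed_susp_nil.2 (hwf'.bndg hs)) (by simp)

theorem IsHeadApp.den {t : STerm C V} (h : IsHeadApp t) : DTerm.IsHeadApp t.den := by
  induction h with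
  | const c => exact .const c
  | ivar x => exact .ivar x
  | idx k => exact .idx k
  | app s _ ih => exact .app _ ih

theorem IsGenHNF.den {t : STerm C V} (h : IsGenHNF t) : DTerm.IsHNF t.den := by
  induction h with
  | body h => exact .body h.den
  | lam _ ih => exact .lam ih

/-! ### Rewriting and the weight of the head path -/

/-- The rewrite rules, with (β'_s) replaced by its composition with the reading rule for
abstractions.  In a well-formed instance of (β'_s), the tail of the environment may contain a second
item `@nl`, and then the right-hand side is not well-formed.  The composite rule, in contrast,
preserves well-formedness. -/
inductive Rule : STerm C V → STerm C V → Prop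
  | read {t t' : STerm C V} : ReadRule t t' → Rule t t'
  | beta (t₁ t₂ : STerm C V) : Rule (app (lam t₁) t₂) (susp t₁ 1 0 [.bndg t₂ 0])
  | betaSusp (t₁ t₂ : STerm C V) (ol nl : ℕ) (e : List (EItem (STerm C V))) :
      Rule (app (susp (lam t₁) ol nl e) t₂) (susp t₁ (ol + 1) nl (.bndg t₂ nl :: e))

/-- Rewriting by the rules `Rule`. -/
abbrev Steps : STerm C V → STerm C V → Prop := Star Rule

theorem Compat.rewriteStar {t t' : STerm C V} (h : Compat Rule t t') : RewriteStar t t' := by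
  induction h with
  | root h =>
    cases h with
    | read h => exact .single (.root (.inl h))
    | beta t₁ t₂ => exact .single (.root (.inr (.beta _ _)))
    | betaSusp t₁ t₂ ol nl e =>
      exact .head (.appL _ (.root (.inl (.r7 _ _ _ _)))) (.single (.root (.inr (.beta' _ _ _ _ _))))
  | appL s _ ih => exact Star.app ih .refl
  | appR s _ ih => exact Star.app .refl ih
  | lam _ ih => exact Star.lam ih
  | susp ol nl e _ ih => exact Star.susp_left ih ol nl e
  | env t ol nl l e₁ e₂ _ ih =>
    exact reflTransGen_map (fun s => STerm.susp t ol nl (e₁ ++ .bndg s l :: e₂))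
      (fun _ _ h => Compat.env t ol nl l e₁ e₂ h) ih

theorem Steps.rewriteStar {t t' : STerm C V} (h : Steps t t') : RewriteStar t t' := by
  induction h with
  | refl => exact .refl
  | tail _ h ih => exact Relation.ReflTransGen.trans ih h.rewriteStar

theorem Rule.wellFormed {t t' : STerm C V} (h : Rule t t') (ht : WellFormed t) :
    WellFormed t' := by
  cases h with
  | read h => exact h.wellFormed ht
  | beta t₁ t₂ =>
    rw [wellFormed_app] at ht
    exact (wellFormed_susp_nil.2 ht.1).susp_bndg ht.2
  | betaSusp t₁ t₂ ol nl e =>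
    rw [wellFormed_app] at ht
    exact ht.1.susp_bndg ht.2

theorem Steps.wellFormed {t t' : STerm C V} (h : Steps t t') (ht : WellFormed t) :
    WellFormed t' :=
  Star.wellFormed (fun _ _ h => h.wellFormed) h ht

/-- The rule `Rule.betaSusp` acts on the meaning as one contraction, at the root. -/
theorem headStep_betaSusp (t₁ t₂ : STerm C V) (ol nl : ℕ) (e : List (EItem (STerm C V))) :
    DTerm.HeadStep (app (susp (lam t₁) ol nl e) t₂).den
      (susp t₁ (ol + 1) nl (.bndg t₂ nl :: e)).den := by
  have := DTerm.HeadStep.contract (t₁.den.subst (DTerm.up (denEnv e nl))) t₂.den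
  rw [DTerm.up_subst_scons] at this
  have hd : denEnv (.bndg t₂ nl :: e) nl = scons t₂.den (denEnv e nl) := by
    simp only [denEnv, denItem, Nat.sub_self, Nat.add_zero, DTerm.rename_eq_subst]
    rw [DTerm.subst_idx]
  simp only [den, hd]
  exact this

/-- On passing from `t` to `t'`, either a redex on the head path is contracted, or the head
variable stays the same and the weight of the head path falls by at least `k`. -/
def Descends (k : ℕ) (t t' : STerm C V) : Prop :=
  DTerm.BetaHead t.den t'.den ∨
    DTerm.BetaStar t.den t'.den ∧ t'.den.headVar = t.den.headVar ∧ t'.cost + k ≤ t.cost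

theorem Descends.betaStar {k : ℕ} {t t' : STerm C V} (h : Descends k t t') :
    DTerm.BetaStar t.den t'.den := by
  rcases h with h | h
  · exact h.betaStar
  · exact h.1

theorem Descends.refl (t : STerm C V) : Descends 0 t t := .inr ⟨.refl, rfl, le_rfl⟩

theorem Descends.mono {k j : ℕ} (hkj : j ≤ k) {t t' : STerm C V} (h : Descends k t t') :
    Descends j t t' := by
  rcases h with h | h
  · exact .inl h
  · exact .inr ⟨h.1, h.2.1, by omega⟩

theorem Descends.trans {k j : ℕ} {t s r : STerm C V} (h : Descends k t s)
    (h' : Descends j s r) : Descends (k + j) t r := by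
  rcases h with h | h
  · exact .inl (h.trans h'.betaStar)
  · rcases h' with h' | h'
    · exact .inl (h.1.trans_betaHead h')
    · exact .inr ⟨h.1.trans h'.1, h'.2.1.trans h.2.1, by omega⟩

theorem ReadRule.descends {t t' : STerm C V} (h : ReadRule t t') (ht : WellFormed t) :
    Descends 1 t t' := by
  have hd := h.den_eq ht
  exact .inr ⟨hd ▸ .refl, by rw [hd], h.cost_lt⟩

theorem Rule.descends {t t' : STerm C V} (h : Rule t t') (ht : WellFormed t) :
    Descends 1 t t' := by
  cases h with
  | read h => exact h.descends ht
  | beta t₁ t₂ =>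
    have := headStep_betaSusp t₁ t₂ 0 0 []
    rw [den, den_susp_zero] at this
    exact .inl this.betaHead
  | betaSusp t₁ t₂ ol nl e =>
    exact .inl (headStep_betaSusp _ _ _ _ _).betaHead

theorem Descends.susp_left {k : ℕ} {t t' : STerm C V} (h : Descends k t t') (ol nl : ℕ)
    (e : List (EItem (STerm C V))) : Descends k (susp t ol nl e) (susp t' ol nl e) := by
  rcases h with h | ⟨h₁, h₂, h₃⟩
  · exact .inl (h.subst _)
  · refine .inr ⟨h₁.subst _, ?_, ?_⟩
    · simp only [den, DTerm.headVar_subst, h₂]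
    · simp only [cost, h₂]
      omega

/-- Rewriting an item of the environment matters for the head path only if the item is bound to
the head variable. -/
theorem Descends.susp_env {s s' : STerm C V} (h : Descends 0 s s') (t : STerm C V)
    (ol nl l : ℕ) (e₁ e₂ : List (EItem (STerm C V))) :
    Descends 0 (susp t ol nl (e₁ ++ .bndg s l :: e₂)) (susp t ol nl (e₁ ++ .bndg s' l :: e₂)) := by
  have hb : ∀ i, DTerm.BetaStar (denEnv (e₁ ++ .bndg s l :: e₂) nl i)
      (denEnv (e₁ ++ .bndg s' l :: e₂) nl i) := by
    intro i
    rcases eq_or_ne i e₁.length with rfl | hi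
    · simp only [denEnv_append_length, denItem]
      exact h.betaStar.rename _
    · rw [denEnv_append_of_ne e₁ e₂ _ (.bndg s' l) nl hi]
      exact .refl
  have hstar := DTerm.BetaStar.subst_right t.den hb
  rcases hv : t.den.headVar with _ | i
  · exact .inr ⟨hstar, by simp [den, DTerm.headVar_subst, hv], by simp [cost, hv]⟩
  · rcases eq_or_ne i e₁.length with rfl | hi
    · rcases h with h | ⟨h₁, h₂, h₃⟩
      · refine .inl (DTerm.BetaHead.subst_right hv ?_ hb)
        simp only [denEnv_append_length, denItem]
        exact h.rename _
      · refine .inr ⟨hstar, ?_, ?_⟩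
        · simp [den, DTerm.headVar_subst, hv, denEnv_append_length, denItem,
            DTerm.headVar_rename, h₂]
        · simp only [cost, hv, Option.elim_some, costAt_append_length, costItem]
          omega
    · refine .inr ⟨hstar, ?_, ?_⟩
      · simp [den, DTerm.headVar_subst, hv, denEnv_append_of_ne e₁ e₂ _ (.bndg s' l) nl hi]
      · simp [cost, hv, costAt_append_of_ne e₁ e₂ _ (.bndg s' l) hi]

/-- Rewriting at any position of a well-formed term, even in an argument, is harmless for the
termination measures. -/
theorem Compat.descends {t t' : STerm C V} (h : Compat Rule t t') (ht : WellFormed t) :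
    Descends 0 t t' := by
  induction h with
  | root h => exact (h.descends ht).mono (by omega)
  | appL s _ ih =>
    rcases ih (wellFormed_app.1 ht).1 with h | ⟨h₁, h₂, h₃⟩
    · exact .inl (h.appL _)
    · exact .inr ⟨h₁.appL _, h₂, by simp only [cost]; omega⟩
  | appR s _ ih =>
    exact .inr ⟨(ih (wellFormed_app.1 ht).2).betaStar.appR _, rfl, le_rfl⟩
  | lam _ ih =>
    rcases ih (wellFormed_lam.1 ht) with h | ⟨h₁, h₂, h₃⟩
    · exact .inl h.lam
    · exact .inr ⟨h₁.lam, by simp only [den, DTerm.headVar, h₂], by simp only [cost]; omega⟩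
  | susp ol nl e _ ih => exact (ih (wellFormed_susp.1 ht).1).susp_left ol nl e
  | env t ol nl l e₁ e₂ _ ih =>
    exact (ih ((wellFormed_susp.1 ht).2.2.2.2 _ l (by simp))).susp_env
      t ol nl l e₁ e₂

theorem Steps.descends {t t' : STerm C V} (h : Steps t t') (ht : WellFormed t) :
    Descends 0 t t' := by
  induction h with
  | refl => exact .refl _
  | tail h h' ih => exact ih.trans (h'.descends (Steps.wellFormed h ht))

/-- A series of steps that removes the suspension at the root applies a rule at the root, hence on
the head path. -/
theorem Steps.descends_one {t t' : STerm C V} (h : Steps t t') (ht : WellFormed t)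
    (hs : t.IsSusp) (hs' : ¬ t'.IsSusp) : Descends 1 t t' := by
  induction h using Relation.ReflTransGen.head_induction_on with
  | refl => exact absurd hs hs'
  | head h h' ih =>
    have hw := h.wellFormed (fun _ _ h => h.wellFormed) ht
    cases h with
    | root h => exact (h.descends ht).trans (Steps.descends h' hw)
    | appL => exact hs.elim
    | appR => exact hs.elim
    | lam => exact hs.elim
    | susp ol nl e h =>
      simpa using ((Compat.susp ol nl e h).descends ht).trans (ih hw trivial)
    | env t ol nl l e₁ e₂ h =>
      simpa using ((Compat.env t ol nl l e₁ e₂ h).descends ht).trans (ih hw trivial)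

/-! ### Terms under a possibly trivial suspension -/

/-- The suspension `⟦t, ol, nl, e⟧`, or just `t` if it is trivial. -/
def wrap (t : STerm C V) (ol nl : ℕ) (e : List (EItem (STerm C V))) : STerm C V :=
  if ol = 0 ∧ nl = 0 then t else susp t ol nl e

theorem wrap_zero (t : STerm C V) (e : List (EItem (STerm C V))) : wrap t 0 0 e = t := by
  simp [wrap]

theorem wrap_of_ne (t : STerm C V) {ol nl : ℕ} (h : ¬ (ol = 0 ∧ nl = 0))
    (e : List (EItem (STerm C V))) : wrap t ol nl e = susp t ol nl e := by
  simp [wrap, h]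

theorem Steps.susp_wrap {t : STerm C V} {ol nl : ℕ} {e : List (EItem (STerm C V))}
    (h : e.length = ol) : Steps (susp t ol nl e) (wrap t ol nl e) := by
  unfold wrap
  split_ifs with h0
  · obtain ⟨rfl, rfl⟩ := h0
    rw [List.length_eq_zero_iff] at h
    subst h
    exact .single (.root (.read (.r9 _)))
  · exact .refl

theorem Steps.wrap {t t' : STerm C V} (h : Steps t t') (ol nl : ℕ)
    {e e' : List (EItem (STerm C V))} (he : List.Forall₂ (ItemRel Steps) e e') :
    Steps (wrap t ol nl e) (wrap t' ol nl e') := by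
  unfold STerm.wrap
  split_ifs with h0
  · exact h
  · exact Star.susp h ol nl he

theorem den_wrap {t : STerm C V} {ol nl : ℕ} {e : List (EItem (STerm C V))}
    (h : e.length = ol) : (wrap t ol nl e).den = (susp t ol nl e).den := by
  unfold wrap
  split_ifs with h0
  · obtain ⟨rfl, rfl⟩ := h0
    rw [List.length_eq_zero_iff] at h
    subst h
    exact (den_susp_zero _).symm
  · rfl

theorem wellFormed_wrap {t : STerm C V} {ol nl : ℕ} {e : List (EItem (STerm C V))}
    (h : e.length = ol) : WellFormed (wrap t ol nl e) ↔ WellFormed (susp t ol nl e) := by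
  unfold wrap
  split_ifs with h0
  · obtain ⟨rfl, rfl⟩ := h0
    rw [List.length_eq_zero_iff] at h
    subst h
    exact wellFormed_susp_nil.symm
  · rfl

theorem Steps.wrap_app (t₁ t₂ : STerm C V) (ol nl : ℕ) (e : List (EItem (STerm C V))) :
    Steps (STerm.wrap (app t₁ t₂) ol nl e)
      (app (STerm.wrap t₁ ol nl e) (STerm.wrap t₂ ol nl e)) := by
  unfold STerm.wrap
  split_ifs with h0
  · exact .refl
  · exact .single (.root (.read (.r6 _ _ _ _ _)))

theorem Steps.wrap_beta (t a : STerm C V) {ol nl : ℕ} {e : List (EItem (STerm C V))}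
    (h : e.length = ol) :
    Steps (app (STerm.wrap (lam t) ol nl e) a) (susp t (ol + 1) nl (.bndg a nl :: e)) := by
  unfold STerm.wrap
  split_ifs with h0
  · obtain ⟨rfl, rfl⟩ := h0
    rw [List.length_eq_zero_iff] at h
    subst h
    exact .single (.root (.beta _ _))
  · exact .single (.root (.betaSusp _ _ _ _ _))

end STerm

/-! ### References and the terms they represent -/

section HeapLemmas

variable {C V : Type*} {h h' : Heap C V}

theorem ItemRel.imp {α β : Type*} {P Q : α → β → Prop} (hPQ : ∀ a b, P a b → Q a b)
    {x : EItem α} {y : EItem β} (hx : ItemRel P x y) : ItemRel Q x y := by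
  cases hx with
  | dum l => exact .dum l
  | bndg l hx => exact .bndg l (hPQ _ _ hx)

theorem exists_forall₂_itemRel {α β : Type*} {P : α → β → Prop} {R : β → β → Prop}
    {env : List (EItem α)} {e : List (EItem β)}
    (he : List.Forall₂ (ItemRel fun u s => ∃ s', P u s' ∧ R s s') env e) :
    ∃ e', List.Forall₂ (ItemRel P) env e' ∧ List.Forall₂ (ItemRel R) e e' := by
  induction he with
  | nil => exact ⟨[], .nil, .nil⟩
  | cons hx _ ih =>
    obtain ⟨e', h₁, h₂⟩ := ih
    cases hx with
    | dum l => exact ⟨.dum l :: e', .cons (.dum l) h₁, .cons (.dum l) h₂⟩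
    | bndg l hx =>
      obtain ⟨s', h₃, h₄⟩ := hx
      exact ⟨.bndg s' l :: e', .cons (.bndg l h₃) h₁, .cons (.bndg l h₄) h₂⟩

theorem forall₂_itemRel_mem {α β : Type*} {P : α → β → Prop} {env : List (EItem α)}
    {e : List (EItem β)} (he : List.Forall₂ (ItemRel P) env e) {u : α} {l : ℕ}
    (hu : EItem.bndg u l ∈ env) : ∃ s, EItem.bndg s l ∈ e ∧ P u s := by
  induction he with
  | nil => simp at hu
  | cons hx _ ih =>
    rcases List.mem_cons.1 hu with hu | hu
    · subst hu
      cases hx with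
      | bndg l hx => exact ⟨_, List.mem_cons_self, hx⟩
    · obtain ⟨s, hs, hp⟩ := ih hu
      exact ⟨s, List.mem_cons_of_mem _ hs, hp⟩

theorem forall₂_itemRel_getElem? {α β : Type*} {P : α → β → Prop} {env : List (EItem α)}
    {e : List (EItem β)} (he : List.Forall₂ (ItemRel P) env e) {k : ℕ} (hk : k < e.length) :
    ∃ x y, env[k]? = some x ∧ e[k]? = some y ∧ ItemRel P x y := by
  induction he generalizing k with
  | nil => simp at hk
  | cons hx _ ih =>
    cases k with
    | zero => exact ⟨_, _, rfl, rfl, hx⟩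
    | succ k =>
      simp only [List.getElem?_cons_succ]
      exact ih (by simpa using hk)

theorem representsEnv_iff {env : List (EItem Loc)} {e : List (EItem (STerm C V))} :
    RepresentsEnv h env e ↔ List.Forall₂ (ItemRel (Represents h)) env e := by
  constructor
  · intro he
    induction env generalizing e with
    | nil => cases he; exact .nil
    | cons x env ih =>
      cases he with
      | dum he => exact .cons (.dum _) (ih he)
      | bndg hx he => exact .cons (.bndg _ hx) (ih he)
  · intro he
    induction he with
    | nil => exact .nil
    | cons hx _ ih =>
      cases hx with
      | dum l => exact .dum ih
      | bndg l hx => exact .bndg hx ih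

/-- Induction on the representation of terms alone. -/
theorem Represents.induct {motive : Loc → STerm C V → Prop}
    (const : ∀ {t c}, h[t]? = some (.const c) → motive t (.const c))
    (fv : ∀ {t x}, h[t]? = some (.fv x) → motive t (.ivar x))
    (bv : ∀ {t k}, h[t]? = some (.bv (k + 1)) → motive t (.idx k))
    (ptr : ∀ {t t' s}, h[t]? = some (.ptr t') → Represents h t' s → motive t' s → motive t s)
    (lam : ∀ {t t' s}, h[t]? = some (.lam t') → Represents h t' s → motive t' s →
      motive t (.lam s))
    (app : ∀ {t t₁ t₂ s₁ s₂}, h[t]? = some (.app t₁ t₂) → Represents h t₁ s₁ →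
      Represents h t₂ s₂ → motive t₁ s₁ → motive t₂ s₂ → motive t (.app s₁ s₂))
    (susp : ∀ {t t' ol nl env s e}, h[t]? = some (.susp t' ol nl env) → Represents h t' s →
      motive t' s → List.Forall₂ (ItemRel fun u r => Represents h u r ∧ motive u r) env e →
      motive t (.susp s ol nl e))
    {t : Loc} {s : STerm C V} (hs : Represents h t s) : motive t s :=
  Represents.rec (h := h) (motive_1 := fun t s _ => motive t s)
    (motive_2 := fun env e _ =>
      List.Forall₂ (ItemRel fun u r => Represents h u r ∧ motive u r) env e)
    (fun h => const h) (fun h => fv h) (fun h => bv h) (fun h₁ h₂ h₃ => ptr h₁ h₂ h₃)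
    (fun h₁ h₂ h₃ => lam h₁ h₂ h₃) (fun h₁ h₂ h₃ h₄ h₅ => app h₁ h₂ h₃ h₄ h₅)
    (fun h₁ h₂ _ h₄ h₅ => susp h₁ h₂ h₄ h₅)
    .nil (fun _ he => .cons (.dum _) he) (fun h₁ _ h₃ h₄ => .cons (.bndg _ ⟨h₁, h₃⟩) h₄) hs

theorem forall₂_itemRel_unique {α β : Type*} {P : α → β → Prop} {env : List (EItem α)}
    {e e' : List (EItem β)}
    (he : List.Forall₂ (ItemRel fun u s => ∀ s', P u s' → s' = s) env e)
    (he' : List.Forall₂ (ItemRel P) env e') : e' = e := by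
  induction he generalizing e' with
  | nil => cases he'; rfl
  | cons hx _ ih =>
    cases he' with
    | cons hx' he' =>
      rw [ih he']
      cases hx with
      | dum l => cases hx'; rfl
      | bndg l hx =>
        cases hx' with
        | bndg l hx' => rw [hx _ hx']

/-- A reference represents at most one term. -/
theorem Represents.unique {t : Loc} {s s' : STerm C V} (hs : Represents h t s)
    (hs' : Represents h t s') : s' = s := by
  refine Represents.induct (motive := fun t s => ∀ s', Represents h t s' → s' = s)
    ?_ ?_ ?_ ?_ ?_ ?_ ?_ hs s' hs'
  · intro t c ht s' hs'
    cases hs' <;> simp_all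
  · intro t c ht s' hs'
    cases hs' <;> simp_all
  · intro t c ht s' hs'
    cases hs' <;> simp_all
  · intro t t' s ht _ ih s' hs'
    cases hs' <;> simp_all
  · intro t t' s ht _ ih s' hs'
    cases hs' with
    | lam ht' hs' =>
      rw [ht] at ht'
      cases ht'
      rw [ih _ hs']
    | _ => simp_all
  · intro t t₁ t₂ s₁ s₂ ht _ _ ih₁ ih₂ s' hs'
    cases hs' with
    | app ht' h₁ h₂ =>
      rw [ht] at ht'
      cases ht'
      rw [ih₁ _ h₁, ih₂ _ h₂]
    | _ => simp_all
  · intro t t' ol nl env s e ht _ ih he s' hs'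
    cases hs' with
    | susp ht' h₁ h₂ =>
      rw [ht] at ht'
      cases ht'
      rw [ih _ h₁, forall₂_itemRel_unique (he.imp fun _ _ => ItemRel.imp fun _ _ h => h.2)
        (representsEnv_iff.1 h₂)]
    | _ => simp_all

/-- The references reachable from one that represents a term form a well-founded graph. -/
theorem Represents.acc {t : Loc} {s : STerm C V} (hs : Represents h t s) :
    Acc (fun v u => Edge h u v) t := by
  refine Represents.induct (motive := fun t _ => Acc (fun v u => Edge h u v) t)
    ?_ ?_ ?_ ?_ ?_ ?_ ?_ hs
  all_goals intros
  all_goals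
    refine Acc.intro _ fun v hv => ?_
    obtain ⟨c, hc, hv⟩ := hv
  · simp_all; cases hv
  · simp_all; cases hv
  · simp_all; cases hv
  · rename_i ht _ ih; rw [ht] at hc; cases hc; cases hv; exact ih
  · rename_i ht _ ih; rw [ht] at hc; cases hc; cases hv; exact ih
  · rename_i ht _ _ ih₁ ih₂
    rw [ht] at hc
    cases hc
    cases hv
    · exact ih₁
    · exact ih₂
  · rename_i ht _ ih he
    rw [ht] at hc
    cases hc
    cases hv with
    | susp => exact ih
    | env _ _ _ _ _ l hm =>
      obtain ⟨s, -, hs⟩ := forall₂_itemRel_mem he hm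
      exact hs.2

theorem Represents.not_transGen {t : Loc} {s : STerm C V} (hs : Represents h t s) :
    ¬ Relation.TransGen (Edge h) t t := by
  have irrefl : ∀ {r : Loc → Loc → Prop} {a : Loc}, Acc r a → ¬ r a a := by
    intro r a ha
    induction ha with
    | intro a _ ih => exact fun h => ih a h h
  intro ht
  exact irrefl hs.acc.transGen (Relation.transGen_swap.2 ht)

theorem Represents.lt_length {t : Loc} {s : STerm C V} (hs : Represents h t s) :
    t < h.length := by
  cases hs with
  | _ ht => exact (List.getElem?_eq_some_iff.1 ht).1

theorem Represents.edge {t v : Loc} {s : STerm C V} (hs : Represents h t s) (hv : Edge h t v) :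
    ∃ r, Represents h v r := by
  obtain ⟨c, hc, hv⟩ := hv
  cases hs with
  | const ht => rw [ht] at hc; cases hc; cases hv
  | fv ht => rw [ht] at hc; cases hc; cases hv
  | bv ht => rw [ht] at hc; cases hc; cases hv
  | ptr ht hs => rw [ht] at hc; cases hc; cases hv; exact ⟨_, hs⟩
  | lam ht hs => rw [ht] at hc; cases hc; cases hv; exact ⟨_, hs⟩
  | app ht h₁ h₂ =>
    rw [ht] at hc
    cases hc
    cases hv
    · exact ⟨_, h₁⟩
    · exact ⟨_, h₂⟩
  | susp ht hs he =>
    rw [ht] at hc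
    cases hc
    cases hv with
    | susp => exact ⟨_, hs⟩
    | env _ _ _ _ _ l hm =>
      obtain ⟨r, -, hr⟩ := forall₂_itemRel_mem (representsEnv_iff.1 he) hm
      exact ⟨r, hr⟩

/-! ### Parts of the heap that an evaluation may change -/

/-- The set `S` contains every reference that can be reached from it, and every location that
has not been allocated yet. -/
structure Closed (h : Heap C V) (S : Set Loc) : Prop where
  free : ∀ u, h.length ≤ u → u ∈ S
  edge : ∀ u v, u ∈ S → Edge h u v → v ∈ S

/-- The passage from `h` to `h'` leaves the contents of the locations outside `S` unchanged, and
no reference to them becomes reachable from `S`. -/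
structure Frame (S : Set Loc) (h h' : Heap C V) : Prop where
  closed : Closed h' S
  agree : ∀ u, u ∉ S → h'[u]? = h[u]?

/-- The references of an environment belong to `S`. -/
def EnvIn (S : Set Loc) (env : List (EItem Loc)) : Prop := ∀ v l, EItem.bndg v l ∈ env → v ∈ S

theorem envIn_nil (S : Set Loc) : EnvIn S [] := by
  intro v l hv
  simp at hv

theorem EnvIn.bndg {S : Set Loc} {env : List (EItem Loc)} {v : Loc} (hv : v ∈ S)
    (he : EnvIn S env) (l : ℕ) : EnvIn S (.bndg v l :: env) := by
  intro u m hu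
  rcases List.mem_cons.1 hu with hu | hu
  · cases hu; exact hv
  · exact he u m hu

theorem EnvIn.dum {S : Set Loc} {env : List (EItem Loc)} (he : EnvIn S env) (l : ℕ) :
    EnvIn S (.dum l :: env) := by
  intro u m hu
  rcases List.mem_cons.1 hu with hu | hu
  · cases hu
  · exact he u m hu

theorem Frame.refl {S : Set Loc} (hS : Closed h S) : Frame S h h := ⟨hS, fun _ _ => rfl⟩

theorem Frame.trans {S : Set Loc} {h₁ h₂ h₃ : Heap C V} (h₁₂ : Frame S h₁ h₂)
    (h₂₃ : Frame S h₂ h₃) : Frame S h₁ h₃ :=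
  ⟨h₂₃.closed, fun u hu => (h₂₃.agree u hu).trans (h₁₂.agree u hu)⟩

theorem Closed.alloc {S : Set Loc} (hS : Closed h S) {c : Cell C V}
    (hc : ∀ v, c.Refers v → v ∈ S) : Frame S h (h ++ [c]) := by
  refine ⟨⟨fun u hu => hS.free u (le_trans (by simp) hu), ?_⟩, ?_⟩
  · rintro u v hu ⟨c', hc', hv⟩
    rw [List.getElem?_append] at hc'
    split_ifs at hc' with hlt
    · exact hS.edge u v hu ⟨c', hc', hv⟩
    · rw [List.getElem?_singleton] at hc'
      split_ifs at hc'
      cases hc'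
      exact hc v hv
  · intro u hu
    have : u < h.length := by
      by_contra hlt
      exact hu (hS.free u (not_lt.1 hlt))
    exact List.getElem?_append_left this

theorem Closed.set {S : Set Loc} (hS : Closed h S) {u : Loc} (hu : u ∈ S) {c : Cell C V}
    (hc : ∀ v, c.Refers v → v ∈ S) : Frame S h (h.set u c) := by
  refine ⟨⟨fun v hv => hS.free v (by simpa using hv), ?_⟩, ?_⟩
  · rintro x v hx ⟨c', hc', hv⟩
    rw [List.getElem?_set] at hc'
    split_ifs at hc'
    · cases hc'
      exact hc v hv
    · exact hS.edge x v hx ⟨c', hc', hv⟩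
  · intro x hx
    exact List.getElem?_set_ne (fun hux : u = x => hx (hux ▸ hu))

theorem Closed.refers {S : Set Loc} (hS : Closed h S) {u v : Loc} {c : Cell C V} (hu : u ∈ S)
    (hc : h[u]? = some c) (hv : c.Refers v) : v ∈ S :=
  hS.edge u v hu ⟨c, hc, hv⟩

/-- The references from which `x` cannot be reached. -/
def avoid (h : Heap C V) (x : Loc) : Set Loc := {u | ¬ Relation.ReflTransGen (Edge h) u x}

theorem closed_avoid {x : Loc} (hx : x < h.length) : Closed h (avoid h x) := by
  refine ⟨fun u hu hr => ?_, fun u v hu huv hr => hu (.head huv hr)⟩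
  rcases Relation.ReflTransGen.cases_head hr with rfl | ⟨v, ⟨c, hc, -⟩, -⟩
  · exact absurd hx (not_lt.2 hu)
  · rw [List.getElem?_eq_none hu] at hc
    cases hc

theorem notMem_avoid (h : Heap C V) (x : Loc) : x ∉ avoid h x := fun hx => hx .refl

theorem Represents.mem_avoid {x v : Loc} {s : STerm C V} {c : Cell C V} (hx : Represents h x s)
    (hc : h[x]? = some c) (hv : c.Refers v) : v ∈ avoid h x := fun hr =>
  hx.not_transGen (Relation.TransGen.head' ⟨c, hc, hv⟩ hr)

/-- A represented term depends only on the part of the heap that its reference reaches. -/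
theorem Represents.of_agree {S : Set Loc} (hS : Closed h S) (ha : ∀ u ∈ S, ∀ c, h[u]? = some c → h'[u]? = some c)
    {t : Loc} {s : STerm C V} (hs : Represents h t s) (ht : t ∈ S) : Represents h' t s := by
  refine Represents.induct (motive := fun t s => t ∈ S → Represents h' t s)
    ?_ ?_ ?_ ?_ ?_ ?_ ?_ hs ht
  · intro t c h₁ ht
    exact .const (ha t ht _ h₁)
  · intro t c h₁ ht
    exact .fv (ha t ht _ h₁)
  · intro t c h₁ ht
    exact .bv (ha t ht _ h₁)
  · intro t t' s h₁ _ ih ht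
    exact .ptr (ha t ht _ h₁) (ih (hS.refers ht h₁ (.ptr _)))
  · intro t t' s h₁ _ ih ht
    exact .lam (ha t ht _ h₁) (ih (hS.refers ht h₁ (.lam _)))
  · intro t t₁ t₂ s₁ s₂ h₁ _ _ ih₁ ih₂ ht
    exact .app (ha t ht _ h₁) (ih₁ (hS.refers ht h₁ (.appL _ _)))
      (ih₂ (hS.refers ht h₁ (.appR _ _)))
  · intro t t' ol nl env s e h₁ _ ih he ht
    refine .susp (ha t ht _ h₁) (ih (hS.refers ht h₁ (.susp _ _ _ _))) (representsEnv_iff.2 ?_)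
    have hm : ∀ u l, EItem.bndg u l ∈ env → u ∈ S :=
      fun u l hu => hS.refers ht h₁ (.env _ _ _ _ _ _ hu)
    clear h₁
    induction he with
    | nil => exact .nil
    | cons hx _ ih' =>
      refine .cons ?_ (ih' fun u l hu => hm u l (List.mem_cons_of_mem _ hu))
      cases hx with
      | dum l => exact .dum l
      | bndg l hx => exact .bndg l (hx.2 (hm _ l List.mem_cons_self))

theorem Represents.alloc {t : Loc} {s : STerm C V} (hs : Represents h t s) (c : Cell C V) :
    Represents (h ++ [c]) t s := by
  refine hs.of_agree (S := Set.univ) ⟨fun _ _ => trivial, fun _ _ _ _ => trivial⟩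
    (fun u _ c' hc => ?_) trivial
  rwa [List.getElem?_append_left (List.getElem?_eq_some_iff.1 hc).1]

/-! ### Evolution of the represented terms -/

/-- On the passage from `h` to `h'`, the represented terms are rewritten, and every new location
represents a term. -/
structure Evolves (h h' : Heap C V) : Prop where
  represents : ∀ u s, Represents h u s → ∃ s', Represents h' u s' ∧ STerm.Steps s s'
  length_le : h.length ≤ h'.length
  new : ∀ u, h.length ≤ u → u < h'.length → ∃ s, Represents h' u s

theorem Evolves.refl (h : Heap C V) : Evolves h h :=
  ⟨fun _ s hs => ⟨s, hs, .refl⟩, le_rfl, fun _ _ _ => by omega⟩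

theorem Evolves.trans {h₁ h₂ h₃ : Heap C V} (h₁₂ : Evolves h₁ h₂) (h₂₃ : Evolves h₂ h₃) :
    Evolves h₁ h₃ := by
  refine ⟨fun u s hs => ?_, h₁₂.length_le.trans h₂₃.length_le, fun u hu hu' => ?_⟩
  · obtain ⟨s', hs', h⟩ := h₁₂.represents u s hs
    obtain ⟨s'', hs'', h'⟩ := h₂₃.represents u s' hs'
    exact ⟨s'', hs'', h.trans h'⟩
  · rcases lt_or_ge u h₂.length with hlt | hge
    · obtain ⟨s, hs⟩ := h₁₂.new u hu hlt
      obtain ⟨s', hs', -⟩ := h₂₃.represents u s hs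
      exact ⟨s', hs'⟩
    · exact h₂₃.new u hge hu'

theorem Evolves.env (hh : Evolves h h') {env : List (EItem Loc)} {e : List (EItem (STerm C V))}
    (he : RepresentsEnv h env e) :
    ∃ e', RepresentsEnv h' env e' ∧ List.Forall₂ (ItemRel STerm.Steps) e e' := by
  simp only [representsEnv_iff] at he ⊢
  exact exists_forall₂_itemRel (he.imp fun _ _ => ItemRel.imp hh.represents)

theorem RepresentsEnv.alloc {env : List (EItem Loc)} {e : List (EItem (STerm C V))}
    (he : RepresentsEnv h env e) (c : Cell C V) : RepresentsEnv (h ++ [c]) env e := by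
  rw [representsEnv_iff] at he ⊢
  exact he.imp fun _ _ => ItemRel.imp fun _ _ hs => hs.alloc c

theorem RepresentsEnv.of_agree {S : Set Loc} (hS : Closed h S) (ha : ∀ u ∈ S, ∀ c, h[u]? = some c → h'[u]? = some c)
    {env : List (EItem Loc)} {e : List (EItem (STerm C V))} (he : RepresentsEnv h env e)
    (ht : EnvIn S env) : RepresentsEnv h' env e := by
  rw [representsEnv_iff] at he ⊢
  induction he with
  | nil => exact .nil
  | cons hx _ ih =>
    refine .cons ?_ (ih fun v l hv => ht v l (List.mem_cons_of_mem _ hv))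
    cases hx with
    | dum l => exact .dum l
    | bndg l hx => exact .bndg l (hx.of_agree hS ha (ht _ l List.mem_cons_self))

theorem Evolves.alloc {c : Cell C V} {s : STerm C V} (hs : Represents (h ++ [c]) h.length s) :
    Evolves h (h ++ [c]) := by
  refine ⟨fun u s hs => ⟨s, hs.alloc c, .refl⟩, by simp, fun u hu hu' => ?_⟩
  obtain rfl : u = h.length := by simp at hu'; omega
  exact ⟨s, hs⟩

/-- The effect of an assignment that replaces `x` by the result of its evaluation.  The heap `h₁`
is the one before the assignment, but the rewriting is followed from the heap `h` before the
evaluation: the evaluation may have updated parts of `x` to terms from which the result is not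
obtained by rewriting. -/
theorem Evolves.assign {h₁ : Heap C V} {S : Set Loc} (hS : Frame S h h₁) (hh : Evolves h h₁)
    {x f : Loc} {s F : STerm C V} (hx : x ∉ S) (hs : Represents h x s) (hf : f ∈ S)
    (hF : Represents h₁ f F) (hsF : STerm.Steps s F) :
    Evolves h (h₁.set x (.ptr f)) ∧ Represents (h₁.set x (.ptr f)) x F ∧
      ∀ u r, u ∈ S → Represents h₁ u r → Represents (h₁.set x (.ptr f)) u r := by
  have hx₁ : x < h₁.length := hs.lt_length.trans_le hh.length_le
  have hagree : ∀ u r, u ∈ S → Represents h₁ u r → Represents (h₁.set x (.ptr f)) u r := by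
    intro u r hu hr
    refine hr.of_agree hS.closed (fun v hv c hc => ?_) hu
    rwa [List.getElem?_set_ne (fun hxv : x = v => hx (hxv ▸ hv))]
  have hxF : Represents (h₁.set x (.ptr f)) x F :=
    .ptr (by rw [List.getElem?_set_self hx₁]) (hagree f F hf hF)
  have hsame : ∀ u, u ∉ S → u ≠ x → (h₁.set x (.ptr f))[u]? = h[u]? := by
    intro u hu hux
    rw [List.getElem?_set_ne (Ne.symm hux), hS.agree u hu]
  refine ⟨⟨?_, by simpa using hh.length_le, ?_⟩, hxF, hagree⟩
  · have key : ∀ u r, Represents h u r → (u ∉ S → u ≠ x → ∃ r',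
        Represents (h₁.set x (.ptr f)) u r' ∧ STerm.Steps r r') →
        ∃ r', Represents (h₁.set x (.ptr f)) u r' ∧ STerm.Steps r r' := by
      intro u r hr hu
      by_cases huS : u ∈ S
      · obtain ⟨r', hr', hst⟩ := hh.represents u r hr
        exact ⟨r', hagree u r' huS hr', hst⟩
      · rcases eq_or_ne u x with rfl | hux
        · rw [hs.unique hr]
          exact ⟨F, hxF, hsF⟩
        · exact hu huS hux
    intro u r hr
    refine Represents.induct (motive := fun u r => ∃ r',
        Represents (h₁.set x (.ptr f)) u r' ∧ STerm.Steps r r') ?_ ?_ ?_ ?_ ?_ ?_ ?_ hr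
    · intro t c ht
      exact key _ _ (.const ht) fun h₁ h₂ => ⟨_, .const (hsame t h₁ h₂ ▸ ht), .refl⟩
    · intro t c ht
      exact key _ _ (.fv ht) fun h₁ h₂ => ⟨_, .fv (hsame t h₁ h₂ ▸ ht), .refl⟩
    · intro t c ht
      exact key _ _ (.bv ht) fun h₁ h₂ => ⟨_, .bv (hsame t h₁ h₂ ▸ ht), .refl⟩
    · rintro t t' s ht hs ⟨s', hs', hst⟩
      exact key _ _ (.ptr ht hs) fun h₁ h₂ => ⟨_, .ptr (hsame t h₁ h₂ ▸ ht) hs', hst⟩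
    · rintro t t' s ht hs ⟨s', hs', hst⟩
      exact key _ _ (.lam ht hs) fun h₁ h₂ => ⟨_, .lam (hsame t h₁ h₂ ▸ ht) hs', hst.lam⟩
    · rintro t t₁ t₂ s₁ s₂ ht hs₁ hs₂ ⟨s₁', hs₁', hst₁⟩ ⟨s₂', hs₂', hst₂⟩
      exact key _ _ (.app ht hs₁ hs₂) fun h₁ h₂ =>
        ⟨_, .app (hsame t h₁ h₂ ▸ ht) hs₁' hs₂', hst₁.app hst₂⟩
    · rintro t t' ol nl env s e ht hs ⟨s', hs', hst⟩ he
      have he₁ : RepresentsEnv h env e :=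
        representsEnv_iff.2 (he.imp fun _ _ => ItemRel.imp fun _ _ h => h.1)
      obtain ⟨e', he', hste⟩ := exists_forall₂_itemRel
        (he.imp fun _ _ => ItemRel.imp fun _ _ h => h.2)
      exact key _ _ (.susp ht hs he₁) fun h₁ h₂ =>
        ⟨_, .susp (hsame t h₁ h₂ ▸ ht) hs' (representsEnv_iff.2 he'), hst.susp ol nl hste⟩
  · intro u hu hu'
    obtain ⟨r, hr⟩ := hh.new u hu (by simpa using hu')
    by_cases huS : u ∈ S
    · exact ⟨r, hagree u r huS hr⟩
    · have hnone := hS.agree u huS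
      rw [List.getElem?_eq_none hu, List.getElem?_eq_none_iff] at hnone
      exact absurd hr.lt_length (not_lt.2 hnone)

/-! ### Indirections -/

/-- The contents of `u` are not an indirection. -/
def Explicit (h : Heap C V) (u : Loc) : Prop := ∀ v, h[u]? ≠ some (.ptr v)

/-- Both `deref` and `assign` follow the indirections from a reference that represents a term to
the same location `v`. -/
theorem Represents.deref {u : Loc} {s : STerm C V} (hs : Represents h u s) :
    ∃ v n, (∀ fuel ≥ n, deref fuel h u = some v ∧
        ∀ x, assign fuel h x u = some (h.set x (.ptr v))) ∧
      Represents h v s ∧ Explicit h v ∧ (Explicit h u → v = u) := by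
  have base : ∀ {t : Loc} {s : STerm C V} {c : Cell C V}, h[t]? = some c → (∀ v, c ≠ .ptr v) →
      Represents h t s → ∃ v n, (∀ fuel ≥ n, Suspension.deref fuel h t = some v ∧
        ∀ x, Suspension.assign fuel h x t = some (h.set x (.ptr v))) ∧
      Represents h v s ∧ Explicit h v ∧ (Explicit h t → v = t) := by
    intro t s c ht hc hs
    refine ⟨t, 1, fun fuel hf => ?_, hs, fun v hv => ?_, fun _ => rfl⟩
    · obtain ⟨fuel, rfl⟩ : ∃ k, fuel = k + 1 := ⟨fuel - 1, by omega⟩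
      cases c with
      | ptr v => exact absurd rfl (hc v)
      | _ => simp [Suspension.deref, Suspension.assign, ht]
    · rw [ht] at hv
      cases hv
      exact hc v rfl
  refine Represents.induct (motive := fun u s => ∃ v n, (∀ fuel ≥ n,
        Suspension.deref fuel h u = some v ∧
        ∀ x, Suspension.assign fuel h x u = some (h.set x (.ptr v))) ∧
      Represents h v s ∧ Explicit h v ∧ (Explicit h u → v = u)) ?_ ?_ ?_ ?_ ?_ ?_ ?_ hs
  · exact fun ht => base ht (by simp) (.const ht)
  · exact fun ht => base ht (by simp) (.fv ht)
  · exact fun ht => base ht (by simp) (.bv ht)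
  · rintro t t' s ht - ⟨v, n, h₁, h₂, h₃, -⟩
    refine ⟨v, n + 1, fun fuel hf => ?_, h₂, h₃, fun h => absurd ht (h t')⟩
    obtain ⟨fuel, rfl⟩ : ∃ k, fuel = k + 1 := ⟨fuel - 1, by omega⟩
    simpa [Suspension.deref, Suspension.assign, ht] using h₁ fuel (by omega)
  · exact fun ht hs _ => base ht (by simp) (.lam ht hs)
  · exact fun ht h₁ h₂ _ _ => base ht (by simp) (.app ht h₁ h₂)
  · exact fun ht hs _ he => base ht (by simp) (.susp ht hs
      (representsEnv_iff.2 (he.imp fun _ _ => ItemRel.imp fun _ _ h => h.1)))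

theorem Closed.deref_mem {S : Set Loc} (hS : Closed h S) {fuel : ℕ} {u v : Loc} (hu : u ∈ S)
    (hd : deref fuel h u = some v) : v ∈ S := by
  induction fuel generalizing u with
  | zero => simp [deref] at hd
  | succ fuel ih =>
    rw [deref] at hd
    split at hd
    · cases hd
    · rename_i t ht
      exact ih (hS.refers hu ht (.ptr t)) hd
    · cases hd
      exact hu

theorem Represents.cases_susp {u : Loc} {s : STerm C V} (hs : Represents h u s)
    (hu : Explicit h u) :
    (∃ t ol nl env r e, h[u]? = some (.susp t ol nl env) ∧ s = .susp r ol nl e ∧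
      Represents h t r ∧ RepresentsEnv h env e) ∨
    ¬ s.IsSusp ∧ ∃ c, h[u]? = some c ∧ ∀ t ol nl env, c ≠ .susp t ol nl env := by
  cases hs with
  | const ht => exact .inr ⟨id, _, ht, by simp⟩
  | fv ht => exact .inr ⟨id, _, ht, by simp⟩
  | bv ht => exact .inr ⟨id, _, ht, by simp⟩
  | ptr ht => exact absurd ht (hu _)
  | lam ht => exact .inr ⟨id, _, ht, by simp⟩
  | app ht => exact .inr ⟨id, _, ht, by simp⟩
  | susp ht hs he => exact .inl ⟨_, _, _, _, _, _, ht, rfl, hs, he⟩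

end HeapLemmas

open STerm

/-! ### Specification of the evaluator -/

section Evaluator

variable {C V : Type*}

/-- The shape of a result that carries no environment: a weak head normal form if the flag is
set, and a generalized head normal form otherwise. -/
def IsResult : Bool → STerm C V → Prop
  | true, t => t.IsHeadApp ∨ ∃ b, t = .lam b
  | false, t => t.IsGenHNF

theorem IsResult.not_isSusp {w : Bool} {t : STerm C V} (ht : IsResult w t) : ¬ t.IsSusp := by
  cases w with
  | true =>
    rcases ht with ht | ⟨b, rfl⟩
    · cases ht <;> exact id
    · exact id
  | false =>
    cases ht with
    | body ht => cases ht <;> exact id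
    | lam _ => exact id

theorem STerm.IsHeadApp.isResult {t : STerm C V} (ht : t.IsHeadApp) (w : Bool) :
    IsResult w t := by
  cases w with
  | true => exact .inl ht
  | false => exact .body ht

/-- What is guaranteed when the evaluation of `⟦s, ol, nl, e⟧`, represented by `term` and `env` in
the heap `h`, yields the heap `h'` and `⟦F, fo, fl, fe⟧`, represented by `f` and `fenv`. -/
structure Outcome (h : Heap C V) (term : Loc) (ol nl : ℕ) (env : List (EItem Loc)) (w : Bool)
    (s : STerm C V) (e : List (EItem (STerm C V))) (h' : Heap C V) (f : Loc) (fo fl : ℕ)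
    (fenv : List (EItem Loc)) (F : STerm C V) (fe : List (EItem (STerm C V))) : Prop where
  rep : Represents h' f F
  repEnv : RepresentsEnv h' fenv fe
  length : fe.length = fo
  steps : Steps (wrap s ol nl e) (wrap F fo fl fe)
  /-- A result that carries an environment is an abstraction, stored at `f` itself. -/
  shape : (fo = 0 ∧ fl = 0 ∧ IsResult w F) ∨
    (w = true ∧ ¬ (fo = 0 ∧ fl = 0) ∧ ∃ b, h'[f]? = some (.lam b))
  /-- If neither the input nor the result carries an environment, then `term` is updated. -/
  update : ol = 0 → nl = 0 → fo = 0 → fl = 0 → Represents h' term F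
  evolves : Evolves h h'
  /-- Any set that is closed under references and contains the input also contains the result, and
  everything outside it is left alone. -/
  frame : ∀ S, Closed h S → term ∈ S → EnvIn S env → Frame S h h' ∧ f ∈ S ∧ EnvIn S fenv

/-- The evaluation of `term` in the environment `env` terminates, with a result as specified. -/
def Good (h : Heap C V) (term : Loc) (ol nl : ℕ) (env : List (EItem Loc)) (w : Bool)
    (s : STerm C V) (e : List (EItem (STerm C V))) : Prop :=
  ∃ h' f fo fl fenv F fe,
    (∃ n, ∀ fuel ≥ n, hnCo fuel h term ol nl env w = some (h', f, fo, fl, fenv)) ∧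
      Outcome h term ol nl env w s e h' f fo fl fenv F fe

/-- The induction hypothesis of the termination proof: evaluations terminate as specified if their
input is nearer to a head normal form than `N` contractions on the head path, or if it is at most
as far and the weight of its head path is less than `c`. -/
def GoodBelow (C V : Type*) (N c : ℕ) : Prop :=
  ∀ (h : Heap C V) (term : Loc) (ol nl : ℕ) (env : List (EItem Loc)) (w : Bool) (s : STerm C V)
    (e : List (EItem (STerm C V))), Represents h term s → RepresentsEnv h env e →
    (susp s ol nl e).WellFormed →
    ((∃ m < N, (susp s ol nl e).den.HeadNormalizes m) ∨
      (susp s ol nl e).den.HeadNormalizes N ∧ (susp s ol nl e).cost < c) →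
    Good h term ol nl env w s e

theorem STerm.Descends.below {t t' : STerm C V} (h : Descends 1 t t') {N : ℕ}
    (hN : t.den.HeadNormalizes N) :
    (∃ m < N, t'.den.HeadNormalizes m) ∨ t'.den.HeadNormalizes N ∧ t'.cost < t.cost := by
  rcases h with h | h
  · obtain ⟨m, rfl, hm⟩ := hN.betaHead h
    exact .inl ⟨m, Nat.lt_succ_self m, hm⟩
  · exact .inr ⟨hN.betaStar h.1, h.2.2⟩

theorem RepresentsEnv.length_eq {h : Heap C V} {env : List (EItem Loc)}
    {e : List (EItem (STerm C V))} (he : RepresentsEnv h env e) : env.length = e.length :=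
  (representsEnv_iff.1 he).length_eq

theorem RepresentsEnv.eq_nil {h : Heap C V} {env : List (EItem Loc)}
    {e : List (EItem (STerm C V))} (he : RepresentsEnv h env e) (hl : e.length = 0) :
    env = [] ∧ e = [] := by
  have := he.length_eq
  exact ⟨List.length_eq_zero_iff.1 (this.trans hl), List.length_eq_zero_iff.1 hl⟩

theorem STerm.Steps.wrap_of_read {t t' : STerm C V} {ol nl : ℕ} {e : List (EItem (STerm C V))}
    (h0 : ¬ (ol = 0 ∧ nl = 0)) (h : ReadRule (susp t ol nl e) t') :
    Steps (STerm.wrap t ol nl e) t' := by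
  rw [wrap_of_ne t h0]
  exact .single (.root (.read h))

/-! ### Constants, variables and indirections -/

/-- The evaluation ends at once, and does not change the heap. -/
theorem Outcome.of_result {h : Heap C V} {term : Loc} {ol nl : ℕ} {env : List (EItem Loc)}
    {w : Bool} {s : STerm C V} {e : List (EItem (STerm C V))} (hs : Represents h term s)
    (hst : Steps (wrap s ol nl e) s) (hr : IsResult w s) :
    Outcome h term ol nl env w s e h term 0 0 [] s [] where
  rep := hs
  repEnv := .nil
  length := rfl
  steps := by rwa [wrap_zero s []]
  shape := .inl ⟨rfl, rfl, hr⟩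
  update _ _ _ _ := hs
  evolves := .refl h
  frame S hS ht _ := ⟨.refl hS, ht, envIn_nil S⟩

/-- The evaluation allocates its result. -/
theorem Outcome.of_alloc {h : Heap C V} {term : Loc} {ol nl : ℕ} {env : List (EItem Loc)}
    {w : Bool} {s F : STerm C V} {e : List (EItem (STerm C V))} {c : Cell C V}
    (h0 : ¬ (ol = 0 ∧ nl = 0)) (hF : Represents (h ++ [c]) h.length F)
    (hst : Steps (wrap s ol nl e) F) (hr : IsResult w F) (hc : ∀ v, ¬ c.Refers v) :
    Outcome h term ol nl env w s e (h ++ [c]) h.length 0 0 [] F [] where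
  rep := hF
  repEnv := .nil
  length := rfl
  steps := by rwa [wrap_zero F []]
  shape := .inl ⟨rfl, rfl, hr⟩
  update h₁ h₂ _ _ := absurd ⟨h₁, h₂⟩ h0
  evolves := .alloc hF
  frame S hS _ _ := ⟨hS.alloc fun v hv => absurd hv (hc v), hS.free _ le_rfl, envIn_nil S⟩

/-- The evaluation continues with another term in another environment. -/
theorem Outcome.of_steps {h h' : Heap C V} {term t : Loc} {ol nl o n fo fl : ℕ}
    {env env₁ fenv : List (EItem Loc)} {w : Bool} {s s₁ F : STerm C V}
    {e e₁ fe : List (EItem (STerm C V))} {f : Loc}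
    (ho : Outcome h t o n env₁ w s₁ e₁ h' f fo fl fenv F fe) (h0 : ¬ (ol = 0 ∧ nl = 0))
    (hst : Steps (wrap s ol nl e) (wrap s₁ o n e₁))
    (hS : ∀ S, Closed h S → term ∈ S → EnvIn S env → t ∈ S ∧ EnvIn S env₁) :
    Outcome h term ol nl env w s e h' f fo fl fenv F fe where
  rep := ho.rep
  repEnv := ho.repEnv
  length := ho.length
  steps := hst.trans ho.steps
  shape := ho.shape
  update h₁ h₂ _ _ := absurd ⟨h₁, h₂⟩ h0
  evolves := ho.evolves
  frame S hc ht he := ho.frame S hc (hS S hc ht he).1 (hS S hc ht he).2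

theorem good_const {h : Heap C V} {term : Loc} {c : C} (hc : h[term]? = some (.const c))
    (ol nl : ℕ) (env : List (EItem Loc)) (w : Bool) (e : List (EItem (STerm C V))) :
    Good h term ol nl env w (.const c) e := by
  refine ⟨h, term, 0, 0, [], .const c, [], ⟨1, fun fuel hf => ?_⟩,
    .of_result (.const hc) ?_ ((STerm.IsHeadApp.const c).isResult w)⟩
  · obtain ⟨fuel, rfl⟩ : ∃ k, fuel = k + 1 := ⟨fuel - 1, by omega⟩
    simp [hnCo, hc]
  · by_cases h0 : ol = 0 ∧ nl = 0
    · simp only [wrap, if_pos h0]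
      exact .refl
    · exact .wrap_of_read h0 (.r1 _ _ _ _)

theorem good_fv {h : Heap C V} {term : Loc} {x : V} (hc : h[term]? = some (.fv x))
    (ol nl : ℕ) (env : List (EItem Loc)) (w : Bool) (e : List (EItem (STerm C V))) :
    Good h term ol nl env w (.ivar x) e := by
  refine ⟨h, term, 0, 0, [], .ivar x, [], ⟨1, fun fuel hf => ?_⟩,
    .of_result (.fv hc) ?_ ((STerm.IsHeadApp.ivar x).isResult w)⟩
  · obtain ⟨fuel, rfl⟩ : ∃ k, fuel = k + 1 := ⟨fuel - 1, by omega⟩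
    simp [hnCo, hc]
  · by_cases h0 : ol = 0 ∧ nl = 0
    · simp only [wrap, if_pos h0]
      exact .refl
    · exact .wrap_of_read h0 (.r2 _ _ _ _)

theorem nth_succ {α : Type*} (l : List α) (k : ℕ) : nth l (k + 1) = l[k]? := by
  induction l generalizing k with
  | nil => rfl
  | cons x l ih =>
    cases k with
    | zero => rfl
    | succ k => simpa [nth] using ih k

/-- The indirections between `u` and `v` survive an evaluation that starts from `v`. -/
theorem Outcome.represents_of_deref {h h' : Heap C V} {v f : Loc} {w : Bool} {s s' F : STerm C V}
    {ol nl fo fl : ℕ} {e fe : List (EItem (STerm C V))} {fenv : List (EItem Loc)}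
    (ho : Outcome h v ol nl [] w s e h' f fo fl fenv F fe) (hF : Represents h' v F) {fuel : ℕ}
    {u : Loc} (hu : Represents h u s') (hd : deref fuel h u = some v) : Represents h' u F := by
  induction fuel generalizing u s' with
  | zero => simp [deref] at hd
  | succ fuel ih =>
    rw [deref] at hd
    split at hd
    · cases hd
    · rename_i t ht
      obtain ⟨r, hr⟩ := hu.edge ⟨_, ht, .ptr t⟩
      have htF := ih hr hd
      have hv : v ∈ avoid h u :=
        (closed_avoid hu.lt_length).deref_mem (hu.mem_avoid ht (.ptr t)) hd
      have := ((ho.frame _ (closed_avoid hu.lt_length) hv (envIn_nil _)).1.agree u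
        (notMem_avoid h u)).trans ht
      exact .ptr this htF
    · cases hd
      exact hF

theorem hnCo_bv {h : Heap C V} {term : Loc} {k ol nl : ℕ} {env : List (EItem Loc)}
    (hc : h[term]? = some (.bv (k + 1))) (h0 : ¬ (ol = 0 ∧ nl = 0)) (fuel : ℕ) (w : Bool) :
    hnCo (fuel + 1) h term ol nl env w =
      if k + 1 > ol then some (h ++ [.bv (k + 1 - ol + nl)], h.length, 0, 0, [])
      else
        match env[k]? with
        | none => none
        | some (.dum l) =>
          (sub nl l).bind fun j => some (h ++ [.bv j], h.length, 0, 0, [])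
        | some (.bndg t l) =>
          if nl = l then hnCo fuel h t 0 0 [] w
          else
            (sub nl l).bind fun j =>
            (deref fuel h t).bind fun t =>
            match h[t]? with
            | none => none
            | some (.susp t₂ o n e) => hnCo fuel h t₂ o (n + j) e w
            | some _ => hnCo fuel h t 0 j [] w := by
  rw [hnCo, hc]
  dsimp only
  split
  · simp at h0
  · rw [nth_succ]
    rfl

theorem good_bv {N : ℕ} {h : Heap C V} {term : Loc} {k ol nl : ℕ} {env : List (EItem Loc)}
    {w : Bool} {e : List (EItem (STerm C V))} (hc : h[term]? = some (.bv (k + 1)))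
    (he : RepresentsEnv h env e) (hwf : (susp (idx k) ol nl e).WellFormed)
    (hN : (susp (idx k) ol nl e).den.HeadNormalizes N)
    (ih : GoodBelow C V N (susp (idx k) ol nl e).cost) : Good h term ol nl env w (.idx k) e := by
  have hlen : e.length = ol := (wellFormed_susp.1 hwf).2.1
  by_cases h0 : ol = 0 ∧ nl = 0
  · refine ⟨h, term, 0, 0, [], .idx k, [], ⟨1, fun fuel hf => ?_⟩,
      .of_result (.bv hc) ?_ ((STerm.IsHeadApp.idx k).isResult w)⟩
    · obtain ⟨fuel, rfl⟩ : ∃ k, fuel = k + 1 := ⟨fuel - 1, by omega⟩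
      obtain ⟨rfl, rfl⟩ := h0
      rw [(he.eq_nil hlen).1]
      simp [hnCo, hc]
    · simp only [wrap, if_pos h0]
      exact .refl
  rcases Nat.lt_or_ge k ol with hk | hk
  · obtain ⟨x, y, hx, hy, hxy⟩ :=
      forall₂_itemRel_getElem? (representsEnv_iff.1 he) (k := k) (by omega)
    cases hxy with
    | dum l =>
      have hl := (wellFormed_susp.1 hwf).2.2.1 l (List.mem_of_getElem? hy)
      refine ⟨h ++ [.bv (nl - l)], h.length, 0, 0, [], .idx (nl - l - 1), [],
        ⟨1, fun fuel hf => ?_⟩, .of_alloc h0 (.bv (by simp; omega))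
        (.wrap_of_read h0 (.r4 k ol nl e l _ hk hy (by omega)))
        ((STerm.IsHeadApp.idx _).isResult w) (by rintro v ⟨⟩)⟩
      obtain ⟨fuel, rfl⟩ : ∃ k, fuel = k + 1 := ⟨fuel - 1, by omega⟩
      rw [hnCo_bv hc h0, if_neg (by omega), hx]
      simp [sub, hl.le]
    | @bndg u r l hur =>
      have hl := (wellFormed_susp.1 hwf).2.2.2.1 r l (List.mem_of_getElem? hy)
      have hwr : r.WellFormed := hwf.of_getElem? hy
      have hu : ∀ S, Closed h S → term ∈ S → EnvIn S env → u ∈ S :=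
        fun S _ _ hS => hS u l (List.mem_of_getElem? hx)
      by_cases hnl : nl = l
      · subst hnl
        have hr : ReadRule (susp (idx k) ol nl e) (susp r 0 0 []) :=
          .r5 k ol nl e r nl 0 hk hy (by omega)
        obtain ⟨h', f, fo, fl, fenv, F, fe, ⟨n, hn⟩, ho⟩ := ih h u 0 0 [] w r [] hur .nil
          (wellFormed_susp_nil.2 hwr) ((hr.descends hwf).below hN)
        refine ⟨h', f, fo, fl, fenv, F, fe, ⟨n + 1, fun fuel hf => ?_⟩,
          ho.of_steps h0 ?_ fun S hS ht hE => ⟨hu S hS ht hE, envIn_nil S⟩⟩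
        · obtain ⟨fuel, rfl⟩ : ∃ k, fuel = k + 1 := ⟨fuel - 1, by omega⟩
          rw [hnCo_bv hc h0, if_neg (by omega), hx]
          simpa using hn fuel (by omega)
        · rw [wrap_zero]
          exact .wrap_of_read h0 (.r10 k ol nl e r hk hy)
      · obtain ⟨v, n₁, hd, hvr, hv, -⟩ := hur.deref
        have huv : ∀ S, Closed h S → term ∈ S → EnvIn S env → v ∈ S :=
          fun S hS ht hE => hS.deref_mem (hu S hS ht hE) (hd n₁ le_rfl).1
        rcases hvr.cases_susp hv with ⟨t₂, o, n, env₂, s₂, e₂, hcv, rfl, hs₂, he₂⟩ |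
          ⟨hns, c, hcv, hcs⟩
        · have hr : ReadRule (susp (idx k) ol nl e) (susp s₂ o (n + (nl - l)) e₂) :=
            .r11 k ol nl e s₂ o n e₂ l (nl - l) hk hy hnl (by omega)
          obtain ⟨h', f, fo, fl, fenv, F, fe, ⟨n₂, hn⟩, ho⟩ :=
            ih h t₂ o (n + (nl - l)) env₂ w s₂ e₂ hs₂ he₂ (hr.wellFormed hwf)
              ((hr.descends hwf).below hN)
          refine ⟨h', f, fo, fl, fenv, F, fe, ⟨max n₁ n₂ + 1, fun fuel hf => ?_⟩,
            ho.of_steps h0 ?_ fun S hS ht hE => ⟨hS.refers (huv S hS ht hE) hcv (.susp _ _ _ _),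
              fun x m hx => hS.refers (huv S hS ht hE) hcv (.env _ _ _ _ _ _ hx)⟩⟩
          · obtain ⟨fuel, rfl⟩ : ∃ k, fuel = k + 1 := ⟨fuel - 1, by omega⟩
            rw [hnCo_bv hc h0, if_neg (by omega), hx]
            simpa [hnl, sub, hl, (hd fuel (by omega)).1, hcv] using hn fuel (by omega)
          · rw [wrap_of_ne s₂ (by omega)]
            exact .wrap_of_read h0 hr
        · have hr : ReadRule (susp (idx k) ol nl e) (susp r 0 (nl - l) []) :=
            .r12 k ol nl e r l (nl - l) hk hy hns hnl (by omega)
          obtain ⟨h', f, fo, fl, fenv, F, fe, ⟨n₂, hn⟩, ho⟩ :=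
            ih h v 0 (nl - l) [] w r [] hvr .nil (hr.wellFormed hwf)
              ((hr.descends hwf).below hN)
          refine ⟨h', f, fo, fl, fenv, F, fe, ⟨max n₁ n₂ + 1, fun fuel hf => ?_⟩,
            ho.of_steps h0 ?_ fun S hS ht hE => ⟨huv S hS ht hE, envIn_nil S⟩⟩
          · obtain ⟨fuel, rfl⟩ : ∃ k, fuel = k + 1 := ⟨fuel - 1, by omega⟩
            rw [hnCo_bv hc h0, if_neg (by omega), hx]
            have := hn fuel (by omega)
            cases c with
            | susp t ol nl env => exact absurd rfl (hcs t ol nl env)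
            | _ => simpa [hnl, sub, hl, (hd fuel (by omega)).1, hcv] using this
          · rw [wrap_of_ne r (by omega)]
            exact .wrap_of_read h0 hr
  · refine ⟨h ++ [.bv (k + 1 - ol + nl)], h.length, 0, 0, [], .idx (k - ol + nl), [],
      ⟨1, fun fuel hf => ?_⟩, .of_alloc h0 (.bv (by simp; omega))
      (.wrap_of_read h0 (.r3 k ol nl e hk)) ((STerm.IsHeadApp.idx _).isResult w)
      (by rintro v ⟨⟩)⟩
    obtain ⟨fuel, rfl⟩ : ∃ k, fuel = k + 1 := ⟨fuel - 1, by omega⟩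
    rw [hnCo_bv hc h0, if_pos (by omega)]

theorem good_ptr {h : Heap C V} {term t v : Loc} {n₀ ol nl : ℕ} {env : List (EItem Loc)}
    {w : Bool} {s : STerm C V} {e : List (EItem (STerm C V))}
    (hc : h[term]? = some (.ptr t)) (hs : Represents h term s) (he : RepresentsEnv h env e)
    (hlen : e.length = ol) (hd : ∀ fuel ≥ n₀, deref fuel h term = some v)
    (hv : Good h v ol nl env w s e) : Good h term ol nl env w s e := by
  obtain ⟨h', f, fo, fl, fenv, F, fe, ⟨n, hn⟩, ho⟩ := hv
  refine ⟨h', f, fo, fl, fenv, F, fe, ⟨max n₀ n + 1, fun fuel hf => ?_⟩,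
    { ho with update := ?_, frame := ?_ }⟩
  · obtain ⟨fuel, rfl⟩ : ∃ k, fuel = k + 1 := ⟨fuel - 1, by omega⟩
    have h₁ := hd (fuel + 1) (by omega)
    simp only [deref, hc] at h₁
    simpa [hnCo, hc, h₁] using hn fuel (by omega)
  · rintro rfl h₂ h₃ h₄
    obtain ⟨rfl, rfl⟩ := he.eq_nil hlen
    exact ho.represents_of_deref (ho.update rfl h₂ h₃ h₄) hs (hd n₀ le_rfl)
  · exact fun S hS ht hE => ho.frame S hS (hS.deref_mem ht (hd n₀ le_rfl)) hE

/-! ### Abstractions -/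

theorem good_lam_whnf {h : Heap C V} {term t : Loc} {ol nl : ℕ} {env : List (EItem Loc)}
    {s : STerm C V} {e : List (EItem (STerm C V))} (hc : h[term]? = some (.lam t))
    (hs : Represents h t s) (he : RepresentsEnv h env e)
    (hwf : (susp (lam s) ol nl e).WellFormed) : Good h term ol nl env true (.lam s) e := by
  refine ⟨h, term, ol, nl, env, .lam s, e, ⟨1, fun fuel hf => ?_⟩, ?_⟩
  · obtain ⟨fuel, rfl⟩ : ∃ k, fuel = k + 1 := ⟨fuel - 1, by omega⟩
    simp [hnCo, hc]
  · refine ⟨.lam hc hs, he, (wellFormed_susp.1 hwf).2.1, .refl, ?_, fun _ _ _ _ => .lam hc hs,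
      .refl h, fun S hS ht hE => ⟨.refl hS, ht, hE⟩⟩
    by_cases h0 : ol = 0 ∧ nl = 0
    · exact .inl ⟨h0.1, h0.2, .inr ⟨s, rfl⟩⟩
    · exact .inr ⟨rfl, h0, t, hc⟩

theorem good_lam {N : ℕ} {h : Heap C V} {term t : Loc} {ol nl : ℕ} {env : List (EItem Loc)}
    {s : STerm C V} {e : List (EItem (STerm C V))} (hc : h[term]? = some (.lam t))
    (hs : Represents h t s) (he : RepresentsEnv h env e)
    (hwf : (susp (lam s) ol nl e).WellFormed)
    (hN : (susp (lam s) ol nl e).den.HeadNormalizes N)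
    (ih : GoodBelow C V N (susp (lam s) ol nl e).cost) :
    Good h term ol nl env false (.lam s) e := by
  have hrep : Represents h term (.lam s) := .lam hc hs
  have hlen : e.length = ol := (wellFormed_susp.1 hwf).2.1
  by_cases h0 : ol = 0 ∧ nl = 0
  · obtain ⟨rfl, rfl⟩ := h0
    obtain ⟨rfl, rfl⟩ := he.eq_nil hlen
    have hN' : (susp s 0 0 []).den.HeadNormalizes N := by
      rw [den_susp_zero] at hN ⊢
      exact hN.of_map (f := DTerm.lam) fun _ _ h => h.lam
    obtain ⟨h', f, fo, fl, fenv, F, fe, ⟨n, hn⟩, ho⟩ := ih h t 0 0 [] false s [] hs .nil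
      (wellFormed_susp_nil.2 (wellFormed_lam.1 (wellFormed_susp_nil.1 hwf)))
      (.inr ⟨hN', by rw [cost_susp_nil, cost_susp_nil, cost]; omega⟩)
    obtain ⟨rfl, rfl, hF⟩ : fo = 0 ∧ fl = 0 ∧ IsResult false F := by simpa using ho.shape
    obtain ⟨rfl, rfl⟩ := ho.repEnv.eq_nil ho.length
    -- The cell `term` cannot be reached from its subterm, so it is unchanged and refers to the
    -- updated body.
    have hc' : h'[term]? = some (.lam t) :=
      ((ho.frame _ (closed_avoid hrep.lt_length) (hrep.mem_avoid hc (.lam t))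
        (envIn_nil _)).1.agree term (notMem_avoid h term)).trans hc
    have hrep' : Represents h' term (.lam F) := .lam hc' (ho.update rfl rfl rfl rfl)
    have hst := ho.steps
    rw [wrap_zero, wrap_zero] at hst
    refine ⟨h', term, 0, 0, [], .lam F, [], ⟨n + 1, fun fuel hf => ?_⟩, hrep', .nil, rfl,
      ?_, .inl ⟨rfl, rfl, .lam hF⟩, fun _ _ _ _ => hrep', ho.evolves, fun S hS ht _ =>
        ⟨(ho.frame S hS (hS.refers ht hc (.lam t)) (envIn_nil S)).1, ht, envIn_nil S⟩⟩
    · obtain ⟨fuel, rfl⟩ : ∃ k, fuel = k + 1 := ⟨fuel - 1, by omega⟩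
      simp [hnCo, hc, hn fuel (by omega), buildLam]
    · rw [wrap_zero, wrap_zero]
      exact hst.lam
  · have hN' : (susp s (ol + 1) (nl + 1) (.dum nl :: e)).den.HeadNormalizes N := by
      rw [den_susp_lam hwf] at hN
      exact hN.of_map (f := DTerm.lam) fun _ _ h => h.lam
    obtain ⟨h', f, fo, fl, fenv, F, fe, ⟨n, hn⟩, ho⟩ :=
      ih h t (ol + 1) (nl + 1) (.dum nl :: env) false s (.dum nl :: e) hs (.dum he) hwf.susp_lam
        (.inr ⟨hN', by rw [cost_susp_lam s ol nl (ol + 1) (nl + 1) e]; omega⟩)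
    obtain ⟨rfl, rfl, hF⟩ : fo = 0 ∧ fl = 0 ∧ IsResult false F := by simpa using ho.shape
    obtain ⟨rfl, rfl⟩ := ho.repEnv.eq_nil ho.length
    have hrep' : Represents (h' ++ [.lam f]) h'.length (.lam F) :=
      .lam (by simp) (ho.rep.alloc _)
    have hst := ho.steps
    rw [wrap_zero, wrap_of_ne s (by omega)] at hst
    refine ⟨h' ++ [.lam f], h'.length, 0, 0, [], .lam F, [], ⟨n + 1, fun fuel hf => ?_⟩, hrep',
      .nil, rfl, ?_, .inl ⟨rfl, rfl, .lam hF⟩, fun h₁ h₂ => absurd ⟨h₁, h₂⟩ h0,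
      ho.evolves.trans (.alloc hrep'), fun S hS ht hE => ?_⟩
    · obtain ⟨fuel, rfl⟩ : ∃ k, fuel = k + 1 := ⟨fuel - 1, by omega⟩
      have hb : buildLam h' term f ol nl = (h' ++ [.lam f], h'.length, 0, 0, []) := by
        unfold buildLam
        split
        · simp at h0
        · rfl
      simp [hnCo, hc, h0, hn fuel (by omega), hb]
    · rw [wrap_zero]
      exact (Steps.wrap_of_read h0 (.r7 s ol nl e)).trans hst.lam
    · obtain ⟨h₁, h₂, h₃⟩ := ho.frame S hS (hS.refers ht hc (.lam t)) (hE.dum nl)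
      refine ⟨h₁.trans (h₁.closed.alloc ?_), h₁.closed.free _ le_rfl, envIn_nil S⟩
      rintro v ⟨⟩
      exact h₂

/-! ### Applications -/

theorem arg_spec {h : Heap C V} {t : Loc} {ol nl : ℕ} {env : List (EItem Loc)} {s : STerm C V}
    {e : List (EItem (STerm C V))} (hs : Represents h t s) (he : RepresentsEnv h env e)
    (hlen : e.length = ol) :
    ∃ (h' : Heap C V) (a : Loc), arg h t ol nl env = (h', a) ∧ Represents h' a (wrap s ol nl e) ∧ Evolves h h' ∧
      (∀ u r, Represents h u r → Represents h' u r) ∧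
      (∀ env' e', RepresentsEnv h env' e' → RepresentsEnv h' env' e') ∧
      ∀ S, Closed h S → t ∈ S → EnvIn S env → Frame S h h' ∧ a ∈ S := by
  by_cases h0 : ol = 0 ∧ nl = 0
  · obtain ⟨rfl, rfl⟩ := h0
    obtain ⟨rfl, rfl⟩ := he.eq_nil hlen
    exact ⟨h, t, rfl, by rwa [wrap_zero], .refl h, fun _ _ h => h, fun _ _ h => h,
      fun S hS ht _ => ⟨.refl hS, ht⟩⟩
  · have hrep : Represents (h ++ [.susp t ol nl env]) h.length (susp s ol nl e) :=
      .susp (by simp) (hs.alloc _) (he.alloc _)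
    refine ⟨h ++ [.susp t ol nl env], h.length, ?_, by rwa [wrap_of_ne s h0], .alloc hrep,
      fun _ _ h => h.alloc _, fun _ _ h => h.alloc _, fun S hS ht hE => ?_⟩
    · unfold arg
      split
      · simp at h0
      · rfl
    · refine ⟨hS.alloc ?_, hS.free _ le_rfl⟩
      intro v hv
      cases hv with
      | susp => exact ht
      | env _ _ _ _ _ l hm => exact hE v l hm

/-- The evaluation of an application whose operator has been evaluated to an abstraction. -/
theorem good_app_lam {N : ℕ} {h h₁ : Heap C V} {term t₁ t₂ f v : Loc} {ol nl fo fl : ℕ}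
    {env fenv : List (EItem Loc)} {w : Bool} {s₁ s₂ F b : STerm C V}
    {e fe : List (EItem (STerm C V))} {n₁ n₂ : ℕ} (hc : h[term]? = some (.app t₁ t₂))
    (hs₁ : Represents h t₁ s₁) (hs₂ : Represents h t₂ s₂) (he : RepresentsEnv h env e)
    (hwf : (susp (app s₁ s₂) ol nl e).WellFormed)
    (hN : (susp (app s₁ s₂) ol nl e).den.HeadNormalizes N)
    (ih : GoodBelow C V N (susp (app s₁ s₂) ol nl e).cost)
    (hn₁ : ∀ fuel ≥ n₁, hnCo fuel h t₁ ol nl env true = some (h₁, f, fo, fl, fenv))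
    (ho₁ : Outcome h t₁ ol nl env true s₁ e h₁ f fo fl fenv F fe)
    (hd : ∀ fuel ≥ n₂, deref fuel h₁ f = some v) (hv : Represents h₁ v (.lam b))
    (hve : Explicit h₁ v) (hF : F = .lam b) : Good h term ol nl env w (.app s₁ s₂) e := by
  subst hF
  have hrep : Represents h term (.app s₁ s₂) := .app hc hs₁ hs₂
  have hlen : e.length = ol := (wellFormed_susp.1 hwf).2.1
  obtain ⟨tb, hcv, htb⟩ : ∃ tb, h₁[v]? = some (.lam tb) ∧ Represents h₁ tb b := by
    cases hv with
    | ptr ht => exact absurd ht (hve _)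
    | lam ht hs => exact ⟨_, ht, hs⟩
  obtain ⟨s₂', hs₂', hst₂⟩ := ho₁.evolves.represents _ _ hs₂
  obtain ⟨e', he', hste⟩ := ho₁.evolves.env he
  have hlen' : e'.length = ol := hste.length_eq ▸ hlen
  obtain ⟨h₂, a, ha, hra, hev₂, hmono, hmonoE, hframe₂⟩ := arg_spec hs₂' he' hlen' (nl := nl)
  have hst : Steps (wrap (app s₁ s₂) ol nl e)
      (app (wrap (lam b) fo fl fe) (wrap s₂' ol nl e')) :=
    (Steps.wrap_app s₁ s₂ ol nl e).trans (ho₁.steps.app (hst₂.wrap ol nl hste))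
  have hst' := Steps.wrap_beta b (wrap s₂' ol nl e') (nl := fl) ho₁.length
  have hwf₁ := Steps.wellFormed hst ((wellFormed_wrap hlen).2 hwf)
  have hwf' := Steps.wellFormed hst' hwf₁
  -- The β-step contracts a redex on the head path, so the second evaluation is nearer to a head
  -- normal form, although the operand and the environment may have changed in the meantime.
  obtain ⟨m, hm, hNm⟩ :
      ∃ m < N, (susp b (fo + 1) fl (.bndg (wrap s₂' ol nl e') fl :: fe)).den.HeadNormalizes m := by
    have h₁ := (hst.descends ((wellFormed_wrap hlen).2 hwf)).betaStar
    rw [den_wrap hlen] at h₁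
    have h₂ := headStep_betaSusp b (wrap s₂' ol nl e') fo fl fe
    rw [den, ← den_wrap ho₁.length] at h₂
    obtain ⟨m, rfl, hm⟩ := (hN.betaStar h₁).of_headStep h₂
    exact ⟨m, Nat.lt_succ_self m, hm⟩
  obtain ⟨h₃, g, go, gl, genv, G, ge, ⟨n₃, hn₃⟩, ho₃⟩ :=
    ih h₂ tb (fo + 1) fl (.bndg a fl :: fenv) w b (.bndg (wrap s₂' ol nl e') fl :: fe)
      (hmono _ _ htb) (.bndg hra (hmonoE _ _ ho₁.repEnv)) hwf' (.inl ⟨m, hm, hNm⟩)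
  have hsteps : Steps (wrap (app s₁ s₂) ol nl e) (wrap G go gl ge) := by
    have := ho₃.steps
    rw [wrap_of_ne b (by omega)] at this
    exact (hst.trans hst').trans this
  have hev : Evolves h h₃ := (ho₁.evolves.trans hev₂).trans ho₃.evolves
  have hframe : ∀ S, Closed h S → t₁ ∈ S → t₂ ∈ S → EnvIn S env →
      Frame S h h₃ ∧ g ∈ S ∧ EnvIn S genv := by
    intro S hS ht₁ ht₂ hE
    obtain ⟨hf₁, hfS, hfE⟩ := ho₁.frame S hS ht₁ hE
    obtain ⟨hf₂, haS⟩ := hframe₂ S hf₁.closed ht₂ hE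
    have htbS := hf₁.closed.refers (hf₁.closed.deref_mem hfS (hd n₂ le_rfl)) hcv (.lam tb)
    obtain ⟨hf₃, hgS, hgE⟩ := ho₃.frame S hf₂.closed htbS (hfE.bndg haS fl)
    exact ⟨(hf₁.trans hf₂).trans hf₃, hgS, hgE⟩
  have hframe' : ∀ S, Closed h S → term ∈ S → EnvIn S env →
      Frame S h h₃ ∧ g ∈ S ∧ EnvIn S genv := fun S hS ht hE =>
    hframe S hS (hS.refers ht hc (.appL _ _)) (hS.refers ht hc (.appR _ _)) hE
  have hrun : ∀ fuel ≥ max n₁ (max n₂ n₃), hnCo (fuel + 1) h term ol nl env w =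
      updateApp fuel h₃ term (g, go, gl, genv) ol nl := by
    intro fuel hf
    simp [hnCo, hc, hn₁ fuel (by omega), hd fuel (by omega), hcv, ha, hn₃ fuel (by omega)]
  by_cases h0 : (ol = 0 ∧ nl = 0) ∧ go = 0 ∧ gl = 0
  · obtain ⟨⟨rfl, rfl⟩, rfl, rfl⟩ := h0
    obtain ⟨rfl, rfl⟩ := ho₃.repEnv.eq_nil ho₃.length
    obtain ⟨rfl, rfl⟩ := he.eq_nil hlen
    obtain ⟨x, n₄, hx, hxG, -, -⟩ := ho₃.rep.deref
    have hgx : ∀ S, Closed h₃ S → g ∈ S → x ∈ S := fun S hS hg =>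
      hS.deref_mem hg (hx n₄ le_rfl).1
    obtain ⟨hf, hgS, -⟩ := hframe _ (closed_avoid hrep.lt_length)
      (hrep.mem_avoid hc (.appL _ _)) (hrep.mem_avoid hc (.appR _ _)) (envIn_nil _)
    rw [wrap_zero, wrap_zero] at hsteps
    obtain ⟨hev', hupd, hkeep⟩ := Evolves.assign hf hev (notMem_avoid h term) hrep
      (hgx _ hf.closed hgS) hxG hsteps
    refine ⟨h₃.set term (.ptr x), g, 0, 0, [], G, [],
      ⟨max (max n₁ n₄) (max n₂ n₃) + 1, fun fuel hf => ?_⟩, hkeep g G hgS ho₃.rep, .nil, rfl, ?_,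
      .inl ⟨rfl, rfl, ?_⟩, fun _ _ _ _ => hupd, hev', fun S hS ht hE => ?_⟩
    · obtain ⟨fuel, rfl⟩ : ∃ k, fuel = k + 1 := ⟨fuel - 1, by omega⟩
      rw [hrun fuel (by omega)]
      simp [updateApp, (hx fuel (by omega)).2]
    · rwa [wrap_zero, wrap_zero]
    · simpa using ho₃.shape
    · obtain ⟨hf, hgS, -⟩ := hframe' S hS ht hE
      refine ⟨hf.trans (hf.closed.set ht ?_), hgS, envIn_nil S⟩
      rintro v ⟨⟩
      exact hgx S hf.closed hgS
  · refine ⟨h₃, g, go, gl, genv, G, ge, ⟨max n₁ (max n₂ n₃) + 1, fun fuel hf => ?_⟩,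
      ho₃.rep, ho₃.repEnv, ho₃.length, hsteps, ho₃.shape,
      fun h₁ h₂ h₃ h₄ => absurd ⟨⟨h₁, h₂⟩, h₃, h₄⟩ h0, hev, hframe'⟩
    obtain ⟨fuel, rfl⟩ : ∃ k, fuel = k + 1 := ⟨fuel - 1, by omega⟩
    rw [hrun fuel (by omega)]
    unfold updateApp
    split
    · rename_i heq
      cases heq
      simp at h0
    · rfl

/-- The evaluation of an application whose operator has been evaluated to a term with a head. -/
theorem good_app_head {h h₁ : Heap C V} {term t₁ t₂ f v : Loc} {ol nl : ℕ}
    {env : List (EItem Loc)} {w : Bool} {s₁ s₂ F : STerm C V}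
    {e : List (EItem (STerm C V))} {n₁ n₂ : ℕ} (hc : h[term]? = some (.app t₁ t₂))
    (hs₁ : Represents h t₁ s₁) (hs₂ : Represents h t₂ s₂) (he : RepresentsEnv h env e)
    (hwf : (susp (app s₁ s₂) ol nl e).WellFormed)
    (hn₁ : ∀ fuel ≥ n₁, hnCo fuel h t₁ ol nl env true = some (h₁, f, 0, 0, []))
    (ho₁ : Outcome h t₁ ol nl env true s₁ e h₁ f 0 0 [] F [])
    (hd : ∀ fuel ≥ n₂, deref fuel h₁ f = some v) (hv : Represents h₁ v F)
    (hve : Explicit h₁ v) (hF : F.IsHeadApp) : Good h term ol nl env w (.app s₁ s₂) e := by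
  have hrep : Represents h term (.app s₁ s₂) := .app hc hs₁ hs₂
  have hlen : e.length = ol := (wellFormed_susp.1 hwf).2.1
  obtain ⟨s₂', hs₂', hst₂⟩ := ho₁.evolves.represents _ _ hs₂
  obtain ⟨e', he', hste⟩ := ho₁.evolves.env he
  have hlen' : e'.length = ol := hste.length_eq ▸ hlen
  obtain ⟨c, hcv, hcl⟩ : ∃ c, h₁[v]? = some c ∧ ∀ t, c ≠ .lam t := by
    cases hv with
    | ptr ht => exact absurd ht (hve _)
    | lam => cases hF
    | _ ht => exact ⟨_, ht, by simp⟩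
  have hrun : ∀ fuel ≥ max n₁ n₂, hnCo (fuel + 1) h term ol nl env w =
      buildApp fuel h₁ term v t₂ ol nl env := by
    intro fuel hf
    cases c with
    | lam t => exact absurd rfl (hcl t)
    | _ => simp [hnCo, hc, hn₁ fuel (by omega), hd fuel (by omega), hcv]
  have hsteps : Steps (wrap (app s₁ s₂) ol nl e) (app F (wrap s₂' ol nl e')) := by
    have := ho₁.steps
    rw [wrap_zero F] at this
    exact (Steps.wrap_app s₁ s₂ ol nl e).trans (this.app (hst₂.wrap ol nl hste))
  have hframe : ∀ S, Closed h S → t₁ ∈ S → EnvIn S env → Frame S h h₁ ∧ v ∈ S := by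
    intro S hS ht₁ hE
    obtain ⟨hf₁, hfS, -⟩ := ho₁.frame S hS ht₁ hE
    exact ⟨hf₁, hf₁.closed.deref_mem hfS (hd n₂ le_rfl)⟩
  have hres : ∀ r, IsResult w (app F r) := fun r => (STerm.IsHeadApp.app r hF).isResult w
  by_cases h0 : ol = 0 ∧ nl = 0
  · obtain ⟨rfl, rfl⟩ := h0
    obtain ⟨rfl, rfl⟩ := he.eq_nil hlen
    rw [wrap_zero, wrap_zero] at hsteps
    have halloc : ∀ S, Closed h S → t₁ ∈ S → t₂ ∈ S → Frame S h (h₁ ++ [Cell.app v t₂]) := by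
      intro S hS ht₁ ht₂
      obtain ⟨hf, hvS⟩ := hframe S hS ht₁ (envIn_nil S)
      refine hf.trans (hf.closed.alloc ?_)
      intro x hx
      cases hx
      · exact hvS
      · exact ht₂
    have hrep₂ : Represents (h₁ ++ [Cell.app v t₂]) h₁.length (app F s₂') :=
      Represents.app (by simp) (hv.alloc _) (hs₂'.alloc _)
    have hf := halloc _ (closed_avoid hrep.lt_length)
      (hrep.mem_avoid hc (.appL _ _)) (hrep.mem_avoid hc (.appR _ _))
    obtain ⟨hev', hupd, hkeep⟩ := Evolves.assign hf (ho₁.evolves.trans (.alloc hrep₂))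
      (notMem_avoid h term) hrep (closed_avoid hrep.lt_length |>.free _ ho₁.evolves.length_le)
      hrep₂ hsteps
    refine ⟨(h₁ ++ [Cell.app v t₂]).set term (.ptr h₁.length), term, 0, 0, [], app F s₂', [],
      ⟨max n₁ n₂ + 2, fun fuel hf => ?_⟩, hupd, .nil, rfl, by rwa [wrap_zero, wrap_zero],
      .inl ⟨rfl, rfl, hres _⟩, fun _ _ _ _ => hupd, hev', fun S hS ht _ => ?_⟩
    · obtain ⟨fuel, rfl⟩ : ∃ k, fuel = k + 2 := ⟨fuel - 2, by omega⟩
      rw [hrun (fuel + 1) (by omega)]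
      simp [buildApp, alloc, assign]
    · have hf := halloc S hS (hS.refers ht hc (.appL _ _)) (hS.refers ht hc (.appR _ _))
      refine ⟨hf.trans (hf.closed.set ht ?_), ht, envIn_nil S⟩
      rintro x ⟨⟩
      exact hS.free _ ho₁.evolves.length_le
  · have hrep₂ : Represents (h₁ ++ [Cell.susp t₂ ol nl env]) h₁.length (wrap s₂' ol nl e') := by
      rw [wrap_of_ne s₂' h0]
      exact .susp (by simp) (hs₂'.alloc _) (he'.alloc _)
    have hrep₃ : Represents (h₁ ++ [Cell.susp t₂ ol nl env] ++ [Cell.app v h₁.length]) (h₁.length + 1)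
        (app F (wrap s₂' ol nl e')) :=
      Represents.app (by simp) ((hv.alloc _).alloc _) (hrep₂.alloc _)
    refine ⟨h₁ ++ [Cell.susp t₂ ol nl env] ++ [Cell.app v h₁.length], h₁.length + 1, 0, 0, [],
      app F (wrap s₂' ol nl e'), [], ⟨max n₁ n₂ + 1, fun fuel hf => ?_⟩, hrep₃, .nil, rfl,
      by rwa [wrap_zero (app F _)], .inl ⟨rfl, rfl, hres _⟩, fun h₁ h₂ => absurd ⟨h₁, h₂⟩ h0,
      (ho₁.evolves.trans (.alloc hrep₂)).trans (.alloc (by simpa using hrep₃)),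
      fun S hS ht hE => ?_⟩
    · obtain ⟨fuel, rfl⟩ : ∃ k, fuel = k + 1 := ⟨fuel - 1, by omega⟩
      rw [hrun fuel (by omega)]
      unfold buildApp
      split
      · simp at h0
      · simp [alloc]
    · obtain ⟨hf, hvS⟩ := hframe S hS (hS.refers ht hc (.appL _ _)) hE
      have ha : h₁.length ∈ S := hf.closed.free _ le_rfl
      have hf₂ : Frame S h₁ (h₁ ++ [Cell.susp t₂ ol nl env]) := by
        refine hf.closed.alloc ?_
        intro x hx
        cases hx with
        | susp => exact hS.refers ht hc (.appR _ _)
        | env _ _ _ _ _ l hm => exact hE x l hm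
      have hf₃ : Frame S (h₁ ++ [Cell.susp t₂ ol nl env])
          (h₁ ++ [Cell.susp t₂ ol nl env] ++ [Cell.app v h₁.length]) := by
        refine hf₂.closed.alloc ?_
        intro x hx
        cases hx
        · exact hvS
        · exact ha
      exact ⟨(hf.trans hf₂).trans hf₃, hf.closed.free _ (Nat.le_succ _), envIn_nil S⟩

theorem good_app {N : ℕ} {h : Heap C V} {term t₁ t₂ : Loc} {ol nl : ℕ} {env : List (EItem Loc)}
    {w : Bool} {s₁ s₂ : STerm C V} {e : List (EItem (STerm C V))}
    (hc : h[term]? = some (.app t₁ t₂)) (hs₁ : Represents h t₁ s₁) (hs₂ : Represents h t₂ s₂)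
    (he : RepresentsEnv h env e) (hwf : (susp (app s₁ s₂) ol nl e).WellFormed)
    (hN : (susp (app s₁ s₂) ol nl e).den.HeadNormalizes N)
    (ih : GoodBelow C V N (susp (app s₁ s₂) ol nl e).cost) :
    Good h term ol nl env w (.app s₁ s₂) e := by
  obtain ⟨h₁, f, fo, fl, fenv, F, fe, ⟨n₁, hn₁⟩, ho₁⟩ :=
    ih h t₁ ol nl env true s₁ e hs₁ he hwf.susp_app.1
      (.inr ⟨hN.of_map (f := fun x => DTerm.app x (s₂.den.subst (denEnv e nl)))
        fun _ _ h => h.appL _, by simp only [cost, den, DTerm.headVar]; omega⟩)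
  obtain ⟨v, n₂, hd, hv, hve, -⟩ := ho₁.rep.deref
  have hd' : ∀ fuel ≥ n₂, deref fuel h₁ f = some v := fun fuel hf => (hd fuel hf).1
  have hF : (∃ b, F = .lam b) ∨ (fo = 0 ∧ fl = 0) ∧ F.IsHeadApp := by
    rcases ho₁.shape with ⟨h₁, h₂, hF | hF⟩ | ⟨-, -, b, hb⟩
    · exact .inr ⟨⟨h₁, h₂⟩, hF⟩
    · exact .inl hF
    · have hr := ho₁.rep
      cases hr with
      | lam => exact .inl ⟨_, rfl⟩
      | _ ht => rw [ht] at hb; cases hb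
  rcases hF with ⟨b, rfl⟩ | ⟨⟨rfl, rfl⟩, hF⟩
  · exact good_app_lam hc hs₁ hs₂ he hwf hN ih hn₁ ho₁ hd' hv hve rfl
  · obtain ⟨rfl, rfl⟩ := ho₁.repEnv.eq_nil ho₁.length
    exact good_app_head hc hs₁ hs₂ he hwf hn₁ ho₁ hd' hv hve hF

/-! ### Suspensions -/

/-- `mkExplicit` replaces the suspension `term`, which represents `s`, by the result of its
evaluation.  If the evaluation is to go on in a nontrivial environment, then a new term `Q` is
represented by `term` that is not a suspension. -/
theorem mkExplicit_spec {h h₁ : Heap C V} {term t f : Loc} {ol₁ nl₁ fo fl : ℕ}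
    {env₁ fenv : List (EItem Loc)} {w : Bool} {s s₁ F : STerm C V}
    {e₁ fe : List (EItem (STerm C V))} (hc : h[term]? = some (.susp t ol₁ nl₁ env₁))
    (hs : Represents h term s)
    (ho : Outcome h t ol₁ nl₁ env₁ w s₁ e₁ h₁ f fo fl fenv F fe)
    (hst : Steps s (wrap F fo fl fe)) (ol nl : ℕ) :
    ∃ (h₂ : Heap C V) (q : Quad) (Q : STerm C V) (n : ℕ),
      (∀ fuel ≥ n, mkExplicit fuel h₁ term (f, fo, fl, fenv) ol nl = some (h₂, q)) ∧
      Represents h₂ term Q ∧ Steps s Q ∧ (¬ (ol = 0 ∧ nl = 0) → ¬ Q.IsSusp) ∧ Evolves h h₂ ∧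
      (∀ S, Closed h S → term ∈ S → Frame S h h₂ ∧ f ∈ S ∧ EnvIn S fenv) ∧
      (ol = 0 → nl = 0 → q = (f, fo, fl, fenv)) ∧ Represents h₂ f F ∧ RepresentsEnv h₂ fenv fe ∧
      (fo = 0 → fl = 0 → Q = F) ∧
      ∀ c : Cell C V, h₁[f]? = some c → h₂[f]? = some c := by
  have hin : ∀ S, Closed h S → t ∈ S → EnvIn S env₁ → Frame S h h₁ ∧ f ∈ S ∧ EnvIn S fenv :=
    ho.frame
  have hchild : t ∈ avoid h term ∧ EnvIn (avoid h term) env₁ :=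
    ⟨hs.mem_avoid hc (.susp _ _ _ _), fun v l hv => hs.mem_avoid hc (.env _ _ _ _ _ _ hv)⟩
  have hchild' : ∀ S, Closed h S → term ∈ S → t ∈ S ∧ EnvIn S env₁ := fun S hS ht =>
    ⟨hS.refers ht hc (.susp _ _ _ _), fun v l hv => hS.refers ht hc (.env _ _ _ _ _ _ hv)⟩
  have hclosed := closed_avoid hs.lt_length
  -- The three clauses of `mkExplicit` differ in the cells that they add to `h₁` before the
  -- assignment, and in the location `x` of the term that replaces the suspension.
  suffices ∃ (k : Heap C V) (x : Loc) (q : Quad) (Q : STerm C V) (n : ℕ),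
      (∀ fuel ≥ n, mkExplicit fuel h₁ term (f, fo, fl, fenv) ol nl =
        some (k.set term (.ptr x), q)) ∧
      (∀ S, Closed h S → t ∈ S → EnvIn S env₁ → Frame S h k ∧ x ∈ S) ∧ Evolves h k ∧
      Represents k x Q ∧ Steps s Q ∧ Represents k f F ∧ RepresentsEnv k fenv fe ∧
      (∀ c : Cell C V, h₁[f]? = some c → k[f]? = some c) ∧
      (¬ (ol = 0 ∧ nl = 0) → ¬ Q.IsSusp) ∧ (ol = 0 → nl = 0 → q = (f, fo, fl, fenv)) ∧
      (fo = 0 → fl = 0 → Q = F) by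
    obtain ⟨k, x, q, Q, n, hrun, hfr, hev, hx, hsQ, hfF, hfe, hcell, hQ, hq, hQF⟩ := this
    obtain ⟨hf, hxS⟩ := hfr _ hclosed hchild.1 hchild.2
    obtain ⟨-, hfS, hfE⟩ := hin _ hclosed hchild.1 hchild.2
    obtain ⟨hev', hupd, hkeep⟩ := Evolves.assign hf hev (notMem_avoid h term) hs hxS hx hsQ
    refine ⟨k.set term (.ptr x), q, Q, n, hrun, hupd, hsQ, hQ, hev', fun S hS ht => ?_, hq,
      hkeep f F hfS hfF, ?_, hQF, fun c hc => ?_⟩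
    · obtain ⟨hf, hxS⟩ := hfr S hS (hchild' S hS ht).1 (hchild' S hS ht).2
      obtain ⟨-, hfS, hfE⟩ := hin S hS (hchild' S hS ht).1 (hchild' S hS ht).2
      refine ⟨hf.trans (hf.closed.set ht ?_), hfS, hfE⟩
      rintro v ⟨⟩
      exact hxS
    · refine hfe.of_agree hf.closed (fun v hv c hc => ?_) hfE
      rwa [List.getElem?_set_ne (fun hxv : term = v => notMem_avoid h term (hxv ▸ hv))]
    · rw [List.getElem?_set_ne (fun hxv : term = f => notMem_avoid h term (hxv ▸ hfS))]
      exact hcell c hc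
  by_cases hq : fo = 0 ∧ fl = 0
  · obtain ⟨rfl, rfl⟩ := hq
    obtain ⟨rfl, rfl⟩ := ho.repEnv.eq_nil ho.length
    obtain ⟨x, n, hx, hxF, -, -⟩ := ho.rep.deref
    have hF : IsResult w F := by simpa using ho.shape
    rw [wrap_zero] at hst
    refine ⟨h₁, x, (f, 0, 0, []), F, n, fun fuel hf => ?_, fun S hS ht hE => ?_, ho.evolves,
      hxF, hst, ho.rep, .nil, fun _ h => h, fun _ => hF.not_isSusp, fun _ _ => rfl,
      fun _ _ => rfl⟩
    · simp [mkExplicit, (hx fuel hf).2]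
    · obtain ⟨hf, hfS, -⟩ := hin S hS ht hE
      exact ⟨hf, hf.closed.deref_mem hfS (hx n le_rfl).1⟩
  rw [wrap_of_ne F hq] at hst
  by_cases h0 : ol = 0 ∧ nl = 0
  · obtain ⟨rfl, rfl⟩ := h0
    have hrep : Represents (h₁ ++ [Cell.susp f fo fl fenv]) h₁.length (susp F fo fl fe) :=
      Represents.susp (by simp) (ho.rep.alloc _) (ho.repEnv.alloc _)
    refine ⟨h₁ ++ [Cell.susp f fo fl fenv], h₁.length, (f, fo, fl, fenv), susp F fo fl fe, 1,
      fun fuel hf => ?_, fun S hS ht hE => ?_, ho.evolves.trans (.alloc hrep), hrep, hst,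
      ho.rep.alloc _, ho.repEnv.alloc _, fun c hc => ?_, fun h => absurd ⟨rfl, rfl⟩ h,
      fun _ _ => rfl, fun h₁ h₂ => absurd ⟨h₁, h₂⟩ hq⟩
    · obtain ⟨fuel, rfl⟩ : ∃ k, fuel = k + 1 := ⟨fuel - 1, by omega⟩
      unfold mkExplicit
      split
      · rename_i heq
        cases heq
        simp at hq
      · rename_i heq _ _
        cases heq
        simp [alloc, assign]
      · rename_i heq
        simp at heq
    · obtain ⟨hf, hfS, hfE⟩ := hin S hS ht hE
      refine ⟨hf.trans (hf.closed.alloc ?_), hf.closed.free _ le_rfl⟩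
      intro v hv
      cases hv with
      | susp => exact hfS
      | env _ _ _ _ _ l hm => exact hfE v l hm
    · rwa [List.getElem?_append_left (List.getElem?_eq_some_iff.1 hc).1]
  · obtain ⟨b, hb⟩ : ∃ b, h₁[f]? = some (.lam b) := by
      rcases ho.shape with ⟨h₁, h₂, -⟩ | ⟨-, -, hb⟩
      · exact absurd ⟨h₁, h₂⟩ hq
      · exact hb
    obtain ⟨r, rfl, hr⟩ : ∃ r, F = .lam r ∧ Represents h₁ b r := by
      have hr := ho.rep
      cases hr with
      | lam ht hr => rw [hb] at ht; cases ht; exact ⟨_, rfl, hr⟩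
      | _ ht => rw [hb] at ht; cases ht
    have hrep₁ : Represents (h₁ ++ [Cell.susp b (fo + 1) (fl + 1) (.dum fl :: fenv)]) h₁.length
        (susp r (fo + 1) (fl + 1) (.dum fl :: fe)) :=
      Represents.susp (by simp) (hr.alloc _) (.dum (ho.repEnv.alloc _))
    have hrep₂ : Represents (h₁ ++ [Cell.susp b (fo + 1) (fl + 1) (.dum fl :: fenv)] ++
        [Cell.lam h₁.length]) (h₁.length + 1)
        (lam (susp r (fo + 1) (fl + 1) (.dum fl :: fe))) :=
      Represents.lam (by simp) (hrep₁.alloc _)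
    refine ⟨h₁ ++ [Cell.susp b (fo + 1) (fl + 1) (.dum fl :: fenv)] ++ [Cell.lam h₁.length],
      h₁.length + 1, (term, 0, 0, []), lam (susp r (fo + 1) (fl + 1) (.dum fl :: fe)), 1,
      fun fuel hf => ?_, fun S hS ht hE => ?_,
      (ho.evolves.trans (.alloc hrep₁)).trans (.alloc (by simpa using hrep₂)), hrep₂,
      hst.tail (.root (.read (.r7 _ _ _ _))), (ho.rep.alloc _).alloc _,
      (ho.repEnv.alloc _).alloc _, fun c hc => ?_, fun _ => id,
      fun h₁ h₂ => absurd ⟨h₁, h₂⟩ h0, fun h₁ h₂ => absurd ⟨h₁, h₂⟩ hq⟩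
    · obtain ⟨fuel, rfl⟩ : ∃ k, fuel = k + 1 := ⟨fuel - 1, by omega⟩
      unfold mkExplicit
      split
      · rename_i heq
        cases heq
        simp at hq
      · simp at h0
      · rename_i heq _
        cases heq
        simp [alloc, assign, hb]
    · obtain ⟨hf, hfS, hfE⟩ := hin S hS ht hE
      have hf₂ : Frame S h₁ (h₁ ++ [Cell.susp b (fo + 1) (fl + 1) (.dum fl :: fenv)]) := by
        refine hf.closed.alloc ?_
        intro v hv
        cases hv with
        | susp => exact hf.closed.refers hfS hb (.lam b)
        | env _ _ _ _ _ l hm => exact hfE.dum fl v l hm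
      refine ⟨(hf.trans hf₂).trans (hf₂.closed.alloc ?_), hf.closed.free _ (Nat.le_succ _)⟩
      rintro v ⟨⟩
      exact hf.closed.free _ le_rfl
    · rwa [List.getElem?_append_left, List.getElem?_append_left]
      · exact (List.getElem?_eq_some_iff.1 hc).1
      · simp only [List.length_append, List.length_singleton]
        exact (List.getElem?_eq_some_iff.1 hc).1.trans (Nat.lt_succ_self _)

theorem good_susp {N : ℕ} {h : Heap C V} {term t : Loc} {ol₁ nl₁ ol nl : ℕ}
    {env₁ env : List (EItem Loc)} {w : Bool} {s₁ : STerm C V} {e₁ e : List (EItem (STerm C V))}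
    (hc : h[term]? = some (.susp t ol₁ nl₁ env₁)) (hs₁ : Represents h t s₁)
    (he₁ : RepresentsEnv h env₁ e₁) (he : RepresentsEnv h env e)
    (hwf : (susp (susp s₁ ol₁ nl₁ e₁) ol nl e).WellFormed)
    (hN : (susp (susp s₁ ol₁ nl₁ e₁) ol nl e).den.HeadNormalizes N)
    (ih : GoodBelow C V N (susp (susp s₁ ol₁ nl₁ e₁) ol nl e).cost) :
    Good h term ol nl env w (.susp s₁ ol₁ nl₁ e₁) e := by
  have hrep : Represents h term (.susp s₁ ol₁ nl₁ e₁) := .susp hc hs₁ he₁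
  have hlen : e.length = ol := (wellFormed_susp.1 hwf).2.1
  have hwf₁ := (wellFormed_susp.1 hwf).1
  obtain ⟨h₁, f, fo, fl, fenv, F, fe, ⟨n₁, hn₁⟩, ho₁⟩ := ih h t ol₁ nl₁ env₁ w s₁ e₁ hs₁ he₁ hwf₁
    (.inr ⟨hN.of_map (f := fun x => x.subst (denEnv e nl)) fun _ _ h => h.subst _, by
      have := cost_pos (susp s₁ ol₁ nl₁ e₁)
      rw [cost.eq_6 (susp s₁ ol₁ nl₁ e₁)]
      omega⟩)
  have hst : Steps (susp s₁ ol₁ nl₁ e₁) (wrap F fo fl fe) :=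
    (Steps.susp_wrap (wellFormed_susp.1 hwf₁).2.1).trans ho₁.steps
  obtain ⟨h₂, q, Q, n₂, hn₂, hQ, hsQ, hQs, hev, hframe, hq, hF, hFe, hQF, hcell⟩ :=
    mkExplicit_spec hc hrep ho₁ hst ol nl
  by_cases h0 : ol = 0 ∧ nl = 0
  · obtain ⟨rfl, rfl⟩ := h0
    obtain rfl := hq rfl rfl
    refine ⟨h₂, f, fo, fl, fenv, F, fe, ⟨max n₁ n₂ + 1, fun fuel hf => ?_⟩, hF, hFe, ho₁.length,
      ?_, ?_, ?_, hev, fun S hS ht _ => hframe S hS ht⟩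
    · obtain ⟨fuel, rfl⟩ : ∃ k, fuel = k + 1 := ⟨fuel - 1, by omega⟩
      simp [hnCo, hc, hn₁ fuel (by omega), hn₂ fuel (by omega)]
    · rwa [wrap_zero]
    · rcases ho₁.shape with hsh | ⟨hw, hne, b, hb⟩
      · exact .inl hsh
      · exact .inr ⟨hw, hne, b, hcell _ hb⟩
    · intro _ _ h₃ h₄
      rwa [← hQF h₃ h₄]
  · obtain ⟨e', he', hste⟩ := hev.env he
    have hst₂ : Steps (susp (susp s₁ ol₁ nl₁ e₁) ol nl e) (susp Q ol nl e') :=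
      Star.susp hsQ ol nl hste
    have hwfQ : (susp Q ol nl e).WellFormed := Steps.wellFormed (Star.susp_left hsQ ol nl e) hwf
    -- The term at `term` is no longer a suspension, which lowers the measures strictly; the changes in
    -- the environment do not raise them.
    have hdesc : Descends 1 (susp (susp s₁ ol₁ nl₁ e₁) ol nl e) (susp Q ol nl e') :=
      ((Steps.descends_one hsQ hwf₁ trivial (hQs h0)).susp_left ol nl e).trans
        (Steps.descends (Star.susp_right Q ol nl hste) hwfQ)
    obtain ⟨h₃, g, go, gl, genv, G, ge, ⟨n₃, hn₃⟩, ho₃⟩ := ih h₂ term ol nl env w Q e' hQ he'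
      (Steps.wellFormed hst₂ hwf) (hdesc.below hN)
    refine ⟨h₃, g, go, gl, genv, G, ge, ⟨max n₁ (max n₂ n₃) + 1, fun fuel hf => ?_⟩,
      ho₃.rep, ho₃.repEnv, ho₃.length, (hsQ.wrap ol nl hste).trans ho₃.steps, ho₃.shape,
      fun h₁ h₂ => absurd ⟨h₁, h₂⟩ h0, hev.trans ho₃.evolves, fun S hS ht hE => ?_⟩
    · obtain ⟨fuel, rfl⟩ : ∃ k, fuel = k + 1 := ⟨fuel - 1, by omega⟩
      simp [hnCo, hc, h0, hn₁ fuel (by omega), hn₂ fuel (by omega), hn₃ fuel (by omega)]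
    · obtain ⟨hf, -, -⟩ := hframe S hS ht
      obtain ⟨hf₃, hg, hgE⟩ := ho₃.frame S hf.closed ht hE
      exact ⟨hf.trans hf₃, hg, hgE⟩

/-! ### Termination and correctness -/

theorem good_of_goodBelow {N : ℕ} {h : Heap C V} {term : Loc} {ol nl : ℕ}
    {env : List (EItem Loc)} {w : Bool} {s : STerm C V} {e : List (EItem (STerm C V))}
    (hs : Represents h term s) (he : RepresentsEnv h env e) (hwf : (susp s ol nl e).WellFormed)
    (hN : (susp s ol nl e).den.HeadNormalizes N)
    (ih : GoodBelow C V N (susp s ol nl e).cost) : Good h term ol nl env w s e := by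
  have explicit : ∀ {v : Loc}, Represents h v s → Explicit h v → Good h v ol nl env w s e := by
    intro v hv hve
    cases hv with
    | const hc => exact good_const hc ol nl env w e
    | fv hc => exact good_fv hc ol nl env w e
    | bv hc => exact good_bv hc he hwf hN ih
    | ptr hc => exact absurd hc (hve _)
    | lam hc hb =>
      cases w with
      | true => exact good_lam_whnf hc hb he hwf
      | false => exact good_lam hc hb he hwf hN ih
    | app hc h₁ h₂ => exact good_app hc h₁ h₂ he hwf hN ih
    | susp hc h₁ h₂ => exact good_susp hc h₁ h₂ he hwf hN ih
  obtain ⟨v, n, hd, hv, hve, hterm⟩ := hs.deref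
  by_cases hex : Explicit h term
  · exact explicit hs hex
  · obtain ⟨t, ht⟩ : ∃ t, h[term]? = some (.ptr t) := by simpa [Explicit] using hex
    exact good_ptr ht hs he (wellFormed_susp.1 hwf).2.1 (fun fuel hf => (hd fuel hf).1)
      (explicit hv hve)

/-- Induction on the number of contractions that lead to a head normal form and, for a given
number, on the weight of the head path. -/
theorem goodBelow (C V : Type*) (N c : ℕ) : GoodBelow C V N c := by
  induction N using Nat.strong_induction_on generalizing c with
  | _ N ihN =>
    induction c using Nat.strong_induction_on with
    | _ c ihc =>
      rintro h term ol nl env w s e hs he hwf (⟨m, hm, hN⟩ | ⟨hN, hlt⟩)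
      · exact good_of_goodBelow hs he hwf hN (ihN m hm _)
      · exact good_of_goodBelow hs he hwf hN (ihc _ hlt)

/-- References that are acyclic stay so: a cycle through changed or new locations is excluded
because these represent terms, and any other cycle was there before. -/
theorem acyclic_of_frame {h h' : Heap C V} (hev : Evolves h h')
    (hf : ∀ S, Closed h S → (∀ u s, Represents h u s → u ∈ S) → Frame S h h') {u : Loc}
    (hu : Acyclic h u) : Acyclic h' u := by
  let S : Set Loc := {u | (∃ s, Represents h u s) ∨ h.length ≤ u}
  have hS : Closed h S := by
    refine ⟨fun u hu => .inr hu, fun u v hu huv => ?_⟩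
    rcases hu with ⟨s, hs⟩ | hu
    · exact .inl (hs.edge huv)
    · obtain ⟨c, hc, -⟩ := huv
      rw [List.getElem?_eq_none hu] at hc
      cases hc
  have hfS := hf S hS fun u s hs => .inl ⟨s, hs⟩
  have hrep : ∀ v ∈ S, ¬ Relation.TransGen (Edge h') v v := by
    intro v hv hcyc
    obtain ⟨w, ⟨c, hc, -⟩, -⟩ := Relation.TransGen.head'_iff.1 hcyc
    have hlt := (List.getElem?_eq_some_iff.1 hc).1
    obtain ⟨s, hs⟩ : ∃ s, Represents h' v s := by
      rcases hv with ⟨s, hs⟩ | hv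
      · obtain ⟨s', hs', -⟩ := hev.represents v s hs
        exact ⟨s', hs'⟩
      · exact hev.new v hv hlt
    exact hs.not_transGen hcyc
  have hedge : ∀ {a b : Loc}, a ∉ S → Edge h' a b → Edge h a b := by
    rintro a b ha ⟨c, hc, hb⟩
    exact ⟨c, hfS.agree a ha ▸ hc, hb⟩
  have hback : ∀ {a b : Loc}, b ∉ S → Relation.ReflTransGen (Edge h') a b →
      a ∉ S ∧ Relation.ReflTransGen (Edge h) a b := by
    intro a b hb hab
    induction hab using Relation.ReflTransGen.head_induction_on with
    | refl => exact ⟨hb, .refl⟩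
    | head hac _ ih =>
      have ha := fun ha => ih.1 (hfS.closed.edge _ _ ha hac)
      exact ⟨ha, .head (hedge ha hac) ih.2⟩
  intro v huv hcyc
  by_cases hv : v ∈ S
  · exact hrep v hv hcyc
  · obtain ⟨w, hvw, hwv⟩ := Relation.TransGen.head'_iff.1 hcyc
    exact hu v (hback hv huv).2 (.head' (hedge hv hvw) (hback hv hwv).2)

end Evaluator

end Suspension

theorem mainTheorem2 {C V : Type*}
    (h : Suspension.Heap C V) (t' : Suspension.Loc)
    (t : Suspension.STerm C V) (d : Suspension.DTerm C V)
    (hacyclic : Suspension.Acyclic h t')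
    (hrep : Suspension.Represents h t' t)
    (hwf : t.WellFormed)
    (hread : t.ReadStar d.toSTerm)
    (hhnf : d.HasHNF) :
    ∃ h' : Suspension.Heap C V,
      Suspension.HeadNorm3Yields h t' h' ∧
      (∀ u, Suspension.Acyclic h u → Suspension.Acyclic h' u) ∧
      ∃ r : Suspension.STerm C V,
        Suspension.Represents h' t' r ∧ r.WellFormed ∧ r.IsGenHNFOf t ∧
        ∃ d' : Suspension.DTerm C V, r.ReadStar d'.toSTerm ∧ d'.IsHNFOf d := by
  have hd : t.den = d := by
    rw [← hread.den_eq hwf, Suspension.STerm.den_toSTerm]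
  obtain ⟨N, hN⟩ := hhnf.headNormalizes
  rw [← hd, ← Suspension.STerm.den_susp_zero] at hN
  obtain ⟨h', f, fo, fl, fenv, r, re, ⟨n, hn⟩, ho⟩ :=
    Suspension.goodBelow C V N _ h t' 0 0 [] false t [] hrep .nil
      (Suspension.STerm.wellFormed_susp_nil.2 hwf) (.inr ⟨hN, Nat.lt_succ_self _⟩)
  obtain ⟨rfl, rfl, hr⟩ : fo = 0 ∧ fl = 0 ∧ Suspension.IsResult false r := by simpa using ho.shape
  have hst := ho.steps
  rw [Suspension.STerm.wrap_zero, Suspension.STerm.wrap_zero] at hst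
  have hwfr := Suspension.STerm.Steps.wellFormed hst hwf
  refine ⟨h', ⟨_, n, hn⟩, fun u hu => Suspension.acyclic_of_frame ho.evolves
    (fun S hS hrS => (ho.frame S hS (hrS t' t hrep) (Suspension.envIn_nil S)).1) hu,
    r, ho.update rfl rfl rfl rfl, hwfr, ⟨hr, hst.rewriteStar⟩, r.den, hwfr.readStar_den,
    hr.den, ?_⟩
  rw [← hd]
  exact (hst.descends hwf).betaStar
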